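/- Let $L,m,A,B_1,B_2,B_3,B_4,C,\varsigma,\gamma,\beta,h_2,h_3>0$ and put $$\tilde A=A-\frac{\gamma^2\beta B_3^2}{B_4},\qquad \tilde B=B_1-\frac{\gamma B_2B_3}{B_4},\qquad \tilde C=C+\frac{\gamma h_2h_3B_2^2}{B_4},$$ where $\tilde A>0$ and $\tilde B>0$ are assumed. Let $P_\varsigma=(\varsigma\tilde C-D_x^2)^{-1}$ on $L^2(0,L)$ with the conditions $u(0)=u_x(L)=0$, that is, $(P_\varsigma f)(x)=\int_0^L g(x,z)f(z)\,dz$ with $$g(x,z)=\frac{\cosh[r(\max(x,z)-L)]\,\sinh[r\min(x,z)]}{r\cosh(rL)},\qquad r=\sqrt{\varsigma\tilde C},$$ and let $J_\varsigma=\varsigma\tilde C P_\varsigma-I$. Let $H^2_L(0,L)=\{\psi\in H^2(0,L):\psi(0)=\psi_x(0)=0\}$ (complex-valued functions) and $\mathcal H=H^2_L(0,L)\times L^2(0,L)$, with the energy norm $$\|(w,v)\|_{\mathcal H}^2=\int_0^L\left\{m|v|^2+\tilde A|w_{xx}|^2-\gamma\beta\varsigma h_2h_3\tilde B^2\,(J_\varsigma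 w_x)\,\bar w_x\right\}dx ,$$ which is equivalent to the product norm of $H^2(0,L)\times L^2(0,L)$. Consider the Mead-Marcus smart beam $$m\ddot w+\tilde A w_{xxxx}+\gamma\beta\varsigma h_2h_3\tilde B^2(J_\varsigma w_x)_x=-\frac{\gamma}{B_4}\left[\varsigma h_2h_3\tilde B B_2(P_\varsigma\delta_L)_x+B_3(\delta_L)_x\right]V(t)$$ on $(0,L)$, where $\delta_L$ is the Dirac distribution at $x=L$, with $w(0)=w_x(0)=0$, with the natural (free) conditions at $x=L$, and with the voltage feedback $$V(t)=-k_1\left[\varsigma h_2h_3\tilde B B_2\,(P_\varsigma\dot w_x)(L)+B_3\,\dot w_x(L)\right],\qquad k_1>0,$$ the equation being understood in weak form, tested against all $\psi\in H^2_L(0,L)$. Put $\ell(\psi)=\varsigma h_2h_3\tilde BB_2(P_\varsigma\psi_x)(L)+B_3\psi_x(L)$. The corresponding closed-loop operator $\tilde{\mathcal A}$ on $\mathcal H$ maps $(w,v)$ to $(v,f)$, its domain being the set of all $(w,v)\in H^2_L(0,L)\times H^2_L(0,L)$ for which there is an $f\in L^2(0,L)$ with $$m\int_0^L f\bar\psi\,dx+\int_0^L\left\{\tilde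 A w_{xx}\bar\psi_{xx}-\gamma\beta\varsigma h_2h_3\tilde B^2(J_\varsigma w_x)\bar\psi_x\right\}dx=-\frac{\gamma k_1}{B_4}\,\ell(v)\,\overline{\ell(\psi)}\qquad\text{for all }\psi\in H^2_L(0,L).$$ **Theorem.** The closed-loop system $\dot\Phi=\tilde{\mathcal A}\Phi$, $\Phi(0)=\Phi^0$, is strongly stable in $\mathcal H$: the operator $\tilde{\mathcal A}$ is the generator of a $C_0$-semigroup $(S(t))_{t\ge0}$ on $\mathcal H$, and for every initial state $\Phi^0\in\mathcal H$ the solution $\Phi(t)=S(t)\Phi^0$ satisfies $\Phi(t)\to0$ in $\mathcal H$ as $t\to\infty$; in particular its energy $\frac12\|\Phi(t)\|_{\mathcal H}^2$ tends to $0$. -/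

import Mathlib

open MeasureTheory Filter Topology Set
open scoped ComplexConjugate

noncomputable section

/-- Data of the electrostatic Mead-Marcus smart beam of length `L`: inertia `m`, material
coefficients, piezoelectric constants `γ`, `β`, and thicknesses `h₂`, `h₃` of two of the layers. -/
structure SmartBeam where
  L : ℝ
  m : ℝ
  A : ℝ
  B₁ : ℝ
  B₂ : ℝ
  B₃ : ℝ
  B₄ : ℝ
  C : ℝ
  ς : ℝ
  γ : ℝ
  β : ℝ
  h₂ : ℝ
  h₃ : ℝ
  L_pos : 0 < L
  m_pos : 0 < m
  A_pos : 0 < A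
  B₁_pos : 0 < B₁
  B₂_pos : 0 < B₂
  B₃_pos : 0 < B₃
  B₄_pos : 0 < B₄
  C_pos : 0 < C
  ς_pos : 0 < ς
  γ_pos : 0 < γ
  β_pos : 0 < β
  h₂_pos : 0 < h₂
  h₃_pos : 0 < h₃
  At_pos : 0 < A - γ ^ 2 * β * B₃ ^ 2 / B₄
  Bt_pos : 0 < B₁ - γ * B₂ * B₃ / B₄

/-- Complex `L²(0, L)`. -/
abbrev L2I (L : ℝ) : Type := Lp ℂ 2 (volume.restrict (Ioc (0 : ℝ) L))

theorem L2I.intervalIntegrable {L : ℝ} (f : L2I L) {x : ℝ} (hx : x ∈ Ioc (0 : ℝ) L) :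
    IntervalIntegrable (f : ℝ → ℂ) volume 0 x := by
  have h : IntegrableOn (f : ℝ → ℂ) (Ioc (0 : ℝ) L) volume :=
    (Lp.memLp f).integrable (by norm_num)
  rw [intervalIntegrable_iff_integrableOn_Ioc_of_le hx.1.le]
  exact h.mono_set (Ioc_subset_Ioc_right hx.2)

theorem L2I.primitive_congr {L : ℝ} {f g : ℝ → ℂ}
    (h : f =ᵐ[volume.restrict (Ioc (0 : ℝ) L)] g) {x : ℝ} (hx : x ∈ Ioc (0 : ℝ) L) :
    ∫ s in (0 : ℝ)..x, f s = ∫ s in (0 : ℝ)..x, g s := by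
  rw [intervalIntegral.integral_of_le hx.1.le, intervalIntegral.integral_of_le hx.1.le]
  exact integral_congr_ae
    (ae_restrict_of_ae_restrict_of_subset (Ioc_subset_Ioc_right hx.2) h)

/-- `IsPrimitive f g`: `f` is the absolutely continuous function with `f(0) = 0` and
derivative `g ∈ L²(0, L)`; that is, `f ∈ H¹(0, L)`, `f(0) = 0`, `f_x = g`. -/
def IsPrimitive {L : ℝ} (f g : L2I L) : Prop :=
  ∀ᵐ x ∂(volume.restrict (Ioc (0 : ℝ) L)), f x = ∫ s in (0 : ℝ)..x, g s

theorem IsPrimitive.zero {L : ℝ} : IsPrimitive (0 : L2I L) 0 := by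
  filter_upwards [Lp.coeFn_zero ℂ 2 (volume.restrict (Ioc (0 : ℝ) L)),
    ae_restrict_mem measurableSet_Ioc] with x h0 hx
  rw [h0, L2I.primitive_congr (Lp.coeFn_zero ℂ 2 (volume.restrict (Ioc (0 : ℝ) L))) hx]
  simp

theorem IsPrimitive.add {L : ℝ} {f g f' g' : L2I L} (h : IsPrimitive f g)
    (h' : IsPrimitive f' g') : IsPrimitive (f + f') (g + g') := by
  filter_upwards [h, h', Lp.coeFn_add f f', ae_restrict_mem measurableSet_Ioc]
    with x h1 h2 h3 hx
  rw [h3, L2I.primitive_congr (Lp.coeFn_add g g') hx, Pi.add_apply, h1, h2]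
  exact (intervalIntegral.integral_add (g.intervalIntegrable hx) (g'.intervalIntegrable hx)).symm

theorem IsPrimitive.smul {L : ℝ} (c : ℂ) {f g : L2I L} (h : IsPrimitive f g) :
    IsPrimitive (c • f) (c • g) := by
  filter_upwards [h, Lp.coeFn_smul c f, ae_restrict_mem measurableSet_Ioc] with x h1 h3 hx
  rw [h3, L2I.primitive_congr (Lp.coeFn_smul c g) hx, Pi.smul_apply, h1]
  exact (intervalIntegral.integral_smul c _).symm

/-- The space `{w ∈ H²(0, L) : w(0) = w_x(0) = 0}`. A function of this space is stored
together with its derivatives, as the triple `(w, w_x, w_xx)`, and carries the corresponding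
`H²`-norm (the largest of the `L²`-norms of `w`, `w_x`, `w_xx`). -/
def H2L (L : ℝ) : Submodule ℂ (L2I L × L2I L × L2I L) where
  carrier := {w | IsPrimitive w.1 w.2.1 ∧ IsPrimitive w.2.1 w.2.2}
  zero_mem' := ⟨IsPrimitive.zero, IsPrimitive.zero⟩
  add_mem' := fun h h' => ⟨h.1.add h'.1, h.2.add h'.2⟩
  smul_mem' := fun c _ h => ⟨h.1.smul c, h.2.smul c⟩

/-- The underlying function `w`. -/
def H2L.val {L : ℝ} (w : H2L L) : L2I L := (w : L2I L × L2I L × L2I L).1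

/-- The second derivative `w_xx`. -/
def H2L.dxx {L : ℝ} (w : H2L L) : L2I L := (w : L2I L × L2I L × L2I L).2.2

/-- The continuous representative of the first derivative `w_x`, which vanishes at `0`. -/
def H2L.dx {L : ℝ} (w : H2L L) (x : ℝ) : ℂ := ∫ s in (0 : ℝ)..x, H2L.dxx w s

/-- The state space `H²_L(0, L) × L²(0, L)` of pairs `(w, ẇ)`. -/
abbrev BeamState (L : ℝ) : Type := H2L L × L2I L

namespace SmartBeam

/-- `Ã` -/
def At (b : SmartBeam) : ℝ := b.A - b.γ ^ 2 * b.β * b.B₃ ^ 2 / b.B₄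

/-- `B̃` -/
def Bt (b : SmartBeam) : ℝ := b.B₁ - b.γ * b.B₂ * b.B₃ / b.B₄

/-- `C̃` -/
def Ct (b : SmartBeam) : ℝ := b.C + b.γ * b.h₂ * b.h₃ * b.B₂ ^ 2 / b.B₄

/-- Green's function of `C̃ς - D_x²` on `(0, L)` with conditions `u(0) = 0`, `u_x(L) = 0`. -/
def green (b : SmartBeam) (x z : ℝ) : ℝ :=
  if x ≤ z then
    Real.cosh (√(b.Ct * b.ς) * (z - b.L)) * Real.sinh (√(b.Ct * b.ς) * x) /
      (√(b.Ct * b.ς) * Real.cosh (√(b.Ct * b.ς) * b.L))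
  else
    Real.cosh (√(b.Ct * b.ς) * (x - b.L)) * Real.sinh (√(b.Ct * b.ς) * z) /
      (√(b.Ct * b.ς) * Real.cosh (√(b.Ct * b.ς) * b.L))

/-- The operator `P_ς = (C̃ς - D_x²)⁻¹`. -/
def P (b : SmartBeam) (f : ℝ → ℂ) (x : ℝ) : ℂ :=
  ∫ z in (0 : ℝ)..b.L, (b.green x z : ℂ) * f z

/-- The operator `J_ς = ςC̃ P_ς - I`. -/
def J (b : SmartBeam) (f : ℝ → ℂ) (x : ℝ) : ℂ :=
  ((b.ς * b.Ct : ℝ) : ℂ) * b.P f x - f x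

/-- The coupling coefficient `γβς h₂h₃ B̃²`. -/
def coupling (b : SmartBeam) : ℝ := b.γ * b.β * b.ς * b.h₂ * b.h₃ * b.Bt ^ 2

/-- The stiffness form
`∫₀ᴸ Ã w_xx ψ̄_xx - γβς h₂h₃ B̃² (J_ς w_x) ψ̄_x dx`, the weak form of
`Ã w_xxxx + γβς h₂h₃ B̃² (J_ς w_x)_x` with free end conditions at `x = L`. -/
def stiffness (b : SmartBeam) (w ψ : H2L b.L) : ℂ :=
  ∫ x in (0 : ℝ)..b.L,
    ((b.At : ℂ) * H2L.dxx w x * conj (H2L.dxx ψ x) - (b.coupling : ℂ) * b.J (H2L.dx w) x *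
      conj (H2L.dx ψ x))

/-- The functional `ς h₂h₃ B̃ B₂ (P_ς ψ_x)(L) + B₃ ψ_x(L)`, which is the pairing of `ψ` with the
distribution `-[ς h₂h₃ B̃ B₂ (P_ς δ_L)_x + B₃ (δ_L)_x]`. -/
def tipOutput (b : SmartBeam) (ψ : H2L b.L) : ℂ :=
  ((b.ς * b.h₂ * b.h₃ * b.Bt * b.B₂ : ℝ) : ℂ) * b.P (H2L.dx ψ) b.L + (b.B₃ : ℂ) * H2L.dx ψ b.L

/-- The voltage feedback `V = -k₁ [ς h₂h₃ B̃ B₂ (P_ς v_x)(L) + B₃ v_x(L)]` for the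
velocity `v = ẇ`. -/
def voltage (b : SmartBeam) (k₁ : ℝ) (v : H2L b.L) : ℂ := -(k₁ : ℂ) * b.tipOutput v

/-- Graph of the closed-loop operator: `(w, v)` lies in its domain and is mapped to `(v, f)`.
This says that `v ∈ H²_L(0, L)`, `f ∈ L²(0, L)` and, tested against every `ψ ∈ H²_L(0, L)`,
`m f + Ã w_xxxx + γβς h₂h₃ B̃² (J_ς w_x)_x
  = -(γ/B₄) [ς h₂h₃ B̃ B₂ (P_ς δ_L)_x + B₃ (δ_L)_x] V` with the feedback voltage `V`. -/
def closedLoop (b : SmartBeam) (k₁ : ℝ) (Φ Ψ : BeamState b.L) : Prop :=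
  H2L.val Ψ.1 = Φ.2 ∧
  ∀ ψ : H2L b.L,
    (b.m : ℂ) * (∫ x in (0 : ℝ)..b.L, Ψ.2 x * conj (H2L.val ψ x)) + b.stiffness Φ.1 ψ
      = ((b.γ / b.B₄ : ℝ) : ℂ) * b.voltage k₁ Ψ.1 * conj (b.tipOutput ψ)

/-- The energy
`½ ∫₀ᴸ m |v|² + Ã |w_xx|² - γβς h₂h₃ B̃² (J_ς w_x) w̄_x dx` of the state `(w, v)`. -/
def energy (b : SmartBeam) (Φ : BeamState b.L) : ℝ :=
  (1 / 2) * (b.m * (∫ x in (0 : ℝ)..b.L, ‖Φ.2 x‖ ^ 2) + (b.stiffness Φ.1 Φ.1).re)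

end SmartBeam

/-- A strongly continuous one-parameter semigroup of bounded operators (only times `t ≥ 0`
matter). -/
structure C0Semigroup (X : Type*) [NormedAddCommGroup X] [NormedSpace ℂ X] where
  S : ℝ → X →L[ℂ] X
  map_zero : S 0 = ContinuousLinearMap.id ℂ X
  map_add : ∀ s t : ℝ, 0 ≤ s → 0 ≤ t → S (s + t) = (S s).comp (S t)
  continuous_zero : ∀ x : X, Tendsto (fun t => S t x) (𝓝[>] 0) (𝓝 x)

/-- The infinitesimal generator of the semigroup is the operator whose graph is `G`. -/
def C0Semigroup.IsGeneratedBy {X : Type*} [NormedAddCommGroup X] [NormedSpace ℂ X]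
    (T : C0Semigroup X) (G : X → X → Prop) : Prop :=
  ∀ x y : X, G x y ↔ Tendsto (fun t : ℝ => (t : ℂ)⁻¹ • (T.S t x - x)) (𝓝[>] 0) (𝓝 y)

end

/-!
In the coordinates `(B w_xx, √m v)`, where `B` is the square root of the operator
`Ã + γβς h₂h₃ B̃² V* (1 + ς C̃ V V*)⁻¹ V` and `V` is the Volterra operator on `L²(0, L)`, the energy
is half the square of the Hilbert norm (`SmartBeam.energy_eq`), and the closed-loop operator becomes
the abstract damped system of `abstractBeamGraph` with `W = √m V² B⁻¹`
(`SmartBeam.closedLoop_iff`). This rests on Green's formula for the kernel of `P`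
(`SmartBeam.P_eq_of_hasDerivWithinAt`), by which `-J w_x = (1 + ς C̃ V V*)⁻¹ V w_xx`.

The abstract system is dissipative, and its resolvent `R = (1 - A)⁻¹` is compact because `V` is. The
theorem of Lumer and Phillips (`exists_isGeneratedBy_resolventGraph`) gives the semigroup. It is
strongly stable as soon as the generator has no eigenvalue on the imaginary axis
(`C0Semigroup.tendsto_zero`): trajectories through the range of `R` are relatively compact, their
limit points lie in the closed subspace on which the semigroup is isometric, and if that subspace
were nonzero, `R` would have there an eigenvector, with eigenvalue `1 / (1 - i ω)`.

An eigenvector for `i ω`, `ω ≠ 0`, dissipates no energy, so it is a mode of the undamped beam with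
tip output zero. That such a mode vanishes (`TipSilentMode.eq_zero`) is the heart of the matter. The real mode
equations form a linear system of order six in `w`, `z = w'`, `p = z'`, the shear force `Q`,
`u = P z` and `v = u'`, with seven boundary conditions. Its characteristic polynomial, in the square
`μ` of the exponent, has a root in `(0, ς C̃)`. With `ς C̃ U = w + v` the function
`f = μ U - v` obeys a quadratic first integral, by which it is largest in absolute value at the tip;
comparison with `cosh (√μ x)` then gives `w(L)` and `u(L)` the same sign. Since the tip output
vanishes, `-z(L)` also has that sign, and seen from the tip the quantities `w, -z, p, u, -v, -Q`
solve a cooperative system, hence keep that sign along the whole beam. Then `|w|` and `|u|` decrease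
towards the tip from the value `0` at the clamped end, and all the tip data are zero.
-/


/-! ### Overdetermined modes of the beam -/

theorem monotoneOn_Icc_of_hasDerivWithinAt_nonneg {a b : ℝ} {f f' : ℝ → ℝ}
    (hf : ∀ x ∈ Icc a b, HasDerivWithinAt f (f' x) (Icc a b) x)
    (h0 : ∀ x ∈ Icc a b, 0 ≤ f' x) : MonotoneOn f (Icc a b) := by
  refine monotoneOn_of_deriv_nonneg (convex_Icc a b) (fun x hx => (hf x hx).continuousWithinAt)
    (fun x hx => ?_) (fun x hx => ?_)
  · exact (hf x (interior_subset hx)).differentiableWithinAt.mono interior_subset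
  · rw [((hf x (interior_subset hx)).hasDerivAt (mem_interior_iff_mem_nhds.1 hx)).deriv]
    exact h0 x (interior_subset hx)

theorem eq_right_of_hasDerivWithinAt_zero {a b : ℝ} {f f' : ℝ → ℝ}
    (hf : ∀ x ∈ Icc a b, HasDerivWithinAt f (f' x) (Icc a b) x)
    (h0 : ∀ x ∈ Icc a b, f' x = 0) {x : ℝ} (hx : x ∈ Icc a b) : f x = f b := by
  have hb : b ∈ Icc a b := ⟨hx.1.trans hx.2, le_rfl⟩
  refine le_antisymm (monotoneOn_Icc_of_hasDerivWithinAt_nonneg hf (fun y hy => (h0 y hy).ge) hx hb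
    hx.2) ?_
  have := monotoneOn_Icc_of_hasDerivWithinAt_nonneg (f := fun y => -f y) (f' := fun y => -f' y)
    (fun y hy => (hf y hy).neg) (fun y hy => by simp [h0 y hy]) hx hb hx.2
  simpa using this

theorem HasDerivWithinAt.nonneg_of_forall_ge {a b : ℝ} {f : ℝ → ℝ} {f' t : ℝ}
    (hf : HasDerivWithinAt f f' (Icc a b) t) (hat : a ≤ t) (htb : t < b)
    (hmin : ∀ s ∈ Icc a b, f t ≤ f s) : 0 ≤ f' := by
  have h1 : Tendsto (slope f t) (𝓝[Ioo t b] t) (𝓝 f') := by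
    refine (hasDerivWithinAt_iff_tendsto_slope.1 hf).mono_left (nhdsWithin_mono _ ?_)
    exact fun s hs => ⟨⟨hat.trans hs.1.le, hs.2.le⟩, ne_of_gt hs.1⟩
  have := left_nhdsWithin_Ioo_neBot htb
  refine ge_of_tendsto h1 (eventually_of_mem self_mem_nhdsWithin fun s hs => ?_)
  rw [slope_def_field]
  exact div_nonneg (sub_nonneg.2 (hmin s ⟨hat.trans hs.1.le, hs.2.le⟩)) (sub_nonneg.2 hs.1.le)

/-- A linear system `x' = -M x` with entrywise nonnegative `M`, solved backwards from
nonnegative data at the right end point, stays nonnegative. -/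
theorem cooperative_nonneg {n : ℕ} {L : ℝ} (hL : 0 ≤ L) {M : Fin n → Fin n → ℝ}
    (hM : ∀ i j, 0 ≤ M i j) {x : Fin n → ℝ → ℝ}
    (hx : ∀ i, ∀ t ∈ Icc 0 L, HasDerivWithinAt (x i) (-∑ j, M i j * x j t) (Icc 0 L) t)
    (hend : ∀ i, 0 ≤ x i L) (i : Fin n) {t : ℝ} (ht : t ∈ Icc 0 L) : 0 ≤ x i t := by
  -- The weight `exp (c t)` makes a negative minimum over all components and times impossible: there
  -- the right derivative would be negative, as `c` exceeds the row sums of `M`.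
  set c : ℝ := 1 + ∑ i, ∑ j, M i j with hc
  set g : Fin n → ℝ → ℝ := fun i t => Real.exp (c * t) * x i t with hg
  have hgd : ∀ i, ∀ t ∈ Icc 0 L,
      HasDerivWithinAt (g i) (c * g i t - ∑ j, M i j * g j t) (Icc 0 L) t := by
    intro i t ht
    have h1 : HasDerivWithinAt (fun t => Real.exp (c * t)) (Real.exp (c * t) * (c * 1))
        (Icc 0 L) t := (((hasDerivAt_id t).const_mul c).exp).hasDerivWithinAt
    refine (h1.mul (hx i t ht)).congr_deriv ?_
    have : ∑ j, M i j * g j t = Real.exp (c * t) * ∑ j, M i j * x j t := by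
      rw [Finset.mul_sum]
      exact Finset.sum_congr rfl fun j _ => by simp only [hg]; ring
    rw [this]; simp only [hg]; ring
  have hmin : ∀ i, ∃ s ∈ Icc 0 L, ∀ r ∈ Icc 0 L, g i s ≤ g i r := fun i =>
    isCompact_Icc.exists_isMinOn ⟨0, le_rfl, hL⟩ fun s hs => (hgd i s hs).continuousWithinAt
  choose s hs hsmin using hmin
  have : Nonempty (Fin n) := ⟨i⟩
  obtain ⟨k, hk⟩ := Finite.exists_min fun i => g i (s i)
  have hall : ∀ j, ∀ r ∈ Icc 0 L, g k (s k) ≤ g j r := fun j r hr => (hk j).trans (hsmin j r hr)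
  have hpos : 0 ≤ g k (s k) := by
    by_contra! hneg
    have hsL : s k < L := by
      refine lt_of_le_of_ne (hs k).2 fun h => ?_
      rw [h] at hneg
      exact absurd hneg (not_lt.2 (mul_nonneg (Real.exp_pos _).le (hend k)))
    have hd := (hgd k (s k) (hs k)).nonneg_of_forall_ge (hs k).1 hsL (hsmin k)
    have h1 : ∑ j, M k j * g k (s k) ≤ ∑ j, M k j * g j (s k) :=
      Finset.sum_le_sum fun j _ => mul_le_mul_of_nonneg_left (hall j _ (hs k)) (hM k j)
    rw [← Finset.sum_mul] at h1
    have h2 : ∑ j, M k j ≤ ∑ i, ∑ j, M i j :=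
      Finset.single_le_sum (f := fun i => ∑ j, M i j)
        (fun i _ => Finset.sum_nonneg fun j _ => hM i j) (Finset.mem_univ k)
    have h3 : 0 < c - ∑ j, M k j := by rw [hc]; linarith
    have h4 : g k (s k) * (c - ∑ j, M k j) < 0 := mul_neg_of_neg_of_pos hneg h3
    nlinarith [hd]
  exact nonneg_of_mul_nonneg_right (hpos.trans (hall i t ht)) (Real.exp_pos (c * t))

/-- The real equations of a mode of the undamped beam, as a first-order system: displacement `w`,
slope `z`, curvature `p`, shear force `Q`, and `u = P z` with its derivative `v`. The parameters are
`At = Ã`, the coupling coefficient `ρ = γβς h₂h₃ B̃²`, `r2 = ς C̃` and `N = mω²`. The beam is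
clamped at `0` and free at `L`, and the sensor reading at `L` vanishes, which is the condition
`tip`, with `σ = ς h₂h₃ B̃ B₂ / B₃`. -/
structure TipSilentMode (L At ρ r2 N σ : ℝ) (w z p Q u v : ℝ → ℝ) : Prop where
  deriv_w : ∀ x ∈ Icc 0 L, HasDerivWithinAt w (z x) (Icc 0 L) x
  deriv_z : ∀ x ∈ Icc 0 L, HasDerivWithinAt z (p x) (Icc 0 L) x
  deriv_p : ∀ x ∈ Icc 0 L, HasDerivWithinAt p ((Q x - ρ * (r2 * u x - z x)) / At) (Icc 0 L) x
  deriv_Q : ∀ x ∈ Icc 0 L, HasDerivWithinAt Q (N * w x) (Icc 0 L) x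
  deriv_u : ∀ x ∈ Icc 0 L, HasDerivWithinAt u (v x) (Icc 0 L) x
  deriv_v : ∀ x ∈ Icc 0 L, HasDerivWithinAt v (r2 * u x - z x) (Icc 0 L) x
  w_zero : w 0 = 0
  z_zero : z 0 = 0
  u_zero : u 0 = 0
  p_end : p L = 0
  Q_end : Q L = 0
  v_end : v L = 0
  tip : z L = -σ * u L

namespace TipSilentMode

variable {L At ρ r2 N σ : ℝ} {w z p Q u v : ℝ → ℝ}

theorem neg (h : TipSilentMode L At ρ r2 N σ w z p Q u v) :
    TipSilentMode L At ρ r2 N σ (-w) (-z) (-p) (-Q) (-u) (-v) where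
  deriv_w x hx := (h.deriv_w x hx).neg
  deriv_z x hx := (h.deriv_z x hx).neg
  deriv_p x hx := (h.deriv_p x hx).neg.congr_deriv (by simp only [Pi.neg_apply]; ring)
  deriv_Q x hx := (h.deriv_Q x hx).neg.congr_deriv (by simp only [Pi.neg_apply]; ring)
  deriv_u x hx := (h.deriv_u x hx).neg
  deriv_v x hx := (h.deriv_v x hx).neg.congr_deriv (by simp only [Pi.neg_apply]; ring)
  w_zero := by simp [h.w_zero]
  z_zero := by simp [h.z_zero]
  u_zero := by simp [h.u_zero]
  p_end := by simp [h.p_end]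
  Q_end := by simp [h.Q_end]
  v_end := by simp [h.v_end]
  tip := by simp [h.tip]

/-- If `w` and `u` are nonnegative at the tip, then `w, -z, p, u, -v, -Q` are nonnegative along the
whole beam: seen from the tip, they solve a cooperative system. -/
theorem nonneg_of_tip (h : TipSilentMode L At ρ r2 N σ w z p Q u v) (hL : 0 ≤ L) (hAt : 0 < At)
    (hρ : 0 ≤ ρ) (hr2 : 0 ≤ r2) (hN : 0 ≤ N) (hσ : 0 ≤ σ) (hw : 0 ≤ w L) (hu : 0 ≤ u L)
    {x : ℝ} (hx : x ∈ Icc 0 L) : 0 ≤ w x ∧ z x ≤ 0 ∧ 0 ≤ u x ∧ v x ≤ 0 := by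
  have key := cooperative_nonneg hL
    (M := ![![0, 1, 0, 0, 0, 0], ![0, 0, 1, 0, 0, 0], ![0, ρ / At, 0, ρ * r2 / At, 0, 1 / At],
      ![0, 0, 0, 0, 1, 0], ![0, 1, 0, r2, 0, 0], ![N, 0, 0, 0, 0, 0]])
    (x := ![w, -z, p, u, -v, -Q]) ?_ ?_ ?_
  · refine ⟨by simpa using key 0 hx, by simpa using key 1 hx, by simpa using key 3 hx,
      by simpa using key 4 hx⟩
  · have := div_nonneg hρ hAt.le
    have := div_nonneg (mul_nonneg hρ hr2) hAt.le
    have := div_nonneg zero_le_one hAt.le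
    simp only [Fin.forall_fin_succ, Fin.isValue]
    simp [*, hAt.le]
  · simp only [Fin.forall_fin_succ, Fin.isValue, Fin.sum_univ_six]
    refine ⟨fun t ht => (h.deriv_w t ht).congr_deriv ?_, fun t ht =>
      (h.deriv_z t ht).neg.congr_deriv ?_, fun t ht => (h.deriv_p t ht).congr_deriv ?_,
      fun t ht => (h.deriv_u t ht).congr_deriv ?_,
      fun t ht => (h.deriv_v t ht).neg.congr_deriv ?_,
      fun t ht => (h.deriv_Q t ht).neg.congr_deriv ?_, fun i => i.elim0⟩
    all_goals simp
    all_goals ring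
  · simp only [Fin.forall_fin_succ, Fin.isValue]
    simp [hw, hu, h.p_end, h.v_end, h.Q_end, h.tip, mul_nonneg hσ hu]

/-- The functions `w` and `u` vanish at the clamped end, are nonnegative and nonincreasing. -/
theorem tip_eq_zero_of_nonneg (h : TipSilentMode L At ρ r2 N σ w z p Q u v) (hL : 0 ≤ L)
    (hAt : 0 < At) (hρ : 0 ≤ ρ) (hr2 : 0 ≤ r2) (hN : 0 ≤ N) (hσ : 0 ≤ σ) (hw : 0 ≤ w L)
    (hu : 0 ≤ u L) : w L = 0 ∧ u L = 0 := by
  have key := fun x hx => h.nonneg_of_tip hL hAt hρ hr2 hN hσ hw hu (x := x) hx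
  have h0 : (0 : ℝ) ∈ Icc 0 L := ⟨le_rfl, hL⟩
  have h1 : L ∈ Icc 0 L := ⟨hL, le_rfl⟩
  have hw' := monotoneOn_Icc_of_hasDerivWithinAt_nonneg (f := fun x => -w x)
    (fun x hx => (h.deriv_w x hx).neg) (fun x hx => by linarith [(key x hx).2.1]) h0 h1 hL
  have hu' := monotoneOn_Icc_of_hasDerivWithinAt_nonneg (f := fun x => -u x)
    (fun x hx => (h.deriv_u x hx).neg) (fun x hx => by linarith [(key x hx).2.2.2]) h0 h1 hL
  simp only [h.w_zero, h.u_zero] at hw' hu'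
  constructor <;> linarith

/-- The characteristic polynomial of the mode equations, in the square of the exponent, has a root
in `(0, r2)`. -/
theorem exists_root (hρ : 0 < ρ) (hr2 : 0 < r2) (hN : 0 < N) :
    ∃ μ, 0 < μ ∧ μ < r2 ∧ -At * μ ^ 3 + (At * r2 + ρ) * μ ^ 2 + N * μ - N * r2 = 0 := by
  have hcont : ContinuousOn
      (fun μ : ℝ => -At * μ ^ 3 + (At * r2 + ρ) * μ ^ 2 + N * μ - N * r2) (Icc 0 r2) := by
    fun_prop
  have h := intermediate_value_Ioo hr2.le hcont
  have h0 : (0 : ℝ) ∈ Ioo (-At * (0 : ℝ) ^ 3 + (At * r2 + ρ) * (0 : ℝ) ^ 2 + N * 0 - N * r2)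
      (-At * r2 ^ 3 + (At * r2 + ρ) * r2 ^ 2 + N * r2 - N * r2) := by
    constructor
    · have := mul_pos hN hr2
      linarith
    · have : 0 < ρ * r2 ^ 2 := by positivity
      nlinarith
  obtain ⟨μ, hμ, hμ0⟩ := h h0
  exact ⟨μ, hμ.1, hμ.2, hμ0⟩

/-- With `μ` a root of the characteristic polynomial in `(0, r2)` and `r2 U = w + v`, the function
`f = μ U - v` is largest in absolute value at the tip. The reason is the first integral
`2 Q f' - (K - At μ) f' (e + μ u) - At f''² - (N r2 / μ) f²` with `e = r2 u - z`, `K = At r2 + ρ`: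
at a critical point of `f` only the last two terms remain. -/
theorem sq_le_sq_tip (h : TipSilentMode L At ρ r2 N σ w z p Q u v) (hL : 0 ≤ L) (hAt : 0 < At)
    (hρ : 0 < ρ) (hr2 : 0 < r2) (hN : 0 < N) (hσ : 0 ≤ σ) {μ : ℝ} (hμ0 : 0 < μ) (hμ : μ < r2)
    (hroot : -At * μ ^ 3 + (At * r2 + ρ) * μ ^ 2 + N * μ - N * r2 = 0) {x : ℝ}
    (hx : x ∈ Icc 0 L) :
    (μ * ((w x + v x) / r2) - v x) ^ 2 ≤ (μ * (w L / r2)) ^ 2 := by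
  set f : ℝ → ℝ := fun x => μ * ((w x + v x) / r2) - v x with hf
  set f' : ℝ → ℝ := fun x => μ * u x - (r2 * u x - z x) with hf'
  set f'' : ℝ → ℝ := fun x => μ * v x - (r2 * v x - p x) with hf''
  have hLL : L ∈ Icc 0 L := ⟨hL, le_rfl⟩
  have df : ∀ x ∈ Icc 0 L, HasDerivWithinAt f (f' x) (Icc 0 L) x := fun x hx =>
    ((((((h.deriv_w x hx).add (h.deriv_v x hx)).div_const r2).const_mul μ).sub
      (h.deriv_v x hx)).congr_deriv (by simp only [hf']; field_simp; ring))
  have df' : ∀ x ∈ Icc 0 L, HasDerivWithinAt f' (f'' x) (Icc 0 L) x := fun x hx =>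
    (((h.deriv_u x hx).const_mul μ).sub (((h.deriv_u x hx).const_mul r2).sub (h.deriv_z x hx)))
  have df'' : ∀ x ∈ Icc 0 L, HasDerivWithinAt f'' (μ * (r2 * u x - z x) -
      (r2 * (r2 * u x - z x) - (Q x - ρ * (r2 * u x - z x)) / At)) (Icc 0 L) x := fun x hx =>
    (((h.deriv_v x hx).const_mul μ).sub (((h.deriv_v x hx).const_mul r2).sub (h.deriv_p x hx)))
  set Γ : ℝ → ℝ := fun x => 2 * Q x * f' x -
    (At * r2 + ρ - At * μ) * (f' x * ((r2 * u x - z x) + μ * u x)) - At * f'' x ^ 2 -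
    N * r2 / μ * f x ^ 2 with hΓ
  -- The derivative of `Γ` vanishes because of the equation for `μ`, which enters through `hD`.
  have dΓ : ∀ x ∈ Icc 0 L, HasDerivWithinAt Γ 0 (Icc 0 L) x := by
    intro x hx
    have h1 := ((((((h.deriv_Q x hx).const_mul 2).mul (df' x hx)).sub
      (((df' x hx).mul ((((h.deriv_u x hx).const_mul r2).sub (h.deriv_z x hx)).add
        ((h.deriv_u x hx).const_mul μ))).const_mul (At * r2 + ρ - At * μ))).sub
      (((df'' x hx).pow 2).const_mul At)).sub (((df x hx).pow 2).const_mul (N * r2 / μ)))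
    refine h1.congr_deriv ?_
    have hU : r2 * ((w x + v x) / r2) = w x + v x := by field_simp
    have hq : At * ((Q x - ρ * (r2 * u x - z x)) / At) = Q x - ρ * (r2 * u x - z x) := by
      field_simp
    have hDμ : N * r2 / μ * μ = N * r2 := by field_simp
    have hD : N * r2 / μ = -At * μ ^ 2 + (At * r2 + ρ) * μ + N := by
      refine mul_right_cancel₀ hμ0.ne' (hDμ.trans ?_)
      linarith
    simp only [hf', hf'', hf, Pi.add_apply, Pi.sub_apply]
    linear_combination (-2 * (μ * v x - (r2 * v x - p x))) * hq
      + (-2 * (μ * u x - (r2 * u x - z x)) * ((w x + v x) / r2)) * hDμ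
      + (-2 * (μ * u x - (r2 * u x - z x)) * N) * hU
      + (2 * v x * (μ * u x - (r2 * u x - z x))) * hD
  have hconst : ∀ x ∈ Icc 0 L, Γ x = Γ L := fun x hx =>
    eq_right_of_hasDerivWithinAt_zero dΓ (fun _ _ => rfl) hx
  have hΓL : -(N * r2 / μ * f L ^ 2) ≤ Γ L := by
    have h1 : Γ L = (At * r2 + ρ - At * μ) * ((r2 + σ) ^ 2 - μ ^ 2) * u L ^ 2
        - N * r2 / μ * f L ^ 2 := by
      simp only [hΓ, hf', hf'', h.Q_end, h.v_end, h.p_end, h.tip]; ring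
    have h2 : 0 ≤ (At * r2 + ρ - At * μ) * ((r2 + σ) ^ 2 - μ ^ 2) * u L ^ 2 := by
      have : 0 < At * (r2 - μ) := mul_pos hAt (sub_pos.2 hμ)
      have : 0 ≤ (r2 + σ) ^ 2 - μ ^ 2 := by nlinarith
      refine mul_nonneg (mul_nonneg (by linarith) this) (sq_nonneg _)
    linarith
  have hcrit : ∀ x ∈ Icc 0 L, f' x = 0 → f x ^ 2 ≤ f L ^ 2 := by
    intro x hx h0
    have h1 : Γ x = -(At * f'' x ^ 2) - N * r2 / μ * f x ^ 2 := by simp only [hΓ, h0]; ring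
    have h2 := hconst x hx
    have h3 : 0 ≤ At * f'' x ^ 2 := by positivity
    have h4 : 0 < N * r2 / μ := by positivity
    have h5 : N * r2 / μ * f x ^ 2 ≤ N * r2 / μ * f L ^ 2 := by linarith
    exact le_of_mul_le_mul_left h5 h4
  -- A maximum point of `f²` is the tip, or the clamped end, where `f' = 0`, or an interior point,
  -- where `f f' = 0`.
  have hfL : f L = μ * (w L / r2) := by simp [hf, h.v_end]
  rw [← hfL]
  obtain ⟨a, ha, hmax⟩ := isCompact_Icc.exists_isMaxOn (f := fun x => f x ^ 2)
    ⟨0, le_rfl, hL⟩ (fun x hx => ((df x hx).pow 2).continuousWithinAt)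
  refine (hmax hx).trans ?_
  rcases eq_or_lt_of_le ha.2 with h1 | h1
  · simp [h1]
  rcases eq_or_lt_of_le ha.1 with h2 | h2
  · refine hcrit a ha ?_
    simp [hf', ← h2, h.u_zero, h.z_zero]
  · have hnhds : Icc 0 L ∈ 𝓝 a := Icc_mem_nhds h2 h1
    have hd : HasDerivAt (fun x => f x ^ 2) _ a := ((df a ha).pow 2).hasDerivAt hnhds
    have h3 := (hmax.isLocalMax hnhds).hasDerivAt_eq_zero hd
    have h4 : f a * f' a = 0 := by simpa [mul_assoc] using h3
    rcases mul_eq_zero.1 h4 with h5 | h5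
    · simpa [h5] using sq_nonneg (f L)
    · exact hcrit a ha h5

/-- A comparison argument: `f = μ U - v` is at most `μ U(L)`, so `Y = U - U(L)` satisfies
`Y'' ≥ μ Y`, while `Y(L) = 0` and `Y'(0) = 0`. Hence the Wronskian of `Y` and `cosh (√μ x)`, which
vanishes at `0`, is nondecreasing, and at the tip it is `Y'(L) cosh (√μ L)`, where `Y' = u`. -/
theorem tip_nonneg_of_pos (h : TipSilentMode L At ρ r2 N σ w z p Q u v) (hL : 0 ≤ L) (hAt : 0 < At)
    (hρ : 0 < ρ) (hr2 : 0 < r2) (hN : 0 < N) (hσ : 0 ≤ σ) (hw : 0 < w L) : 0 ≤ u L := by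
  obtain ⟨μ, hμ0, hμ, hroot⟩ := exists_root (At := At) hρ hr2 hN
  have hle := fun x hx => h.sq_le_sq_tip hL hAt hρ hr2 hN hσ hμ0 hμ hroot (x := x) hx
  set k := √μ with hk
  have hk2 : k * k = μ := Real.mul_self_sqrt hμ0.le
  have h0 : (0 : ℝ) ∈ Icc 0 L := ⟨le_rfl, hL⟩
  have h1 : L ∈ Icc 0 L := ⟨hL, le_rfl⟩
  have hmono := monotoneOn_Icc_of_hasDerivWithinAt_nonneg (a := 0) (b := L)
    (f := fun x => u x * Real.cosh (k * x) -
      ((w x + v x) / r2 - w L / r2) * (k * Real.sinh (k * x)))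
    (f' := fun x => (μ * (w L / r2) - (μ * ((w x + v x) / r2) - v x)) * Real.cosh (k * x))
    (fun x hx => ?_) (fun x hx => ?_) h0 h1 hL
  · simp only [h.u_zero, h.v_end, add_zero, sub_self, zero_mul, mul_zero, Real.sinh_zero,
      sub_zero] at hmono
    exact nonneg_of_mul_nonneg_left hmono (Real.cosh_pos _)
  · have hkx : HasDerivWithinAt (fun x => k * x) (k * 1) (Icc 0 L) x :=
      ((hasDerivAt_id x).const_mul k).hasDerivWithinAt
    refine (((h.deriv_u x hx).mul hkx.cosh).sub
      (((((h.deriv_w x hx).add (h.deriv_v x hx)).div_const r2).sub_const (w L / r2)).mul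
      (hkx.sinh.const_mul k))).congr_deriv ?_
    have e1 : (z x + (r2 * u x - z x)) / r2 = u x := by field_simp; ring
    simp only [Pi.add_apply, e1]
    rw [← hk2]; ring
  · refine mul_nonneg (sub_nonneg.2 ?_) (Real.cosh_pos _).le
    exact abs_le_of_sq_le_sq' (hle x hx) (mul_nonneg hμ0.le (div_nonneg hw.le hr2.le)) |>.2

/-- The beam has no mode that the sensor at the tip does not see. -/
theorem eq_zero (h : TipSilentMode L At ρ r2 N σ w z p Q u v) (hL : 0 ≤ L) (hAt : 0 < At)
    (hρ : 0 < ρ) (hr2 : 0 < r2) (hN : 0 < N) (hσ : 0 ≤ σ) {x : ℝ} (hx : x ∈ Icc 0 L) :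
    w x = 0 ∧ z x = 0 := by
  have htip : w L = 0 ∧ u L = 0 := by
    rcases lt_trichotomy (w L) 0 with hw | hw | hw
    · have hw' : 0 < (-w) L := neg_pos.2 hw
      simpa using h.neg.tip_eq_zero_of_nonneg hL hAt hρ.le hr2.le hN.le hσ hw'.le
        (h.neg.tip_nonneg_of_pos hL hAt hρ hr2 hN hσ hw')
    · rcases le_total 0 (u L) with hu | hu
      · exact h.tip_eq_zero_of_nonneg hL hAt hρ.le hr2.le hN.le hσ hw.ge hu
      · simpa using h.neg.tip_eq_zero_of_nonneg hL hAt hρ.le hr2.le hN.le hσ (by simp [hw])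
          (by simpa using hu)
    · exact h.tip_eq_zero_of_nonneg hL hAt hρ.le hr2.le hN.le hσ hw.le
        (h.tip_nonneg_of_pos hL hAt hρ hr2 hN hσ hw)
  have h1 := h.nonneg_of_tip hL hAt hρ.le hr2.le hN.le hσ htip.1.ge htip.2.ge hx
  have h2 := h.neg.nonneg_of_tip hL hAt hρ.le hr2.le hN.le hσ (by simp [htip.1])
    (by simp [htip.2]) hx
  simp only [Pi.neg_apply] at h2
  constructor <;> linarith

end TipSilentMode

/-! ### Compact operators whose Cayley transform is isometric -/

section Hilbert

variable {H : Type*} [NormedAddCommGroup H] [InnerProductSpace ℂ H] [CompleteSpace H]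

omit [CompleteSpace H] in
theorem inner_self_eq_ofReal (x : H) : inner ℂ x x = ((‖x‖ ^ 2 : ℝ) : ℂ) := by
  rw [inner_self_eq_norm_sq_to_K]; simp

theorem norm_adjoint_comp_sub_sq (R : H →L[ℂ] H) (μ : ℝ) (x : H) :
    ‖R.adjoint (R x) - (μ : ℂ) • x‖ ^ 2 =
      ‖R.adjoint (R x)‖ ^ 2 - 2 * μ * ‖R x‖ ^ 2 + μ ^ 2 * ‖x‖ ^ 2 := by
  rw [@norm_sub_sq ℂ, inner_smul_right, ContinuousLinearMap.adjoint_inner_left,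
    inner_self_eq_ofReal, norm_smul, mul_pow, Complex.norm_real, Real.norm_eq_abs, sq_abs,
    ← Complex.ofReal_mul]
  simp only [RCLike.re_to_complex, Complex.ofReal_re]
  ring

/-- A compact operator attains its norm, at an eigenvector of `R* R`. Along a maximizing sequence
`xₙ` in the unit ball, `R* R xₙ - ‖R‖² xₙ` tends to zero. -/
theorem IsCompactOperator.exists_norm_attained [Nontrivial H] {R : H →L[ℂ] H}
    (hR : IsCompactOperator R) (h0 : R ≠ 0) :
    ∃ x ≠ 0, R.adjoint (R x) = ((‖R‖ ^ 2 : ℝ) : ℂ) • x := by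
  set μ : ℝ := ‖R‖ ^ 2 with hμ
  have hRpos : 0 < ‖R‖ := norm_pos_iff.2 h0
  have hμ0 : 0 < μ := by positivity
  have hex : ∀ n : ℕ, ∃ x : H, ‖x‖ < 1 ∧ ‖R‖ - 1 / (n + 1) < ‖R x‖ := fun n =>
    R.exists_lt_apply_of_lt_opNorm (sub_lt_self _ (by positivity))
  choose x hx1 hx2 using hex
  obtain ⟨K, hK, hKsub⟩ :=
    (hR.clm_comp R.adjoint).image_closedBall_subset_compact
      (f := (R.adjoint.comp R : H →ₗ[ℂ] H)) 1
  obtain ⟨y, -, φ, hφ, hy⟩ := hK.tendsto_subseq (x := fun n => R.adjoint (R (x n)))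
    fun n => hKsub ⟨x n, by simpa using (hx1 n).le, rfl⟩
  have hlim : Tendsto (fun n => ‖R (x n)‖) atTop (𝓝 ‖R‖) := by
    refine tendsto_of_tendsto_of_tendsto_of_le_of_le
      (g := fun n : ℕ => ‖R‖ - 1 / ((n : ℝ) + 1)) ?_ tendsto_const_nhds (fun n => (hx2 n).le)
      (fun n => ?_)
    · simpa using tendsto_const_nhds.sub (tendsto_one_div_add_atTop_nhds_zero_nat (𝕜 := ℝ))
    · exact (R.le_opNorm _).trans (mul_le_of_le_one_right hRpos.le (hx1 n).le)
  have hdiff : Tendsto (fun n => R.adjoint (R (x n)) - (μ : ℂ) • x n) atTop (𝓝 0) := by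
    have hsq : Tendsto (fun n => 2 * μ * (μ - ‖R (x n)‖ ^ 2)) atTop (𝓝 0) := by
      have := ((tendsto_const_nhds (x := μ)).sub (hlim.pow 2)).const_mul (2 * μ)
      simpa [hμ] using this
    have hsq' : Tendsto (fun n => ‖R.adjoint (R (x n)) - (μ : ℂ) • x n‖ ^ 2) atTop (𝓝 0) := by
      refine squeeze_zero (fun n => sq_nonneg _) (fun n => ?_) hsq
      rw [norm_adjoint_comp_sub_sq]
      have h1 : ‖R.adjoint (R (x n))‖ ≤ ‖R‖ * ‖R (x n)‖ := by
        simpa using R.adjoint.le_opNorm (R (x n))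
      have h2 : ‖R.adjoint (R (x n))‖ ≤ μ := by
        refine h1.trans ?_
        rw [hμ, sq]
        refine mul_le_mul_of_nonneg_left ?_ hRpos.le
        exact (R.le_opNorm _).trans (mul_le_of_le_one_right hRpos.le (hx1 n).le)
      have h3 : ‖R.adjoint (R (x n))‖ ^ 2 ≤ μ ^ 2 := pow_le_pow_left₀ (norm_nonneg _) h2 2
      have h4 : ‖x n‖ ^ 2 ≤ 1 := pow_le_one₀ (norm_nonneg _) (hx1 n).le
      nlinarith [mul_le_mul_of_nonneg_left h4 (sq_nonneg μ)]
    have := hsq'.sqrt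
    simp only [Real.sqrt_zero, Real.sqrt_sq (norm_nonneg _)] at this
    exact tendsto_zero_iff_norm_tendsto_zero.2 this
  have hμc : (μ : ℂ) ≠ 0 := by exact_mod_cast hμ0.ne'
  have hxlim : Tendsto (fun n => x (φ n)) atTop (𝓝 ((μ : ℂ)⁻¹ • y)) := by
    have h1 := (hy.sub (hdiff.comp hφ.tendsto_atTop)).const_smul (μ : ℂ)⁻¹
    simpa only [Function.comp_def, sub_sub_cancel, sub_zero, inv_smul_smul₀ hμc] using h1
  refine ⟨(μ : ℂ)⁻¹ • y, fun h => ?_, ?_⟩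
  · have h1 := tendsto_nhds_unique (hlim.comp hφ.tendsto_atTop)
      ((R.continuous.tendsto _).comp hxlim).norm
    rw [h, map_zero, norm_zero] at h1
    exact hRpos.ne' h1
  · have h1 := tendsto_nhds_unique hy
      (((R.adjoint.continuous.comp R.continuous).tendsto _).comp hxlim)
    rw [smul_smul, mul_inv_cancel₀ hμc, one_smul]
    exact h1.symm

/-- If `‖R z‖² = Re ⟪z, R z⟫` for all `z`, that is, if `2 R - 1` is isometric, and `R` is compact
and injective, then `R` has an eigenvector. A vector `x` at which `R` attains its norm satisfies
`R² x = 2 ‖R‖² R x - ‖R‖² x`, so it spans with `R x` an invariant subspace. -/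
theorem IsCompactOperator.exists_eigenvector [Nontrivial H] {R : H →L[ℂ] H}
    (hR : IsCompactOperator R) (hinj : ∀ x, R x = 0 → x = 0)
    (hiso : ∀ z, ‖R z‖ ^ 2 = (inner ℂ z (R z)).re) :
    ∃ (ν : ℂ) (x : H), x ≠ 0 ∧ R x = ν • x := by
  have h0 : R ≠ 0 := by
    rintro rfl
    obtain ⟨x, hx⟩ := exists_ne (0 : H)
    exact hx (hinj x rfl)
  obtain ⟨x, hx, hxR⟩ := hR.exists_norm_attained h0
  set μ : ℝ := ‖R‖ ^ 2 with hμ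
  have hop : R + R.adjoint - (2 : ℂ) • R.adjoint.comp R = 0 := by
    rw [← ContinuousLinearMap.coe_inj, ContinuousLinearMap.toLinearMap_zero,
      ← inner_map_self_eq_zero]
    intro z
    have h1 : (inner ℂ (R z) z : ℂ) + inner ℂ z (R z) = ((2 * ‖R z‖ ^ 2 : ℝ) : ℂ) := by
      rw [← inner_conj_symm (R z) z, hiso z, add_comm, Complex.add_conj]
    simp only [ContinuousLinearMap.coe_coe, _root_.sub_apply,
      _root_.add_apply, _root_.smul_apply,
      ContinuousLinearMap.comp_apply, inner_sub_left, inner_add_left, inner_smul_left,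
      ContinuousLinearMap.adjoint_inner_left, h1, inner_self_eq_ofReal]
    simp [Complex.conj_ofNat]
  have hadj : R.adjoint x = ((2 * μ : ℝ) : ℂ) • x - R x := by
    have h1 := congrArg (fun S : H →L[ℂ] H => S x) hop
    simp only [_root_.sub_apply, _root_.add_apply,
      _root_.smul_apply, ContinuousLinearMap.comp_apply, hxR,
      _root_.zero_apply, smul_smul] at h1
    push_cast
    rw [sub_eq_zero] at h1
    rw [eq_sub_iff_add_eq, add_comm, h1]
  have hnorm : ‖R x‖ ^ 2 = μ * ‖x‖ ^ 2 := by
    have h1 : (inner ℂ (R.adjoint (R x)) x : ℂ) = ((μ * ‖x‖ ^ 2 : ℝ) : ℂ) := by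
      rw [hxR, inner_smul_left, inner_self_eq_ofReal]; simp
    rw [ContinuousLinearMap.adjoint_inner_left, inner_self_eq_ofReal] at h1
    exact_mod_cast h1
  have hnorm' : ‖R.adjoint x‖ ^ 2 = μ * ‖x‖ ^ 2 := by
    rw [hadj, @norm_sub_sq ℂ, inner_smul_left, norm_smul, mul_pow, Complex.norm_real,
      Real.norm_eq_abs, sq_abs, Complex.conj_ofReal]
    simp only [RCLike.re_to_complex, Complex.re_ofReal_mul, ← hiso x, hnorm]
    ring
  have hRR : R (R.adjoint x) = (μ : ℂ) • x := by
    have h1 := norm_adjoint_comp_sub_sq R.adjoint μ x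
    rw [ContinuousLinearMap.adjoint_adjoint, hnorm'] at h1
    have h2 : ‖R (R.adjoint x)‖ ^ 2 ≤ μ * (μ * ‖x‖ ^ 2) := by
      rw [← hnorm', hμ, ← mul_pow]
      exact pow_le_pow_left₀ (norm_nonneg _) (R.le_opNorm _) 2
    have h3 : ‖R (R.adjoint x) - (μ : ℂ) • x‖ ^ 2 ≤ 0 := by rw [h1]; linarith
    exact sub_eq_zero.1 (norm_eq_zero.1 (pow_eq_zero_iff two_ne_zero |>.1
      (le_antisymm h3 (sq_nonneg _))))
  have hquad : R (R x) = ((2 * μ : ℝ) : ℂ) • R x - (μ : ℂ) • x := by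
    rw [hadj, map_sub, map_smul] at hRR
    rw [← hRR]; abel
  -- With `s² = ‖R‖⁴ - ‖R‖²`, the numbers `‖R‖² ± s` are the roots of the quadratic equation.
  obtain ⟨s, hs⟩ := IsAlgClosed.exists_pow_nat_eq ((μ : ℂ) ^ 2 - μ) two_pos
  by_cases hy : R x - ((μ : ℂ) - s) • x = 0
  · exact ⟨_, x, hx, sub_eq_zero.1 hy⟩
  · refine ⟨μ + s, _, hy, ?_⟩
    rw [map_sub, map_smul, hquad, smul_sub, smul_smul]
    have e1 : ((μ : ℂ) + s) * ((μ : ℂ) - s) = μ := by linear_combination -hs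
    rw [e1]
    push_cast
    module

end Hilbert

/-! ### Semigroups generated by a dissipative operator with compact resolvent -/

/-- The graph of the operator `A` with `(1 - A)⁻¹ = R`: if `R` is injective, `y = A x` means that
`(1 - A) x = x - y`. -/
def resolventGraph {H : Type*} [NormedAddCommGroup H] [NormedSpace ℂ H] (R : H →L[ℂ] H)
    (x y : H) : Prop := R (x - y) = x

namespace C0Semigroup

section Banach

variable {X : Type*} [NormedAddCommGroup X] [NormedSpace ℂ X] (T : C0Semigroup X)

theorem tendsto_zero_right (x : X) : Tendsto (fun t => T.S t x) (𝓝[≥] 0) (𝓝 x) := by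
  have h : (𝓝[≥] (0 : ℝ)) = 𝓝[>] 0 ⊔ pure 0 := by
    rw [← Ioi_insert, nhdsWithin_insert, sup_comm]
  rw [h, tendsto_sup]
  refine ⟨T.continuous_zero x, ?_⟩
  rw [tendsto_pure_left]
  intro s hs
  simpa [T.map_zero] using mem_of_mem_nhds hs

/-- Near time zero the operators of a semigroup are bounded, by the uniform boundedness
principle. -/
theorem exists_local_bound [CompleteSpace X] :
    ∃ δ > 0, ∃ M : ℝ, ∀ t ∈ Icc 0 δ, ‖T.S t‖ ≤ M := by
  by_contra! hcon
  have h1 : ∀ n : ℕ, ∃ t ∈ Icc (0 : ℝ) (1 / (n + 1)), (n : ℝ) < ‖T.S t‖ := fun n =>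
    hcon _ (by positivity) n
  choose t ht hn using h1
  have ht0 : Tendsto t atTop (𝓝[≥] 0) := by
    refine tendsto_nhdsWithin_iff.2 ⟨squeeze_zero (fun n => (ht n).1) (fun n => (ht n).2)
      tendsto_one_div_add_atTop_nhds_zero_nat, Eventually.of_forall fun n => (ht n).1⟩
  obtain ⟨C, hC⟩ := banach_steinhaus (g := fun n => T.S (t n)) fun x => by
    obtain ⟨C, hC⟩ := ((T.tendsto_zero_right x).comp ht0).norm.bddAbove_range
    exact ⟨C, fun n => hC ⟨n, rfl⟩⟩
  obtain ⟨n, hn'⟩ := exists_nat_gt C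
  exact absurd (hn n) (not_lt.2 ((hC n).trans hn'.le))

theorem continuousOn_of_bound {δ M : ℝ} (hM : ∀ t ∈ Icc 0 δ, ‖T.S t‖ ≤ M) (x : X) :
    ContinuousOn (fun t => T.S t x) (Icc 0 δ) := by
  have key : ∀ s ∈ Icc 0 δ, ∀ t ∈ Icc 0 δ, ‖T.S t x - T.S s x‖ ≤ M * ‖T.S |t - s| x - x‖ := by
    have main : ∀ s ∈ Icc 0 δ, ∀ t ∈ Icc 0 δ, s ≤ t →
        ‖T.S t x - T.S s x‖ ≤ M * ‖T.S (t - s) x - x‖ := by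
      intro s hs t ht hst
      have h1 : T.S t x - T.S s x = T.S s (T.S (t - s) x - x) := by
        rw [map_sub, ← ContinuousLinearMap.comp_apply, ← T.map_add _ _ hs.1 (sub_nonneg.2 hst)]
        simp
      rw [h1]
      exact ((T.S s).le_opNorm _).trans (mul_le_mul_of_nonneg_right (hM s hs) (norm_nonneg _))
    intro s hs t ht
    rcases le_total s t with h | h
    · rw [abs_of_nonneg (sub_nonneg.2 h)]; exact main s hs t ht h
    · rw [abs_of_nonpos (sub_nonpos.2 h), norm_sub_rev, neg_sub]; exact main t ht s hs h
  intro s hs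
  have h0 : Tendsto (fun t => |t - s|) (𝓝[Icc 0 δ] s) (𝓝[≥] 0) := by
    refine tendsto_nhdsWithin_iff.2 ⟨?_, Eventually.of_forall fun t => mem_Ici.2 (abs_nonneg _)⟩
    have : Tendsto (fun t => |t - s|) (𝓝 s) (𝓝 |s - s|) := by
      exact (continuous_abs.comp (continuous_id.sub continuous_const)).tendsto s
    rw [sub_self, abs_zero] at this
    exact this.mono_left nhdsWithin_le_nhds
  have h1 : Tendsto (fun t => M * ‖T.S |t - s| x - x‖) (𝓝[Icc 0 δ] s) (𝓝 0) := by
    have := ((((T.tendsto_zero_right x).comp h0).sub_const x).norm).const_mul M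
    simpa using this
  refine tendsto_iff_norm_sub_tendsto_zero.2 (squeeze_zero' (Eventually.of_forall fun t =>
    norm_nonneg _) (eventually_of_mem self_mem_nhdsWithin fun t ht => key s hs t ht) h1)

variable {T} {G : X → X → Prop}

theorem IsGeneratedBy.map (hT : T.IsGeneratedBy G) {x y : X} (h : G x y) {t : ℝ} (ht : 0 ≤ t) :
    G (T.S t x) (T.S t y) := by
  refine (hT _ _).2 ((((T.S t).continuous.tendsto y).comp ((hT x y).1 h)).congr' ?_)
  refine eventually_of_mem self_mem_nhdsWithin fun s (hs : 0 < s) => ?_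
  simp only [Function.comp_apply, map_smul, map_sub]
  rw [← ContinuousLinearMap.comp_apply, ← ContinuousLinearMap.comp_apply, ← T.map_add _ _ ht hs.le,
    ← T.map_add _ _ hs.le ht, add_comm]

theorem IsGeneratedBy.hasDerivWithinAt (hT : T.IsGeneratedBy G) {x y : X} (h : G x y) {t : ℝ}
    (ht : 0 ≤ t) : HasDerivWithinAt (fun s => T.S s x) (T.S t y) (Ici t) t := by
  rw [← hasDerivWithinAt_Ioi_iff_Ici, hasDerivWithinAt_iff_tendsto_slope' (by simp)]
  have h1 := (hT _ _).1 (hT.map h ht)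
  have h2 : Tendsto (fun s => s - t) (𝓝[>] t) (𝓝[>] 0) := by
    refine tendsto_nhdsWithin_iff.2 ⟨?_, eventually_of_mem self_mem_nhdsWithin fun s hs =>
      mem_Ioi.2 (sub_pos.2 hs)⟩
    have : Tendsto (fun s => s - t) (𝓝 t) (𝓝 (t - t)) :=
      (continuous_id.sub continuous_const).tendsto t
    rw [sub_self] at this
    exact this.mono_left nhdsWithin_le_nhds
  refine (h1.comp h2).congr' (eventually_of_mem self_mem_nhdsWithin fun s (hs : t < s) => ?_)
  simp only [Function.comp_apply, slope, vsub_eq_sub]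
  rw [← ContinuousLinearMap.comp_apply, ← T.map_add _ _ (sub_nonneg.2 hs.le) ht, sub_add_cancel,
    ← Complex.ofReal_inv, Complex.coe_smul]

end Banach

section Hilbert

variable {H : Type*} [NormedAddCommGroup H] [InnerProductSpace ℂ H] [CompleteSpace H]
  {T : C0Semigroup H} {R : H →L[ℂ] H}

omit [CompleteSpace H] in
/-- The condition `‖R y‖² ≤ Re ⟪y, R y⟫` expresses that `A` is dissipative. -/
theorem _root_.resolventGraph.re_inner_nonpos (hR : ∀ y, ‖R y‖ ^ 2 ≤ (inner ℂ y (R y)).re)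
    {x y : H} (h : resolventGraph R x y) : (inner ℂ y x).re ≤ 0 := by
  have h1 := hR (x - y)
  have h2 : R (x - y) = x := h
  rw [h2, inner_sub_left, inner_self_eq_ofReal, Complex.sub_re, Complex.ofReal_re] at h1
  linarith

theorem _root_.denseRange_of_firmlyNonexpansive (hR : ∀ y, ‖R y‖ ^ 2 ≤ (inner ℂ y (R y)).re)
    (hinj : ∀ y, R y = 0 → y = 0) : DenseRange R := by
  have h : (LinearMap.range (R : H →ₗ[ℂ] H)).topologicalClosure = ⊤ := by
    rw [Submodule.topologicalClosure_eq_top_iff, Submodule.eq_bot_iff]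
    intro z hz
    have h1 : inner ℂ (R z) z = 0 := (Submodule.mem_orthogonal _ _).1 hz _ ⟨z, rfl⟩
    have h2 := hR z
    rw [← inner_conj_symm, h1] at h2
    refine hinj z (norm_eq_zero.1 (pow_eq_zero_iff two_ne_zero |>.1 (le_antisymm ?_ (sq_nonneg _))))
    simpa using h2
  have h2 := Submodule.dense_iff_topologicalClosure_eq_top.2 h
  rwa [LinearMap.coe_range] at h2

omit [CompleteSpace H] in
theorem commute_resolvent (hT : T.IsGeneratedBy (resolventGraph R)) {t : ℝ} (ht : 0 ≤ t) (y : H) :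
    T.S t (R y) = R (T.S t y) := by
  have h : resolventGraph R (R y) (R y - y) := by simp [resolventGraph]
  have h1 : R (T.S t (R y) - T.S t (R y - y)) = T.S t (R y) := hT.map h ht
  rw [← h1, ← map_sub]; simp

theorem norm_le_of_isGeneratedBy (hT : T.IsGeneratedBy (resolventGraph R))
    (hR : ∀ y, ‖R y‖ ^ 2 ≤ (inner ℂ y (R y)).re) (hinj : ∀ y, R y = 0 → y = 0) {t : ℝ}
    (ht : 0 ≤ t) (x : H) : ‖T.S t x‖ ≤ ‖x‖ := by
  -- By dissipativity the bound holds for short times on the domain `range R` of the generator, then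
  -- by density everywhere, and by iteration for all times.
  obtain ⟨δ, hδ, M, hM⟩ := T.exists_local_bound
  have hlocR : ∀ t ∈ Icc 0 δ, ∀ y, ‖T.S t (R y)‖ ≤ ‖R y‖ := by
    intro t ht y
    have hc := T.continuousOn_of_bound hM (R y)
    have h : resolventGraph R (R y) (R y - y) := by simp [resolventGraph]
    have h1 : ‖T.S t (R y)‖ ^ 2 ≤ ‖R y‖ ^ 2 := by
      refine image_le_of_deriv_right_le_deriv_boundary (a := 0) (b := δ)
        (f := fun s => ‖T.S s (R y)‖ ^ 2)
        (f' := fun s => 2 * (inner ℂ (T.S s (R y)) (T.S s (R y - y))).re)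
        (B := fun _ => ‖R y‖ ^ 2) (B' := fun _ => 0) (hc.norm.pow 2) (fun s hs => ?_) ?_
        continuousOn_const (fun s _ => hasDerivWithinAt_const _ _ _) (fun s hs => ?_) ht
      · have hd := hT.hasDerivWithinAt h hs.1
        let _ : InnerProductSpace ℝ H := InnerProductSpace.rclikeToReal ℂ H
        exact hd.norm_sq
      · simp [T.map_zero]
      · have := (hT.map h hs.1).re_inner_nonpos hR
        rw [← inner_conj_symm, Complex.conj_re] at this
        linarith
    exact (sq_le_sq₀ (norm_nonneg _) (norm_nonneg _)).1 h1
  have hloc : ∀ t ∈ Icc 0 δ, ∀ y, ‖T.S t y‖ ≤ ‖y‖ := fun t ht y =>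
    (denseRange_of_firmlyNonexpansive hR hinj).induction_on y
      (isClosed_le (T.S t).continuous.norm continuous_norm) (hlocR t ht)
  have hiter : ∀ n : ℕ, ∀ t, 0 ≤ t → t ≤ n * δ → ∀ y, ‖T.S t y‖ ≤ ‖y‖ := by
    intro n
    induction n with
    | zero =>
      intro t h0 h1 y
      have : t = 0 := le_antisymm (by simpa using h1) h0
      simp [this, T.map_zero]
    | succ n ih =>
      intro t h0 h1 y
      rcases le_total t δ with h | h
      · exact hloc t ⟨h0, h⟩ y
      · have h2 : T.S t y = T.S (t - δ) (T.S δ y) := by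
          rw [← ContinuousLinearMap.comp_apply, ← T.map_add _ _ (sub_nonneg.2 h) hδ.le,
            sub_add_cancel]
        rw [h2]
        refine (ih (t - δ) (sub_nonneg.2 h) ?_ _).trans (hloc δ ⟨hδ.le, le_rfl⟩ y)
        push_cast at h1
        linarith
  obtain ⟨n, hn⟩ := exists_nat_ge (t / δ)
  exact hiter n t ht ((div_le_iff₀ hδ).1 hn) x

end Hilbert

end C0Semigroup

namespace C0Semigroup

variable {H : Type*} [NormedAddCommGroup H] [InnerProductSpace ℂ H] [CompleteSpace H]
  {T : C0Semigroup H} {R : H →L[ℂ] H}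

/-- For a contraction `S`, the vectors whose norm `S` preserves are the fixed points of `S* S`. -/
theorem _root_.norm_eq_iff_adjoint_apply_eq {S : H →L[ℂ] H} (hS : ∀ x, ‖S x‖ ≤ ‖x‖) (z : H) :
    ‖S z‖ = ‖z‖ ↔ S.adjoint (S z) = z := by
  constructor
  · intro h
    have h1 := norm_adjoint_comp_sub_sq S 1 z
    have h2 : ‖S.adjoint (S z)‖ ≤ ‖z‖ := by
      have h3 : ‖S‖ ≤ 1 := S.opNorm_le_bound zero_le_one fun x => by simpa using hS x
      calc ‖S.adjoint (S z)‖ ≤ ‖S.adjoint‖ * ‖S z‖ := S.adjoint.le_opNorm _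
        _ ≤ 1 * ‖z‖ := by
          rw [LinearIsometryEquiv.norm_map, h]
          exact mul_le_mul_of_nonneg_right h3 (norm_nonneg _)
        _ = ‖z‖ := one_mul _
    have h3 : ‖S.adjoint (S z)‖ ^ 2 ≤ ‖z‖ ^ 2 := pow_le_pow_left₀ (norm_nonneg _) h2 2
    rw [h] at h1
    have h4 : ‖S.adjoint (S z) - ((1 : ℝ) : ℂ) • z‖ ^ 2 ≤ 0 := by rw [h1]; linarith
    have h5 := norm_eq_zero.1 (pow_eq_zero_iff two_ne_zero |>.1 (le_antisymm h4 (sq_nonneg _)))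
    simpa [sub_eq_zero] using h5
  · intro h
    have h1 : inner ℂ (S.adjoint (S z)) z = inner ℂ z z := by rw [h]
    rw [ContinuousLinearMap.adjoint_inner_left, inner_self_eq_ofReal, inner_self_eq_ofReal,
      Complex.ofReal_inj] at h1
    exact (sq_eq_sq₀ (norm_nonneg _) (norm_nonneg _)).1 h1

/-- The closed subspace of the states along whose trajectories the norm is constant. -/
noncomputable def isometricPart (T : C0Semigroup H) : Submodule ℂ H :=
  ⨅ s : {s : ℝ // 0 ≤ s}, LinearMap.ker
    (((T.S s).adjoint.comp (T.S s) - ContinuousLinearMap.id ℂ H : H →L[ℂ] H) : H →ₗ[ℂ] H)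

theorem isClosed_isometricPart : IsClosed (T.isometricPart : Set H) := by
  rw [isometricPart, Submodule.coe_iInf]
  exact isClosed_iInter fun s => ContinuousLinearMap.isClosed_ker _

theorem mem_isometricPart (hT : ∀ t, 0 ≤ t → ∀ x, ‖T.S t x‖ ≤ ‖x‖) {z : H} :
    z ∈ T.isometricPart ↔ ∀ s, 0 ≤ s → ‖T.S s z‖ = ‖z‖ := by
  simp only [isometricPart, Submodule.mem_iInf, LinearMap.mem_ker, ContinuousLinearMap.coe_coe,
    _root_.sub_apply, ContinuousLinearMap.comp_apply, ContinuousLinearMap.id_apply, sub_eq_zero,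
    Subtype.forall]
  exact forall₂_congr fun s hs => (norm_eq_iff_adjoint_apply_eq (hT s hs) z).symm

theorem map_mem_isometricPart (hT : ∀ t, 0 ≤ t → ∀ x, ‖T.S t x‖ ≤ ‖x‖) {z : H}
    (hz : z ∈ T.isometricPart) {t : ℝ} (ht : 0 ≤ t) : T.S t z ∈ T.isometricPart := by
  rw [mem_isometricPart hT] at hz ⊢
  intro s hs
  rw [← ContinuousLinearMap.comp_apply, ← T.map_add _ _ hs ht, hz _ (add_nonneg hs ht), hz t ht]

/-- The isometric part is invariant under the resolvent: the component `p` of `x = R z` orthogonal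
to it satisfies `‖p‖² = lim Re ⟪p, (T(h) p - p) / h⟫ ≤ 0`. -/
theorem resolvent_mem_isometricPart (hgen : T.IsGeneratedBy (resolventGraph R))
    (hT : ∀ t, 0 ≤ t → ∀ x, ‖T.S t x‖ ≤ ‖x‖) {z : H} (hz : z ∈ T.isometricPart) :
    R z ∈ T.isometricPart := by
  have : CompleteSpace T.isometricPart := isClosed_isometricPart.completeSpace_coe
  obtain ⟨m, hm, p, hp, hx⟩ := T.isometricPart.exists_add_mem_mem_orthogonal (R z)
  have hG : resolventGraph R (R z) (R z - z) := by simp [resolventGraph]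
  have hort : ∀ y ∈ T.isometricPart, inner ℂ p y = 0 := fun y hy =>
    Submodule.inner_left_of_mem_orthogonal hy hp
  have hlim := ((continuous_const (y := p)).inner (𝕜 := ℂ) continuous_id).tendsto (R z - z)
  have hlim' := (Complex.continuous_re.tendsto _).comp (hlim.comp ((hgen _ _).1 hG))
  have h1 : (inner ℂ p (R z - z)).re = ‖p‖ ^ 2 := by
    rw [inner_sub_right, hort z hz, hx, inner_add_right, hort m hm, inner_self_eq_ofReal,
      sub_zero, zero_add, Complex.ofReal_re]
  have h2 : ‖p‖ ^ 2 ≤ 0 := by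
    rw [← h1]
    refine le_of_tendsto hlim' (eventually_of_mem self_mem_nhdsWithin fun h (hh : 0 < h) => ?_)
    simp only [Function.comp_apply, id_eq]
    rw [hx, _root_.map_add, add_sub_add_comm, inner_smul_right, inner_add_right, inner_sub_right,
      hort _ (map_mem_isometricPart hT hm hh.le), hort m hm, inner_sub_right,
      inner_self_eq_ofReal, ← Complex.ofReal_inv, Complex.re_ofReal_mul]
    refine mul_nonpos_of_nonneg_of_nonpos (inv_nonneg.2 hh.le) ?_
    have h3 : (inner ℂ p (T.S h p)).re ≤ ‖p‖ * ‖T.S h p‖ := re_inner_le_norm (𝕜 := ℂ) _ _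
    have h4 := mul_le_mul_of_nonneg_left (hT h hh.le p) (norm_nonneg p)
    simp only [sub_zero, zero_add, Complex.sub_re, Complex.ofReal_re]
    nlinarith
  have h3 : p = 0 := norm_eq_zero.1 (pow_eq_zero_iff two_ne_zero |>.1
    (le_antisymm h2 (sq_nonneg _)))
  rw [hx, h3, add_zero]
  exact hm

/-- The restriction of `R` to the isometric part is compact, and `2 R - 1` is isometric there; so if
the isometric part is nonzero, `R` has an eigenvector in it. -/
theorem isometricPart_eq_bot (hgen : T.IsGeneratedBy (resolventGraph R))
    (hT : ∀ t, 0 ≤ t → ∀ x, ‖T.S t x‖ ≤ ‖x‖) (hcomp : IsCompactOperator R)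
    (hinj : ∀ y, R y = 0 → y = 0)
    (hev : ∀ (ω : ℝ) (x : H), resolventGraph R x ((ω * Complex.I) • x) → x = 0) :
    T.isometricPart = ⊥ := by
  by_contra hne
  have : CompleteSpace T.isometricPart := isClosed_isometricPart.completeSpace_coe
  have : Nontrivial T.isometricPart := Submodule.nontrivial_iff_ne_bot.2 hne
  have hiso : ∀ z ∈ T.isometricPart, ‖R z‖ ^ 2 = (inner ℂ z (R z)).re := by
    intro z hz
    have hG : resolventGraph R (R z) (R z - z) := by simp [resolventGraph]
    have hd := hgen.hasDerivWithinAt hG le_rfl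
    let _ : InnerProductSpace ℝ H := InnerProductSpace.rclikeToReal ℂ H
    have hd1 := hd.norm_sq
    have hd2 : HasDerivWithinAt (fun t => ‖T.S t (R z)‖ ^ 2) 0 (Ici 0) 0 := by
      refine (hasDerivWithinAt_const (0 : ℝ) (Ici 0) (‖R z‖ ^ 2)).congr (fun t ht => ?_) ?_
      · rw [(mem_isometricPart hT).1 (resolvent_mem_isometricPart hgen hT hz) t ht]
      · simp [T.map_zero]
    have h1 := (uniqueDiffWithinAt_Ici (0 : ℝ)).eq_deriv _ hd1 hd2
    have h2 : (inner ℂ (R z) (R z - z)).re = 0 := by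
      have h3 : 2 * (inner ℂ (T.S 0 (R z)) (T.S 0 (R z - z))).re = 0 := h1
      simpa [T.map_zero] using h3
    rw [inner_sub_right, inner_self_eq_ofReal, Complex.sub_re, Complex.ofReal_re,
      ← inner_conj_symm, Complex.conj_re] at h2
    linarith
  set RM : T.isometricPart →L[ℂ] T.isometricPart :=
    (R.comp T.isometricPart.subtypeL).codRestrict T.isometricPart
      (fun z => resolvent_mem_isometricPart hgen hT z.2) with hRM
  have hRMc : IsCompactOperator RM :=
    (hcomp.comp_clm T.isometricPart.subtypeL).codRestrict
      (fun z => resolvent_mem_isometricPart hgen hT z.2) isClosed_isometricPart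
  obtain ⟨ν, x, hx, hνx⟩ := hRMc.exists_eigenvector
    (fun z hz => Subtype.ext (hinj z (congrArg Subtype.val hz))) (fun z => hiso z z.2)
  have hνx' : R (x : H) = ν • (x : H) := congrArg Subtype.val hνx
  have hx' : (x : H) ≠ 0 := fun h => hx (Subtype.ext h)
  have hν : ν ≠ 0 := by
    rintro rfl
    exact hx' (hinj _ (by rw [hνx', zero_smul]))
  -- The eigenvalue `1 - ν⁻¹` of the generator lies on the imaginary axis.
  have hre : (1 - ν⁻¹).re = 0 := by
    have h1 := hiso x x.2
    rw [hνx', norm_smul, inner_smul_right, inner_self_eq_ofReal, mul_pow, Complex.re_mul_ofReal]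
      at h1
    have h2 := mul_right_cancel₀ (pow_ne_zero 2 (norm_ne_zero_iff.2 hx')) h1
    rw [Complex.sub_re, Complex.inv_re, Complex.one_re, Complex.normSq_eq_norm_sq, ← h2,
      div_self (pow_ne_zero 2 (norm_ne_zero_iff.2 hν)), sub_self]
  refine hx' (hev (1 - ν⁻¹).im x ?_)
  have h1 : (((1 - ν⁻¹).im : ℝ) * Complex.I : ℂ) = 1 - ν⁻¹ := by
    conv_rhs => rw [← Complex.re_add_im (1 - ν⁻¹), hre]
    simp
  rw [resolventGraph, h1, sub_smul, one_smul, sub_sub_cancel, map_smul, hνx', inv_smul_smul₀ hν]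

/-- A semigroup whose generator is dissipative with compact resolvent and has no eigenvalue on the
imaginary axis is strongly stable. Limit points of a trajectory through the range of `R` exist by
compactness, and they lie in the isometric part. -/
theorem tendsto_zero (hgen : T.IsGeneratedBy (resolventGraph R))
    (hR : ∀ y, ‖R y‖ ^ 2 ≤ (inner ℂ y (R y)).re) (hcomp : IsCompactOperator R)
    (hinj : ∀ y, R y = 0 → y = 0)
    (hev : ∀ (ω : ℝ) (x : H), resolventGraph R x ((ω * Complex.I) • x) → x = 0) (x : H) :
    Tendsto (fun t => T.S t x) atTop (𝓝 0) := by
  have hT : ∀ t, 0 ≤ t → ∀ x, ‖T.S t x‖ ≤ ‖x‖ := fun t ht x =>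
    norm_le_of_isGeneratedBy hgen hR hinj ht x
  have hbot := isometricPart_eq_bot hgen hT hcomp hinj hev
  -- Negative times carry no information, so they are cut off at zero.
  have hanti : ∀ x, Antitone fun t => ‖T.S (max t 0) x‖ := by
    intro x s t hst
    have h1 : T.S (max t 0) x = T.S (max t 0 - max s 0) (T.S (max s 0) x) := by
      rw [← ContinuousLinearMap.comp_apply, ← T.map_add _ _
        (sub_nonneg.2 (max_le_max_right 0 hst)) (le_max_right _ _), sub_add_cancel]
    simp only [h1]
    exact hT _ (sub_nonneg.2 (max_le_max_right 0 hst)) _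
  have hR0 : ∀ y, Tendsto (fun t => ‖T.S (max t 0) (R y)‖) atTop (𝓝 0) := by
    intro y
    have hc := tendsto_atTop_ciInf (hanti (R y)) ⟨0, by rintro _ ⟨t, rfl⟩; exact norm_nonneg _⟩
    set c := ⨅ t, ‖T.S (max t 0) (R y)‖ with hcdef
    obtain ⟨K, hK, hKsub⟩ := hcomp.image_closedBall_subset_compact (f := (R : H →ₗ[ℂ] H)) ‖y‖
    obtain ⟨z, -, φ, hφ, hz⟩ := hK.tendsto_subseq (x := fun n : ℕ => T.S n (R y)) fun n =>
      hKsub ⟨T.S n y, by simpa using hT n n.cast_nonneg y,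
        (commute_resolvent hgen n.cast_nonneg y).symm⟩
    have hzc : ∀ s, 0 ≤ s → ‖T.S s z‖ = c := by
      intro s hs
      have h1 := (((T.S s).continuous.tendsto z).comp hz).norm
      have h2 : Tendsto (fun n => s + (φ n : ℝ)) atTop atTop :=
        tendsto_atTop_add_const_left _ _ (tendsto_natCast_atTop_atTop.comp hφ.tendsto_atTop)
      refine tendsto_nhds_unique (h1.congr fun n => ?_) (hc.comp h2)
      simp only [Function.comp_apply]
      rw [max_eq_left (add_nonneg hs (Nat.cast_nonneg _)), T.map_add _ _ hs (Nat.cast_nonneg _)]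
      rfl
    have hz0 : z = 0 := by
      have h1 : z ∈ T.isometricPart := (mem_isometricPart hT).2 fun s hs => by
        rw [hzc s hs, ← hzc 0 le_rfl, T.map_zero]; rfl
      rwa [hbot, Submodule.mem_bot] at h1
    have hc0 : c = 0 := by rw [← hzc 0 le_rfl, hz0, _root_.map_zero, norm_zero]
    rwa [hc0] at hc
  rw [tendsto_zero_iff_norm_tendsto_zero]
  have hall : Tendsto (fun t => ‖T.S (max t 0) x‖) atTop (𝓝 0) := by
    rw [Metric.tendsto_nhds]
    intro ε hε
    obtain ⟨y, hy⟩ := (denseRange_of_firmlyNonexpansive hR hinj).exists_dist_lt x (half_pos hε)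
    filter_upwards [Metric.tendsto_nhds.1 (hR0 y) (ε / 2) (half_pos hε)] with t ht
    rw [dist_zero_right, norm_norm] at ht ⊢
    have h1 : T.S (max t 0) x = T.S (max t 0) (x - R y) + T.S (max t 0) (R y) := by
      rw [← _root_.map_add, sub_add_cancel]
    rw [h1]
    refine (norm_add_le _ _).trans_lt ?_
    have h2 := hT (max t 0) (le_max_right _ _) (x - R y)
    rw [dist_eq_norm] at hy
    linarith
  refine hall.congr' ?_
  filter_upwards [eventually_ge_atTop 0] with t ht
  rw [max_eq_left ht]

end C0Semigroup

/-! ### Generation of contraction semigroups -/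

section Generation

variable {H : Type*} [NormedAddCommGroup H] [InnerProductSpace ℂ H] [CompleteSpace H]

theorem hasDerivAt_exp_smul_apply (B : H →L[ℂ] H) (x : H) (t : ℝ) :
    HasDerivAt (fun s : ℝ => NormedSpace.exp (s • B) x) (NormedSpace.exp (t • B) (B x)) t :=
  (((ContinuousLinearMap.apply ℂ H x).restrictScalars ℝ).hasFDerivAt.comp_hasDerivAt t
    (hasDerivAt_exp_smul_const (𝕂 := ℝ) B t))

theorem commute_exp_smul {B C : H →L[ℂ] H} (h : Commute B C) (t : ℝ) :
    Commute B (NormedSpace.exp (t • C)) := (h.smul_right t).exp_right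

theorem norm_exp_smul_apply_le {B : H →L[ℂ] H} (hB : ∀ x, (inner ℂ x (B x)).re ≤ 0) {t : ℝ}
    (ht : 0 ≤ t) (x : H) : ‖NormedSpace.exp (t • B) x‖ ≤ ‖x‖ := by
  let _ : InnerProductSpace ℝ H := InnerProductSpace.rclikeToReal ℂ H
  have hd : ∀ s : ℝ, HasDerivAt (fun s : ℝ => ‖NormedSpace.exp (s • B) x‖ ^ 2)
      (2 * (inner ℂ (NormedSpace.exp (s • B) x) (NormedSpace.exp (s • B) (B x))).re) s := fun s =>
    (hasDerivAt_exp_smul_apply B x s).norm_sq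
  have hanti : Antitone fun s : ℝ => ‖NormedSpace.exp (s • B) x‖ ^ 2 := by
    refine antitone_of_deriv_nonpos (fun s => (hd s).differentiableAt) fun s => ?_
    rw [(hd s).deriv]
    have h1 : NormedSpace.exp (s • B) (B x) = B (NormedSpace.exp (s • B) x) :=
      congrArg (fun S : H →L[ℂ] H => S x) (commute_exp_smul (Commute.refl B) s).eq.symm
    rw [h1]
    linarith [hB (NormedSpace.exp (s • B) x)]
  have h1 := hanti ht
  simp only [zero_smul, NormedSpace.exp_zero, one_apply_eq_self] at h1
  exact (sq_le_sq₀ (norm_nonneg _) (norm_nonneg _)).1 h1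

/-- The two semigroups are the end values of `s ↦ exp (s B) exp ((t - s) C) x`. -/
theorem norm_exp_smul_sub_exp_smul_le {B C : H →L[ℂ] H} (hB : ∀ x, (inner ℂ x (B x)).re ≤ 0)
    (hC : ∀ x, (inner ℂ x (C x)).re ≤ 0) (hBC : Commute B C) {t : ℝ} (ht : 0 ≤ t) (x : H) :
    ‖NormedSpace.exp (t • B) x - NormedSpace.exp (t • C) x‖ ≤ t * ‖B x - C x‖ := by
  have hd : ∀ s : ℝ, HasDerivAt
      (fun s : ℝ => (NormedSpace.exp (s • B) * NormedSpace.exp ((t - s) • C)) x)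
      (NormedSpace.exp (s • B) (NormedSpace.exp ((t - s) • C) (B x - C x))) s := by
    intro s
    have h1 := hasDerivAt_exp_smul_const (𝕂 := ℝ) B s
    have h2 : HasDerivAt (fun s : ℝ => NormedSpace.exp ((t - s) • C))
        ((-1 : ℝ) • (C * NormedSpace.exp ((t - s) • C))) s :=
      (hasDerivAt_exp_smul_const' (𝕂 := ℝ) C (t - s)).scomp s ((hasDerivAt_id s).const_sub t)
    have h3 := ((ContinuousLinearMap.apply ℂ H x).restrictScalars ℝ).hasFDerivAt.comp_hasDerivAt s
      (h1.mul h2)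
    refine h3.congr_deriv ?_
    have e1 : B * NormedSpace.exp ((t - s) • C) = NormedSpace.exp ((t - s) • C) * B :=
      (commute_exp_smul hBC (t - s)).eq
    have e2 : C * NormedSpace.exp ((t - s) • C) = NormedSpace.exp ((t - s) • C) * C :=
      (commute_exp_smul (Commute.refl C) (t - s)).eq
    rw [e2, mul_assoc, e1]
    simp [sub_eq_add_neg]
  have h1 := norm_image_sub_le_of_norm_deriv_le_segment' (a := 0) (b := t)
    (C := ‖B x - C x‖) (fun s _ => (hd s).hasDerivWithinAt) (fun s hs => ?_) t ⟨ht, le_rfl⟩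
  · simpa [NormedSpace.exp_zero, mul_comm] using h1
  · exact (norm_exp_smul_apply_le hB hs.1 _).trans
      (norm_exp_smul_apply_le hC (sub_nonneg.2 hs.2.le) _)

/-- A first-order expansion of `exp (t B) x`, where `y` approximates `B x`. The bound does not
involve the norm of `B`. -/
theorem norm_exp_smul_sub_sub_le {B : H →L[ℂ] H} (hB : ∀ x, (inner ℂ x (B x)).re ≤ 0) {t : ℝ}
    (ht : 0 ≤ t) (x y : H) : ‖NormedSpace.exp (t • B) x - x - t • y‖ ≤
      (‖B x - y‖ + t * ‖B y‖) * t := by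
  have hd : ∀ s : ℝ, HasDerivAt (fun s : ℝ => NormedSpace.exp (s • B) x - s • y)
      (NormedSpace.exp (s • B) (B x) - (1 : ℝ) • y) s := fun s =>
    (hasDerivAt_exp_smul_apply B x s).sub ((hasDerivAt_id s).smul_const y)
  have h1 := norm_image_sub_le_of_norm_deriv_le_segment' (a := 0) (b := t)
    (C := ‖B x - y‖ + t * ‖B y‖) (fun s _ => (hd s).hasDerivWithinAt) (fun s hs => ?_) t
    ⟨ht, le_rfl⟩
  · simpa [NormedSpace.exp_zero, sub_right_comm] using h1
  · have e1 : NormedSpace.exp (s • B) (B x) - (1 : ℝ) • y =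
        NormedSpace.exp (s • B) (B x - y) + (NormedSpace.exp (s • B) y - y) := by
      rw [map_sub, one_smul]; abel
    rw [e1]
    refine (norm_add_le _ _).trans (add_le_add (norm_exp_smul_apply_le hB hs.1 _) ?_)
    have h2 := norm_exp_smul_sub_exp_smul_le hB (C := 0) (by simp) (Commute.zero_right B) hs.1 y
    simp only [smul_zero, NormedSpace.exp_zero, one_apply_eq_self, _root_.zero_apply,
      sub_zero] at h2
    exact h2.trans (mul_le_mul_of_nonneg_right hs.2.le (norm_nonneg _))

/-- Contractions that converge on a dense set converge everywhere. -/
theorem exists_tendsto_of_denseRange {Y : Type*} {r : Y → H} (hr : DenseRange r)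
    {E : ℕ → H →L[ℂ] H} (hE : ∀ n x, ‖E n x‖ ≤ ‖x‖)
    (hlim : ∀ y, CauchySeq fun n => E n (r y)) (x : H) :
    ∃ z, Tendsto (fun n => E n x) atTop (𝓝 z) := by
  refine cauchySeq_tendsto_of_complete (Metric.cauchySeq_iff'.2 fun ε hε => ?_)
  obtain ⟨y, hy⟩ := hr.exists_dist_lt x (show 0 < ε / 3 by positivity)
  obtain ⟨N, hN⟩ := Metric.cauchySeq_iff'.1 (hlim y) (ε / 3) (by positivity)
  refine ⟨N, fun n hn => ?_⟩
  have h1 := hN n hn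
  rw [dist_eq_norm] at h1 hy ⊢
  have e1 : E n x - E N x = E n (x - r y) + (E n (r y) - E N (r y)) - E N (x - r y) := by
    simp only [map_sub]; abel
  rw [e1]
  have h2 := hE n (x - r y)
  have h3 := hE N (x - r y)
  have h4 := norm_sub_le (E n (x - r y) + (E n (r y) - E N (r y))) (E N (x - r y))
  have h5 := norm_add_le (E n (x - r y)) (E n (r y) - E N (r y))
  linarith

omit [InnerProductSpace ℂ H] [CompleteSpace H] in
/-- Operators with a uniform bound that converge to zero on a dense set converge to zero
everywhere. -/
theorem tendsto_zero_of_denseRange {ι Y : Type*} {l : Filter ι} {r : Y → H} (hr : DenseRange r)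
    {E : ι → H → H} (hsub : ∀ i x y, E i (x - y) = E i x - E i y) {C : ℝ}
    (hE : ∀ᶠ i in l, ∀ x, ‖E i x‖ ≤ C * ‖x‖)
    (hlim : ∀ y, Tendsto (fun i => E i (r y)) l (𝓝 0)) (x : H) :
    Tendsto (fun i => E i x) l (𝓝 0) := by
  rw [Metric.tendsto_nhds]
  intro ε hε
  have hC : 0 < 2 * (|C| + 1) := by positivity
  obtain ⟨y, hy⟩ := hr.exists_dist_lt x (show 0 < ε / (2 * (|C| + 1)) by positivity)
  filter_upwards [hE, Metric.tendsto_nhds.1 (hlim y) (ε / 2) (half_pos hε)] with i h1 h2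
  rw [dist_zero_right] at h2 ⊢
  rw [dist_eq_norm, lt_div_iff₀ hC] at hy
  have e1 : E i x = E i (x - r y) + E i (r y) := by rw [hsub]; abel
  have h3 := h1 (x - r y)
  have h4 := norm_add_le (E i (x - r y)) (E i (r y))
  have h5 := mul_le_mul_of_nonneg_right (le_abs_self C) (norm_nonneg (x - r y))
  rw [e1]
  nlinarith [norm_nonneg (x - r y)]

/-- If commuting dissipative bounded operators `Bₙ` converge on the range of `R = (1 - A)⁻¹` to `A`,
which maps `R y` to `R y - y`, then the semigroups `exp (t Bₙ)` converge to a contraction semigroup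
whose generator extends `A`. -/
theorem exists_semigroup_of_tendsto {R : H →L[ℂ] H} (hdense : DenseRange R)
    (hRle : ∀ y, ‖R y‖ ≤ ‖y‖) {B : ℕ → H →L[ℂ] H} (hB : ∀ n x, (inner ℂ x (B n x)).re ≤ 0)
    (hcomm : ∀ m n, Commute (B m) (B n))
    (hlim : ∀ y, Tendsto (fun n => B n (R y)) atTop (𝓝 (R y - y))) :
    ∃ T : C0Semigroup H, (∀ t, 0 ≤ t → ∀ x, ‖T.S t x‖ ≤ ‖x‖) ∧ ∀ y,
      Tendsto (fun t : ℝ => (t : ℂ)⁻¹ • (T.S t (R y) - R y)) (𝓝[>] 0) (𝓝 (R y - y)) := by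
  have hconv : ∀ (t : ℝ) (x : H), ∃ z,
      Tendsto (fun n => NormedSpace.exp (max t 0 • B n) x) atTop (𝓝 z) := by
    intro t
    refine exists_tendsto_of_denseRange hdense
      (fun n x => norm_exp_smul_apply_le (hB n) (le_max_right _ _) x) fun y => ?_
    have h1 := (hlim y).cauchySeq
    refine Metric.cauchySeq_iff'.2 fun ε hε => ?_
    have hpos : 0 < max t 0 + 1 := by positivity
    obtain ⟨N, hN⟩ := Metric.cauchySeq_iff'.1 h1 (ε / (max t 0 + 1)) (by positivity)
    refine ⟨N, fun n hn => ?_⟩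
    have h2 := hN n hn
    rw [dist_eq_norm] at h2 ⊢
    refine (norm_exp_smul_sub_exp_smul_le (hB n) (hB N) (hcomm n N) (le_max_right _ _)
      (R y)).trans_lt ?_
    rw [lt_div_iff₀ hpos] at h2
    nlinarith [norm_nonneg (B n (R y) - B N (R y))]
  choose f hf using hconv
  set S : ℝ → H →L[ℂ] H := fun t => continuousLinearMapOfTendsto
    (fun n => NormedSpace.exp (max t 0 • B n)) (tendsto_pi_nhds.2 (hf t)) with hS
  have hSlim : ∀ t, 0 ≤ t → ∀ x,
      Tendsto (fun n => NormedSpace.exp (t • B n) x) atTop (𝓝 (S t x)) := by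
    intro t ht x
    have := hf t x
    rwa [max_eq_left ht] at this
  have hScontr : ∀ t, 0 ≤ t → ∀ x, ‖S t x‖ ≤ ‖x‖ := fun t ht x =>
    le_of_tendsto (hSlim t ht x).norm
      (Eventually.of_forall fun n => norm_exp_smul_apply_le (hB n) ht x)
  have hSsub : ∀ t, 0 ≤ t → ∀ y, ‖S t (R y) - R y‖ ≤ t * ‖R y - y‖ := by
    intro t ht y
    refine le_of_tendsto_of_tendsto ((hSlim t ht (R y)).sub_const (R y)).norm
      ((hlim y).norm.const_mul t) (Eventually.of_forall fun n => ?_)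
    have h2 := norm_exp_smul_sub_exp_smul_le (hB n) (C := 0) (by simp) (Commute.zero_right _) ht
      (R y)
    simpa [NormedSpace.exp_zero] using h2
  have hSsub2 : ∀ t, 0 ≤ t → ∀ y,
      ‖S t (R (R y)) - R (R y) - t • (R (R y) - R y)‖ ≤ t * ‖R (R y - y) - (R y - y)‖ * t := by
    intro t ht y
    have h3 : Tendsto (fun n => (‖B n (R (R y)) - (R (R y) - R y)‖ +
        t * ‖B n (R (R y - y))‖) * t) atTop
        (𝓝 ((‖(R (R y) - R y) - (R (R y) - R y)‖ + t * ‖R (R y - y) - (R y - y)‖) * t)) :=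
      ((((hlim (R y)).sub_const _).norm).add ((hlim (R y - y)).norm.const_mul t)).mul_const t
    rw [sub_self, norm_zero, zero_add] at h3
    refine le_of_tendsto_of_tendsto (((hSlim t ht (R (R y))).sub_const _).sub_const _).norm h3
      (Eventually.of_forall fun n => ?_)
    have := norm_exp_smul_sub_sub_le (hB n) ht (R (R y)) (R (R y) - R y)
    rwa [map_sub R (R y) y]
  refine ⟨⟨S, ?_, ?_, ?_⟩, hScontr, fun y => ?_⟩
  · ext x
    refine tendsto_nhds_unique (hSlim 0 le_rfl x) ?_
    simp [NormedSpace.exp_zero]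
  · intro s t hs ht
    ext x
    refine tendsto_nhds_unique (hSlim _ (add_nonneg hs ht) x) ?_
    have h1 : Tendsto (fun n => NormedSpace.exp (s • B n)
        (NormedSpace.exp (t • B n) x - S t x)) atTop (𝓝 0) := by
      refine squeeze_zero_norm (fun n => norm_exp_smul_apply_le (hB n) hs _) ?_
      exact tendsto_iff_norm_sub_tendsto_zero.1 (hSlim t ht x)
    have h2 := h1.add (hSlim s hs (S t x))
    rw [zero_add] at h2
    refine h2.congr fun n => ?_
    have h3 : NormedSpace.exp ((s + t) • B n) =
        NormedSpace.exp (s • B n) * NormedSpace.exp (t • B n) := by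
      let _ : NormedAlgebra ℚ (H →L[ℂ] H) := NormedAlgebra.restrictScalars ℚ ℝ _
      rw [add_smul]
      exact NormedSpace.exp_add_of_commute
        (((Commute.refl (B n)).smul_left s).smul_right t)
    rw [h3, ← map_add, sub_add_cancel]
    rfl
  · intro x
    have h1 : Tendsto (fun t => S t x - x) (𝓝[>] 0) (𝓝 0) := by
      refine tendsto_zero_of_denseRange (E := fun t x => S t x - x) (C := 2) hdense
        (fun t x y => by rw [map_sub]; abel) ?_ (fun y => ?_) x
      · refine eventually_of_mem self_mem_nhdsWithin fun t (ht : 0 < t) x => ?_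
        have := norm_sub_le (S t x) x
        have := hScontr t ht.le x
        linarith
      · have h2 : Tendsto (fun t : ℝ => t * ‖R y - y‖) (𝓝[>] 0) (𝓝 0) := by
          have : Tendsto (fun t : ℝ => t * ‖R y - y‖) (𝓝 0) (𝓝 (0 * ‖R y - y‖)) :=
            (continuous_id.mul continuous_const).tendsto 0
          rw [zero_mul] at this
          exact this.mono_left nhdsWithin_le_nhds
        exact squeeze_zero_norm' (eventually_of_mem self_mem_nhdsWithin
          fun t (ht : 0 < t) => hSsub t ht.le y) h2
    simpa using h1.add_const x
  · -- The derivative at zero exists on the range of `R²` by the expansion of first order, hence on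
    -- the range of `R`, as the difference quotients are bounded there in terms of the preimage.
    have hkey : Tendsto (fun t : ℝ => t⁻¹ • (S t (R y) - R y) - (R y - y)) (𝓝[>] 0) (𝓝 0) := by
      refine tendsto_zero_of_denseRange (r := R) (C := 4) hdense
        (E := fun (t : ℝ) y => t⁻¹ • (S t (R y) - R y) - (R y - y))
        (fun t x y => by simp only [map_sub, smul_sub]; abel) ?_ (fun z => ?_) y
      · refine eventually_of_mem self_mem_nhdsWithin fun t (ht : 0 < t) x => ?_
        have h1 : ‖t⁻¹ • (S t (R x) - R x)‖ ≤ ‖R x - x‖ := by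
          rw [norm_smul, norm_inv, Real.norm_of_nonneg ht.le, inv_mul_le_iff₀ ht]
          exact hSsub t ht.le x
        have h2 := norm_sub_le (t⁻¹ • (S t (R x) - R x)) (R x - x)
        have h3 := norm_sub_le (R x) x
        have h4 := hRle x
        linarith
      · have h2 : Tendsto (fun t : ℝ => t * ‖R (R z - z) - (R z - z)‖) (𝓝[>] 0) (𝓝 0) := by
          have : Tendsto (fun t : ℝ => t * ‖R (R z - z) - (R z - z)‖) (𝓝 0) (𝓝 (0 * _)) :=
            (continuous_id.mul continuous_const).tendsto 0
          rw [zero_mul] at this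
          exact this.mono_left nhdsWithin_le_nhds
        refine squeeze_zero_norm' (eventually_of_mem self_mem_nhdsWithin
          fun t (ht : 0 < t) => ?_) h2
        have h3 := hSsub2 t ht.le z
        have e1 : t⁻¹ • (S t (R (R z)) - R (R z)) - (R (R z) - R z) =
            t⁻¹ • (S t (R (R z)) - R (R z) - t • (R (R z) - R z)) := by
          rw [smul_sub t⁻¹ _ (t • _), inv_smul_smul₀ ht.ne']
        rw [e1, norm_smul, norm_inv, Real.norm_of_nonneg ht.le, inv_mul_le_iff₀ ht]
        linarith
    have h1 := hkey.add_const (R y - y)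
    rw [zero_add] at h1
    refine h1.congr fun t => ?_
    rw [sub_add_cancel, ← Complex.ofReal_inv, Complex.coe_smul]

/-- If `S` is accretive, then `1 + S` is invertible with a contraction as its inverse. -/
theorem exists_inverse_one_add {S : H →L[ℂ] H} (hS : ∀ x, 0 ≤ (inner ℂ x (S x)).re) :
    ∃ D : H →L[ℂ] H, (1 + S) * D = 1 ∧ D * (1 + S) = 1 ∧ ∀ y, ‖D y‖ ≤ ‖y‖ := by
  have hlow : ∀ x, ‖x‖ ^ 2 ≤ ‖inner ℂ ((1 + S) x) x‖ := by
    intro x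
    refine le_trans ?_ (Complex.re_le_norm _)
    rw [← inner_conj_symm, Complex.conj_re, _root_.add_apply, one_apply_eq_self, inner_add_right,
      inner_self_eq_ofReal, Complex.add_re, Complex.ofReal_re]
    linarith [hS x]
  obtain ⟨u, hu⟩ := ContinuousLinearMap.isUnit_of_forall_le_norm_inner_map
    (1 + S) (c := 1) one_pos (fun x => by rw [NNReal.coe_one, mul_one]; exact hlow x)
  refine ⟨((u⁻¹ : (H →L[ℂ] H)ˣ) : H →L[ℂ] H), by rw [← hu]; exact u.mul_inv,
    by rw [← hu]; exact u.inv_mul, fun y => ?_⟩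
  set x := ((u⁻¹ : (H →L[ℂ] H)ˣ) : H →L[ℂ] H) y with hx
  have hy : (1 + S) x = y := by
    rw [← hu, hx, ← mul_apply_eq_comp, u.mul_inv, one_apply_eq_self]
  have h1 := (hlow x).trans (norm_inner_le_norm _ _)
  rw [hy] at h1
  rcases eq_or_lt_of_le (norm_nonneg x) with h | h
  · rw [← h]; exact norm_nonneg _
  · nlinarith

/-- The theorem of Lumer and Phillips, in terms of `R = (1 - A)⁻¹`. The proof takes the limit of
the semigroups generated by the Yosida approximations `s (R - 1) (1 + (s - 1) R)⁻¹` of `A`. -/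
theorem exists_isGeneratedBy_resolventGraph {R : H →L[ℂ] H}
    (hR : ∀ y, ‖R y‖ ^ 2 ≤ (inner ℂ y (R y)).re) (hinj : ∀ y, R y = 0 → y = 0) :
    ∃ T : C0Semigroup H, T.IsGeneratedBy (resolventGraph R) := by
  have hdense := denseRange_of_firmlyNonexpansive hR hinj
  have hRle : ∀ y, ‖R y‖ ≤ ‖y‖ := by
    intro y
    have h1 := (hR y).trans ((Complex.re_le_norm _).trans (norm_inner_le_norm _ _))
    rcases eq_or_lt_of_le (norm_nonneg (R y)) with h | h
    · rw [← h]; exact norm_nonneg _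
    · nlinarith
  -- `D n = (1 + n R)⁻¹`, and `B n` is the Yosida approximation with `s = n + 1`.
  choose D hD1 hD2 hDle using fun n : ℕ =>
    exists_inverse_one_add (S := ((n : ℝ) : ℂ) • R) fun x => by
      rw [_root_.smul_apply, inner_smul_right, Complex.re_ofReal_mul]
      exact mul_nonneg n.cast_nonneg ((sq_nonneg _).trans (hR x))
  have hRD : ∀ n, Commute R (D n) := by
    intro n
    have h1 : Commute R (1 + ((n : ℝ) : ℂ) • R) :=
      (Commute.one_right R).add_right ((Commute.refl R).smul_right _)
    exact h1.units_inv_right (u := ⟨1 + ((n : ℝ) : ℂ) • R, D n, hD1 n, hD2 n⟩)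
  have hDD : ∀ m n, Commute (D m) (D n) := by
    intro m n
    have h1 : Commute (D m) (1 + ((n : ℝ) : ℂ) • R) :=
      (Commute.one_right _).add_right ((hRD m).symm.smul_right _)
    exact h1.units_inv_right (u := ⟨1 + ((n : ℝ) : ℂ) • R, D n, hD1 n, hD2 n⟩)
  set B : ℕ → H →L[ℂ] H := fun n => ((n + 1 : ℝ) : ℂ) • ((R - 1) * D n) with hBdef
  have hBcomm : ∀ m n, Commute (B m) (B n) := by
    intro m n
    have h1 : Commute (R - 1) (R - 1) := Commute.refl _
    have h2 : ∀ k, Commute (R - 1) (D k) := fun k => (hRD k).sub_left (Commute.one_left _)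
    exact (((h1.mul_right (h2 n)).mul_left
      ((h2 m).symm.mul_right (hDD m n))).smul_left _).smul_right _
  have hDapply : ∀ n y, D n y + ((n : ℝ) : ℂ) • R (D n y) = y := fun n y =>
    congrArg (fun S : H →L[ℂ] H => S y) (hD1 n)
  have hBdis : ∀ n x, (inner ℂ x (B n x)).re ≤ 0 := by
    intro n y
    set x := D n y with hx
    have hy : y = x + ((n : ℝ) : ℂ) • R x := (hDapply n y).symm
    have e1 : B n y = ((n + 1 : ℝ) : ℂ) • (R x - x) := by simp [hBdef, ← hx]
    rw [e1, inner_smul_right, Complex.re_ofReal_mul]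
    refine mul_nonpos_of_nonneg_of_nonpos (by positivity) ?_
    rw [hy, inner_add_left, inner_smul_left, inner_sub_right, inner_sub_right,
      inner_self_eq_ofReal, inner_self_eq_ofReal, Complex.conj_ofReal, Complex.add_re,
      Complex.re_ofReal_mul, Complex.sub_re, Complex.sub_re, Complex.ofReal_re, Complex.ofReal_re,
      ← inner_conj_symm (R x) x, Complex.conj_re]
    have h1 : (inner ℂ x (R x)).re ≤ ‖x‖ * ‖R x‖ := re_inner_le_norm (𝕜 := ℂ) _ _
    have h2 := mul_nonneg (Nat.cast_nonneg (α := ℝ) n) (sub_nonneg.2 (hR x))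
    have h3 := mul_le_mul_of_nonneg_left (hRle x) (norm_nonneg x)
    nlinarith
  have hDlim : ∀ y, Tendsto (fun n => D n y) atTop (𝓝 0) := by
    refine tendsto_zero_of_denseRange (E := fun n y => D n y) (C := 1) hdense
      (fun n x y => map_sub _ _ _) (Eventually.of_forall fun n x => by simpa using hDle n x)
      fun z => ?_
    refine squeeze_zero_norm' (a := fun n : ℕ => 2 * ‖z‖ / n) ?_
      (tendsto_const_div_atTop_nhds_zero_nat _)
    filter_upwards [eventually_gt_atTop 0] with n hn
    have hn' : (0 : ℝ) < n := by exact_mod_cast hn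
    have e1 : D n (R z) = R (D n z) :=
      congrArg (fun S : H →L[ℂ] H => S z) (hRD n).eq.symm
    have e2 : ((n : ℝ) : ℂ) • R (D n z) = z - D n z := eq_sub_of_add_eq' (hDapply n z)
    have h1 : (n : ℝ) * ‖R (D n z)‖ = ‖z - D n z‖ := by
      rw [← e2, norm_smul, Complex.norm_real, Real.norm_of_nonneg hn'.le]
    have h2 := norm_sub_le z (D n z)
    have h3 := hDle n z
    rw [e1, le_div_iff₀ hn', mul_comm, h1]
    linarith
  have hBlim : ∀ y, Tendsto (fun n => B n (R y)) atTop (𝓝 (R y - y)) := by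
    intro y
    have e1 : ∀ n, B n (R y) = (R - 1) (y - D n y + R (D n y)) := by
      intro n
      have e2 : D n (R y) = R (D n y) :=
        congrArg (fun S : H →L[ℂ] H => S y) (hRD n).eq.symm
      have e3 : y - D n y + R (D n y) = ((n + 1 : ℝ) : ℂ) • R (D n y) := by
        rw [← eq_sub_of_add_eq' (hDapply n y)]
        push_cast
        rw [add_smul, one_smul]
      rw [e3, map_smul]
      simp [hBdef, e2]
    have h1 : Tendsto (fun n => (R - 1) (y - D n y + R (D n y))) atTop
        (𝓝 ((R - 1) (y - 0 + R 0))) :=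
      ((R - 1).continuous.tendsto _).comp (((hDlim y).const_sub y).add
        ((R.continuous.tendsto _).comp (hDlim y)))
    have h2 : (R - 1) (y - 0 + R 0) = R y - y := by simp
    rw [h2] at h1
    exact h1.congr fun n => (e1 n).symm
  obtain ⟨T, hTc, hT⟩ := exists_semigroup_of_tendsto hdense hRle hBdis hBcomm hBlim
  refine ⟨T, fun x y => ⟨fun h => ?_, fun h => ?_⟩⟩
  · have h1 : R (x - y) = x := h
    have h2 := hT (x - y)
    rwa [h1, sub_sub_cancel] at h2
  · -- The generator of `T` is dissipative, so it cannot properly extend `A`.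
    have h1 := h.sub (hT (x - y))
    set z := x - R (x - y) with hz
    have e1 : y - (R (x - y) - (x - y)) = z := by rw [hz]; abel
    rw [e1] at h1
    have h2 : Tendsto (fun t : ℝ => (inner ℂ z ((t : ℂ)⁻¹ • (T.S t z - z))).re) (𝓝[>] 0)
        (𝓝 (inner ℂ z z).re) := by
      have h3 : Tendsto (fun t : ℝ => (t : ℂ)⁻¹ • (T.S t z - z)) (𝓝[>] 0) (𝓝 z) := by
        refine h1.congr fun t => ?_
        rw [← smul_sub, hz, map_sub (T.S t) x]
        congr 1; abel
      exact (Complex.continuous_re.tendsto _).comp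
        (((continuous_const (y := z)).inner (𝕜 := ℂ) continuous_id).tendsto z |>.comp h3)
    have h3 : (inner ℂ z z).re ≤ 0 := by
      refine le_of_tendsto h2 (eventually_of_mem self_mem_nhdsWithin fun t (ht : 0 < t) => ?_)
      rw [← Complex.ofReal_inv, inner_smul_right, Complex.re_ofReal_mul, inner_sub_right,
        inner_self_eq_ofReal, Complex.sub_re, Complex.ofReal_re]
      refine mul_nonpos_of_nonneg_of_nonpos (inv_nonneg.2 ht.le) ?_
      have h4 : (inner ℂ z (T.S t z)).re ≤ ‖z‖ * ‖T.S t z‖ := re_inner_le_norm (𝕜 := ℂ) _ _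
      have h5 := mul_le_mul_of_nonneg_left (hTc t ht.le z) (norm_nonneg z)
      nlinarith
    rw [inner_self_eq_ofReal, Complex.ofReal_re] at h3
    have h4 := norm_eq_zero.1 (pow_eq_zero_iff two_ne_zero |>.1 (le_antisymm h3 (sq_nonneg _)))
    exact (sub_eq_zero.1 h4).symm

end Generation

/-! ### Abstract beam equations -/

section AbstractBeam

variable {E : Type*} [NormedAddCommGroup E] [InnerProductSpace ℂ E] [CompleteSpace E]

/-- The graph of the generator of the abstract damped system `a = W* (-b') - k ⟪ε, a'⟫ ε`,
`b = W a'`, where `(a, b)` is the state and `(a', b')` its time derivative. -/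
def abstractBeamGraph (W : E →L[ℂ] E) (k : ℝ) (ε : E) (x y : WithLp 2 (E × E)) : Prop :=
  x.snd = W y.fst ∧ W.adjoint y.snd + x.fst + (k * inner ℂ ε y.fst) • ε = 0

/-- The energy balance: only the feedback dissipates. -/
theorem abstractBeamGraph.re_inner {W : E →L[ℂ] E} {k : ℝ} {ε : E} {x y : WithLp 2 (E × E)}
    (h : abstractBeamGraph W k ε x y) : (inner ℂ y x).re = -(k * ‖inner ℂ ε y.fst‖ ^ 2) := by
  have h1 : x.fst + W.adjoint y.snd = -((k * inner ℂ ε y.fst) • ε) := by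
    rw [eq_neg_iff_add_eq_zero, ← h.2]; abel
  have h2 : inner ℂ y x =
      inner ℂ y.fst x.fst + (starRingEnd ℂ) (inner ℂ y.fst (W.adjoint y.snd)) := by
    rw [inner_conj_symm, ContinuousLinearMap.adjoint_inner_left, ← h.1]
    exact WithLp.prod_inner_apply y x
  have h3 : (inner ℂ y x).re = (inner ℂ y.fst (x.fst + W.adjoint y.snd)).re := by
    rw [h2, inner_add_right, Complex.add_re, Complex.add_re, Complex.conj_re]
  rw [h3, h1, inner_neg_right, inner_smul_right, ← inner_conj_symm y.fst ε, mul_assoc,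
    Complex.mul_conj, Complex.neg_re, Complex.normSq_eq_norm_sq, ← Complex.ofReal_mul,
    Complex.ofReal_re]

/-- The abstract damped system has a compact resolvent. With `S = W* W + k ⟪ε, ·⟫ ε`, it takes
`(f, g)` to `(a, W (a - f))`, where `(1 + S) a = S f + W* g`. -/
theorem exists_resolvent_abstractBeam {W : E →L[ℂ] E} (hW : IsCompactOperator W)
    (hW' : IsCompactOperator W.adjoint) {k : ℝ} (hk : 0 ≤ k) (ε : E) :
    ∃ R : WithLp 2 (E × E) →L[ℂ] WithLp 2 (E × E), IsCompactOperator R ∧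
      ∀ x y, abstractBeamGraph W k ε x y ↔ resolventGraph R x y := by
  set S : E →L[ℂ] E := W.adjoint.comp W + (k : ℂ) • (innerSL ℂ ε).smulRight ε with hS
  have hSapp : ∀ x, S x = W.adjoint (W x) + (k * inner ℂ ε x) • ε := fun x => by
    simp [hS, mul_smul]
  have hSre : ∀ x, 0 ≤ (inner ℂ x (S x)).re := by
    intro x
    have h1 : inner ℂ x (S x) = ((‖W x‖ ^ 2 + k * ‖inner ℂ ε x‖ ^ 2 : ℝ) : ℂ) := by
      rw [hSapp, inner_add_right, ContinuousLinearMap.adjoint_inner_right, inner_smul_right,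
        ← inner_conj_symm x ε, mul_assoc, Complex.mul_conj', inner_self_eq_ofReal]
      push_cast; rfl
    rw [h1, Complex.ofReal_re]
    positivity
  obtain ⟨N, hN2, hN3, -⟩ := exists_inverse_one_add hSre
  have hN1 : ∀ x y, x = N y ↔ x + S x = y := by
    intro x y
    constructor
    · rintro rfl
      exact congrArg (fun A : E →L[ℂ] E => A y) hN2
    · rintro rfl
      exact (congrArg (fun A : E →L[ℂ] E => A x) hN3).symm
  have hSc : IsCompactOperator S := by
    have h1 : IsCompactOperator (innerSL ℂ ε) :=
      isCompactOperator_of_locallyCompactSpace_dom (innerSL ℂ ε)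
    exact (hW.clm_comp W.adjoint).add
      ((h1.clm_comp (ContinuousLinearMap.toSpanSingleton ℂ ε)).smul (k : ℂ))
  set e := WithLp.prodContinuousLinearEquiv 2 ℂ E E with he
  set a : E × E →L[ℂ] E := N.comp (S.comp (ContinuousLinearMap.fst ℂ E E) +
    W.adjoint.comp (ContinuousLinearMap.snd ℂ E E)) with ha
  set c : E × E →L[ℂ] E := W.comp (a - ContinuousLinearMap.fst ℂ E E) with hc
  have hac : IsCompactOperator a :=
    ((hSc.comp_clm (ContinuousLinearMap.fst ℂ E E)).add
      (hW'.comp_clm (ContinuousLinearMap.snd ℂ E E))).clm_comp N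
  have hcc : IsCompactOperator c := hW.comp_clm (a - ContinuousLinearMap.fst ℂ E E)
  have hprod : IsCompactOperator (a.prod c) := by
    have h1 := (hac.clm_comp (ContinuousLinearMap.inl ℂ E E)).add
      (hcc.clm_comp (ContinuousLinearMap.inr ℂ E E))
    have h2 : a.prod c = (ContinuousLinearMap.inl ℂ E E).comp a +
        (ContinuousLinearMap.inr ℂ E E).comp c := by
      refine ContinuousLinearMap.ext fun x => Prod.ext ?_ ?_ <;> simp
    rw [h2]
    exact h1
  refine ⟨(e.symm : E × E →L[ℂ] WithLp 2 (E × E)).comp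
      ((a.prod c).comp (e : WithLp 2 (E × E) →L[ℂ] E × E)),
    (hprod.comp_clm (e : WithLp 2 (E × E) →L[ℂ] E × E)).clm_comp
      (e.symm : E × E →L[ℂ] WithLp 2 (E × E)), fun x y => ?_⟩
  have h1 : resolventGraph ((e.symm : E × E →L[ℂ] WithLp 2 (E × E)).comp
      ((a.prod c).comp (e : WithLp 2 (E × E) →L[ℂ] E × E))) x y ↔
      a (e (x - y)) = x.fst ∧ c (e (x - y)) = x.snd := by
    unfold resolventGraph
    rw [← e.injective.eq_iff]
    simp only [ContinuousLinearMap.comp_apply, ContinuousLinearEquiv.coe_coe,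
      ContinuousLinearEquiv.apply_symm_apply, ContinuousLinearMap.prod_apply, Prod.ext_iff]
    rfl
  have h2 : a (e (x - y)) = x.fst ↔
      x.fst + S x.fst = S (x.fst - y.fst) + W.adjoint (x.snd - y.snd) := by
    rw [eq_comm, ← hN1]; rfl
  have h3 : a (e (x - y)) = x.fst → c (e (x - y)) = W y.fst := by
    intro h
    have : c (e (x - y)) = W (a (e (x - y)) - (x.fst - y.fst)) := rfl
    rw [this, h, sub_sub_cancel]
  rw [h1]
  constructor
  · rintro ⟨h4, h5⟩
    have h6 : a (e (x - y)) = x.fst := by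
      rw [h2, map_sub, map_sub, h4, hSapp y.fst, ← sub_eq_zero, ← h5]; abel
    exact ⟨h6, (h3 h6).trans h4.symm⟩
  · rintro ⟨h4, h5⟩
    have h6 : x.snd = W y.fst := h5.symm.trans (h3 h4)
    refine ⟨h6, ?_⟩
    rw [h2, map_sub, map_sub, h6, hSapp y.fst, ← sub_eq_zero] at h4
    rw [← h4]; abel

/-- Well-posedness and strong stability of the abstract damped system. Stability holds if no
undamped oscillation is invisible to the sensor `⟪ε, ·⟫`. -/
theorem abstractBeam_stable {W : E →L[ℂ] E} (hW : IsCompactOperator W)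
    (hW' : IsCompactOperator W.adjoint) (hinj : ∀ x, W x = 0 → x = 0)
    (hinj' : ∀ x, W.adjoint x = 0 → x = 0) {k : ℝ} (hk : 0 < k) {ε : E}
    (hsilent : ∀ (ω : ℝ) (a : E), ω ≠ 0 → a = ((ω ^ 2 : ℝ) : ℂ) • W.adjoint (W a) →
      inner ℂ ε a = 0 → a = 0) :
    (∃ T : C0Semigroup (WithLp 2 (E × E)), T.IsGeneratedBy (abstractBeamGraph W k ε)) ∧
    ∀ T : C0Semigroup (WithLp 2 (E × E)), T.IsGeneratedBy (abstractBeamGraph W k ε) →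
      ∀ x, Tendsto (fun t => T.S t x) atTop (𝓝 0) := by
  obtain ⟨R, hRc, hRg⟩ := exists_resolvent_abstractBeam hW hW' hk.le ε
  have hgraph : abstractBeamGraph W k ε = resolventGraph R := by
    ext x y; exact hRg x y
  have hR : ∀ y, ‖R y‖ ^ 2 ≤ (inner ℂ y (R y)).re := by
    intro y
    have h1 : abstractBeamGraph W k ε (R y) (R y - y) := (hRg _ _).2 (by simp [resolventGraph])
    have h2 := h1.re_inner
    rw [inner_sub_left, inner_self_eq_ofReal, Complex.sub_re, Complex.ofReal_re] at h2
    have h3 : 0 ≤ k * ‖inner ℂ ε (R y - y).fst‖ ^ 2 := by positivity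
    linarith
  have hRinj : ∀ y, R y = 0 → y = 0 := by
    intro y hy
    have h1 : abstractBeamGraph W k ε 0 (-y) := (hRg _ _).2 (by simpa [resolventGraph] using hy)
    have h2 : (-y).fst = 0 := hinj _ h1.1.symm
    have h3 := h1.2
    rw [h2, inner_zero_right, mul_zero, zero_smul] at h3
    have h4 : (-y).snd = 0 := hinj' _ (by simpa using h3)
    rw [← neg_eq_zero]
    exact (WithLp.equiv 2 (E × E)).injective (Prod.ext h2 h4)
  rw [hgraph]
  refine ⟨exists_isGeneratedBy_resolventGraph hR hRinj, fun T hT x =>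
    T.tendsto_zero hT hR hRc hRinj (fun ω x hx => ?_) x⟩
  have h1 : abstractBeamGraph W k ε x ((ω * Complex.I) • x) := (hRg _ _).2 hx
  have e1 : x.snd = (ω * Complex.I) • W x.fst := by
    have := h1.1
    rwa [WithLp.smul_fst, map_smul] at this
  have hdamp : k * ‖inner ℂ ε ((ω * Complex.I) • x).fst‖ ^ 2 = 0 := by
    have h2 := h1.re_inner
    rw [inner_smul_left, inner_self_eq_ofReal, Complex.re_mul_ofReal] at h2
    simp only [map_mul, Complex.conj_ofReal, Complex.conj_I, mul_neg, Complex.neg_re,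
      Complex.re_ofReal_mul, Complex.I_re, mul_zero, neg_zero, zero_mul] at h2
    linarith
  have hdamp' : inner ℂ ε ((ω * Complex.I) • x).fst = 0 := by
    rcases mul_eq_zero.1 hdamp with h | h
    · exact absurd h hk.ne'
    · exact norm_eq_zero.1 (pow_eq_zero_iff two_ne_zero |>.1 h)
  have h2 := h1.2
  rw [hdamp', mul_zero, zero_smul, add_zero, WithLp.smul_snd, map_smul, e1, map_smul, smul_smul]
    at h2
  have e2 : (ω * Complex.I) * (ω * Complex.I) = -((ω ^ 2 : ℝ) : ℂ) := by
    push_cast; linear_combination (ω : ℂ) ^ 2 * Complex.I_sq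
  rw [e2, neg_smul, neg_add_eq_zero] at h2
  have hfst : x.fst = 0 := by
    by_cases hω : ω = 0
    · rw [← h2, hω]; simp
    · refine hsilent ω _ hω h2.symm ?_
      rw [WithLp.smul_fst, inner_smul_right] at hdamp'
      refine (mul_eq_zero.1 hdamp').resolve_left ?_
      exact mul_ne_zero (by exact_mod_cast hω) Complex.I_ne_zero
  exact (WithLp.equiv 2 (E × E)).injective (Prod.ext hfst (by
    show x.snd = 0
    rw [e1, hfst, map_zero, smul_zero]))

end AbstractBeam

/-! ### The Volterra operator -/

namespace L2I

variable {L : ℝ}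

theorem integrableOn (f : L2I L) : IntegrableOn (f : ℝ → ℂ) (Ioc 0 L) :=
  (Lp.memLp f).integrable (by norm_num)

theorem intervalIntegrable_of_subset (f : L2I L) {a b : ℝ} (ha : 0 ≤ a) (hab : a ≤ b) (hb : b ≤ L) :
    IntervalIntegrable (f : ℝ → ℂ) volume a b := by
  rw [intervalIntegrable_iff_integrableOn_Ioc_of_le hab]
  exact f.integrableOn.mono_set (Ioc_subset_Ioc ha hb)

/-- The indicator function of `(a, b]` in `L²(0, L)`. -/
noncomputable def window (L a b : ℝ) : L2I L :=
  indicatorConstLp 2 (measurableSet_Ioc (a := a) (b := b)) (measure_ne_top _ _) 1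

theorem inner_window (f : L2I L) {a b : ℝ} (ha : 0 ≤ a) (hab : a ≤ b) (hb : b ≤ L) :
    inner ℂ (window L a b) f = ∫ s in a..b, f s := by
  rw [window, L2.inner_indicatorConstLp_one, Measure.restrict_restrict measurableSet_Ioc,
    inter_eq_left.2 (Ioc_subset_Ioc ha hb), intervalIntegral.integral_of_le hab]

theorem norm_window_le {a b : ℝ} (hab : a ≤ b) : ‖window L a b‖ ≤ √(b - a) := by
  refine (norm_indicatorConstLp_le).trans ?_
  rw [norm_one, one_mul, Real.sqrt_eq_rpow]
  rw [ENNReal.toReal_ofNat]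
  refine Real.rpow_le_rpow measureReal_nonneg ?_ (by norm_num)
  calc (volume.restrict (Ioc 0 L)).real (Ioc a b) ≤ volume.real (Ioc a b) := by
        rw [measureReal_def, measureReal_def]
        exact ENNReal.toReal_mono (by simp) (Measure.restrict_le_self _)
    _ = b - a := by rw [Real.volume_real_Ioc_of_le hab]

theorem norm_integral_le (f : L2I L) {a b : ℝ} (ha : 0 ≤ a) (hab : a ≤ b) (hb : b ≤ L) :
    ‖∫ s in a..b, f s‖ ≤ √(b - a) * ‖f‖ := by
  rw [← f.inner_window ha hab hb]
  exact (norm_inner_le_norm _ _).trans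
    (mul_le_mul_of_nonneg_right (norm_window_le hab) (norm_nonneg _))

theorem continuousOn_primitive (f : L2I L) :
    ContinuousOn (fun x => ∫ s in (0 : ℝ)..x, f s) (Icc 0 L) := by
  rcases le_or_gt 0 L with hL | hL
  · have h := intervalIntegral.continuousOn_primitive_interval (μ := volume) (f := f) (a := 0)
      (b := L) (by rw [uIcc_of_le hL, integrableOn_Icc_iff_integrableOn_Ioc]; exact f.integrableOn)
    rwa [uIcc_of_le hL] at h
  · rw [Icc_eq_empty hL.not_ge]; exact continuousOn_empty _

theorem memLp_of_continuousOn {φ : ℝ → ℂ} (h : ContinuousOn φ (Icc 0 L)) :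
    MemLp φ 2 (volume.restrict (Ioc 0 L)) := by
  obtain ⟨C, hC⟩ := isCompact_Icc.exists_bound_of_continuousOn h
  refine MemLp.of_bound ((h.mono Ioc_subset_Icc_self).aestronglyMeasurable measurableSet_Ioc) C ?_
  filter_upwards [ae_restrict_mem measurableSet_Ioc] with x hx
  exact hC x (Ioc_subset_Icc_self hx)

theorem norm_le_of_forall_Ioc {f : L2I L} {C : ℝ} (hC : 0 ≤ C)
    (h : ∀ᵐ x ∂(volume.restrict (Ioc 0 L)), x ∈ Ioc 0 L → ‖f x‖ ≤ C) :
    ‖f‖ ≤ measureUnivNNReal (volume.restrict (Ioc 0 L)) ^ (2 : ENNReal).toReal⁻¹ * C := by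
  refine Lp.norm_le_of_ae_bound hC ?_
  filter_upwards [h, ae_restrict_mem measurableSet_Ioc] with x hx hx'
  exact hx hx'

/-- The Volterra operator `(V f)(x) = ∫₀ˣ f` on `L²(0, L)`. -/
noncomputable def volterra (L : ℝ) : L2I L →L[ℂ] L2I L :=
  LinearMap.mkContinuous
    { toFun := fun f => (memLp_of_continuousOn f.continuousOn_primitive).toLp _
      map_add' := fun f g => by
        rw [← MemLp.toLp_add]
        refine MemLp.toLp_congr _ _ ?_
        filter_upwards [ae_restrict_mem measurableSet_Ioc] with x hx
        rw [L2I.primitive_congr (Lp.coeFn_add f g) hx, Pi.add_apply]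
        exact intervalIntegral.integral_add (f.intervalIntegrable hx) (g.intervalIntegrable hx)
      map_smul' := fun c f => by
        rw [RingHom.id_apply, ← MemLp.toLp_const_smul]
        refine MemLp.toLp_congr _ _ ?_
        filter_upwards [ae_restrict_mem measurableSet_Ioc] with x hx
        rw [L2I.primitive_congr (Lp.coeFn_smul c f) hx, Pi.smul_apply]
        exact intervalIntegral.integral_smul c _ }
    (measureUnivNNReal (volume.restrict (Ioc 0 L)) ^ (2 : ENNReal).toReal⁻¹ * √L)
    fun f => by
      rw [mul_assoc]
      refine norm_le_of_forall_Ioc (by positivity) ?_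
      filter_upwards [MemLp.coeFn_toLp (memLp_of_continuousOn f.continuousOn_primitive)]
        with x hx hx'
      simp only [LinearMap.coe_mk, AddHom.coe_mk]
      rw [hx]
      refine (f.norm_integral_le le_rfl hx'.1.le hx'.2).trans
        (mul_le_mul_of_nonneg_right (Real.sqrt_le_sqrt ?_) (norm_nonneg _))
      linarith [hx'.2]

theorem volterra_ae (f : L2I L) :
    ∀ᵐ x ∂(volume.restrict (Ioc 0 L)), volterra L f x = ∫ s in (0 : ℝ)..x, f s :=
  MemLp.coeFn_toLp (memLp_of_continuousOn f.continuousOn_primitive)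

theorem _root_.isPrimitive_iff {f g : L2I L} : IsPrimitive f g ↔ f = volterra L g := by
  constructor
  · intro h
    refine Lp.ext ?_
    filter_upwards [h, g.volterra_ae] with x h1 h2
    rw [h1, h2]
  · rintro rfl
    exact g.volterra_ae

theorem eqOn_Icc_of_ae (hL : 0 < L) {φ ψ : ℝ → ℂ}
    (h : ∀ᵐ x ∂(volume.restrict (Ioc 0 L)), φ x = ψ x) (hφ : ContinuousOn φ (Icc 0 L))
    (hψ : ContinuousOn ψ (Icc 0 L)) : EqOn φ ψ (Icc 0 L) :=
  Measure.eqOn_Icc_of_ae_eq volume hL.ne (by rwa [← Measure.restrict_congr_set Ioc_ae_eq_Icc]) hφ hψ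

theorem eq_zero_of_primitive_eq_zero (hL : 0 < L) {f : L2I L}
    (h : ∀ x ∈ Icc 0 L, ∫ s in (0 : ℝ)..x, f s = 0) : f = 0 := by
  refine Lp.ext ?_
  have h1 := (f.intervalIntegrable_of_subset le_rfl hL.le le_rfl).ae_hasDerivAt_integral
  filter_upwards [ae_restrict_of_ae h1, ae_restrict_mem measurableSet_Ioc,
    Lp.coeFn_zero ℂ 2 (volume.restrict (Ioc 0 L)), ae_restrict_of_ae (Measure.ae_ne volume L)]
    with x hx hxm h0 hxL
  have hx' : x ∈ Ioo 0 L := ⟨hxm.1, lt_of_le_of_ne hxm.2 hxL⟩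
  rw [uIcc_of_le hL.le] at hx
  have h2 := hx (Ioc_subset_Icc_self hxm) 0 ⟨le_rfl, hL.le⟩
  have h3 : HasDerivAt (fun x => ∫ s in (0 : ℝ)..x, f s) 0 x :=
    (hasDerivAt_const x (0 : ℂ)).congr_of_eventuallyEq
      (eventually_of_mem (Icc_mem_nhds hx'.1 hx'.2) h)
  rw [h0, h2.unique h3]; rfl

theorem volterra_injective (hL : 0 < L) {f : L2I L} (h : volterra L f = 0) : f = 0 := by
  refine eq_zero_of_primitive_eq_zero hL
    (eqOn_Icc_of_ae hL ?_ f.continuousOn_primitive continuousOn_const)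
  filter_upwards [f.volterra_ae, Lp.coeFn_zero ℂ 2 (volume.restrict (Ioc 0 L))] with x h1 h2
  rw [← h1, h, h2]; rfl

/-- Fubini's theorem for `conj (f s) * g t`, with the square split along its diagonal. -/
theorem integral_inner_volterra (hL : 0 ≤ L) (f g : L2I L) :
    inner ℂ f (volterra L g) + inner ℂ (volterra L f) g =
      conj (∫ s in (0 : ℝ)..L, f s) * ∫ s in (0 : ℝ)..L, g s := by
  set μ := volume.restrict (Ioc (0 : ℝ) L) with hμ
  set F : ℝ × ℝ → ℂ := fun p => conj (f p.1) * g p.2 with hF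
  have hfi : Integrable (fun x => conj (f x)) μ := by
    have := f.integrableOn
    exact (Complex.conjLIE.integrable_comp_iff).2 this
  have hgi : Integrable g μ := g.integrableOn
  have hFi : Integrable F (μ.prod μ) := hfi.mul_prod hgi
  have hmeas : MeasurableSet {p : ℝ × ℝ | p.2 ≤ p.1} :=
    measurableSet_le measurable_snd measurable_fst
  have htot : ∫ p, F p ∂(μ.prod μ) =
      conj (∫ s in (0 : ℝ)..L, f s) * ∫ s in (0 : ℝ)..L, g s := by
    rw [intervalIntegral.integral_of_le hL, intervalIntegral.integral_of_le hL, ← integral_conj]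
    exact integral_prod_mul (fun x => conj (f x)) g
  have hsplit := integral_add_compl hmeas hFi
  have h1 : ∫ p in {p : ℝ × ℝ | p.2 ≤ p.1}, F p ∂(μ.prod μ) = inner ℂ f (volterra L g) := by
    rw [← integral_indicator hmeas, integral_prod _ (hFi.indicator hmeas), L2.inner_def]
    refine integral_congr_ae ?_
    filter_upwards [g.volterra_ae, ae_restrict_mem measurableSet_Ioc] with x hx hxm
    rw [RCLike.inner_apply', hx, intervalIntegral.integral_of_le hxm.1.le]
    have e1 : (fun y => {p : ℝ × ℝ | p.2 ≤ p.1}.indicator F (x, y)) =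
        (Iic x).indicator fun y => conj (f x) * g y := by
      ext y; simp [indicator, hF]
    rw [e1, integral_indicator measurableSet_Iic, hμ, Measure.restrict_restrict measurableSet_Iic,
      integral_const_mul]
    congr 3
    ext y
    simp only [mem_inter_iff, mem_Iic, mem_Ioc]
    exact ⟨fun h => ⟨h.2.1, h.1⟩, fun h => ⟨h.2, h.1, h.2.trans hxm.2⟩⟩
  have h2 : ∫ p in {p : ℝ × ℝ | p.2 ≤ p.1}ᶜ, F p ∂(μ.prod μ) = inner ℂ (volterra L f) g := by
    rw [← integral_indicator hmeas.compl, integral_prod_symm _ (hFi.indicator hmeas.compl),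
      L2.inner_def]
    refine integral_congr_ae ?_
    filter_upwards [f.volterra_ae, ae_restrict_mem measurableSet_Ioc] with y hy hym
    rw [RCLike.inner_apply', hy, intervalIntegral.integral_of_le hym.1.le]
    have e1 : (fun x => {p : ℝ × ℝ | p.2 ≤ p.1}ᶜ.indicator F (x, y)) =
        (Iio y).indicator fun x => conj (f x) * g y := by
      ext x; simp [indicator, hF]
    rw [e1, integral_indicator measurableSet_Iio, hμ, Measure.restrict_restrict measurableSet_Iio,
      integral_mul_const, integral_conj, integral_Ioc_eq_integral_Ioo]
    congr 4
    ext x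
    simp only [mem_inter_iff, mem_Iio, mem_Ioc, mem_Ioo]
    exact ⟨fun h => ⟨h.2.1, h.1⟩, fun h => ⟨h.2, h.1, h.2.le.trans hym.2⟩⟩
  rw [← h1, ← h2, hsplit, htot]

/-- The sum `V + V*` is the operator `f ↦ ∫₀ᴸ f` of rank one. -/
theorem adjoint_volterra_apply (hL : 0 ≤ L) (f : L2I L) :
    (volterra L).adjoint f = (∫ s in (0 : ℝ)..L, f s) • window L 0 L - volterra L f := by
  refine ext_inner_left ℂ fun g => ?_
  rw [ContinuousLinearMap.adjoint_inner_right, inner_sub_right, inner_smul_right,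
    eq_sub_iff_add_eq', integral_inner_volterra hL, ← inner_conj_symm g,
    inner_window g le_rfl hL le_rfl, mul_comm]

theorem window_ae : ∀ᵐ x ∂(volume.restrict (Ioc 0 L)), window L 0 L x = 1 := by
  filter_upwards [indicatorConstLp_coeFn (p := 2) (hs := measurableSet_Ioc (a := (0 : ℝ)) (b := L))
    (hμs := measure_ne_top (volume.restrict (Ioc 0 L)) _) (c := (1 : ℂ)),
    ae_restrict_mem measurableSet_Ioc] with x hx hxm
  rw [window, hx, indicator_of_mem hxm]

theorem adjoint_volterra_ae (hL : 0 ≤ L) (f : L2I L) :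
    ∀ᵐ x ∂(volume.restrict (Ioc 0 L)), (volterra L).adjoint f x = ∫ s in x..L, f s := by
  rw [adjoint_volterra_apply hL]
  filter_upwards [Lp.coeFn_sub ((∫ s in (0 : ℝ)..L, f s) • window L 0 L) (volterra L f),
    Lp.coeFn_smul (∫ s in (0 : ℝ)..L, f s) (window L 0 L), window_ae (L := L), f.volterra_ae,
    ae_restrict_mem measurableSet_Ioc] with x h1 h2 h3 h4 hx
  rw [h1, Pi.sub_apply, h2, Pi.smul_apply, h3, h4, smul_eq_mul, mul_one,
    ← intervalIntegral.integral_interval_sub_left (f.intervalIntegrable_of_subset le_rfl hL le_rfl)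
      (f.intervalIntegrable hx)]

theorem adjoint_volterra_injective (hL : 0 < L) {f : L2I L} (h : (volterra L).adjoint f = 0) :
    f = 0 := by
  set c := ∫ s in (0 : ℝ)..L, f s with hc
  have h1 : EqOn (fun x => ∫ s in (0 : ℝ)..x, f s) (fun _ => c) (Icc 0 L) := by
    refine eqOn_Icc_of_ae hL ?_ f.continuousOn_primitive continuousOn_const
    filter_upwards [adjoint_volterra_ae hL.le f, Lp.coeFn_zero ℂ 2 (volume.restrict (Ioc 0 L)),
      ae_restrict_mem measurableSet_Ioc] with x h2 h3 hx
    rw [h, h3] at h2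
    have h4 := intervalIntegral.integral_interval_sub_left
      (f.intervalIntegrable_of_subset le_rfl hL.le le_rfl) (f.intervalIntegrable hx)
    rw [← h2, Pi.zero_apply] at h4
    exact (sub_eq_zero.1 h4).symm
  have h2 := h1 ⟨le_rfl, hL.le⟩
  simp only [intervalIntegral.integral_same] at h2
  refine eq_zero_of_primitive_eq_zero hL fun x hx => ?_
  rw [h2]; exact h1 hx

/-- The index of the mesh cell of width `L / (n + 1)` containing `x`. -/
noncomputable def cell (L : ℝ) (n : ℕ) (x : ℝ) : Fin (n + 2) :=
  ⟨min ⌊x * (n + 1) / L⌋₊ (n + 1), by omega⟩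

theorem measurable_cell (n : ℕ) : Measurable (cell L n) := by
  have h1 : Measurable fun x : ℝ => ⌊x * (n + 1) / L⌋₊ :=
    Nat.measurable_floor.comp (by fun_prop)
  exact (measurable_from_top (f := fun k : ℕ => (⟨min k (n + 1), by omega⟩ : Fin (n + 2)))).comp h1

theorem cell_spec (hL : 0 < L) (n : ℕ) {x : ℝ} (hx : x ∈ Ioc 0 L) :
    0 ≤ (cell L n x : ℕ) * (L / (n + 1)) ∧ (cell L n x : ℕ) * (L / (n + 1)) ≤ x ∧
      x - (cell L n x : ℕ) * (L / (n + 1)) ≤ L / (n + 1) := by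
  have hn : (0 : ℝ) < n + 1 := by positivity
  have h0 : 0 ≤ x * (n + 1) / L := by have := hx.1; positivity
  have hle : ⌊x * (n + 1) / L⌋₊ ≤ n + 1 := by
    refine Nat.floor_le_of_le ?_
    rw [div_le_iff₀ hL]
    push_cast
    nlinarith [hx.2]
  have hc : ((cell L n x : ℕ) : ℝ) = (⌊x * (n + 1) / L⌋₊ : ℝ) := by
    simp only [cell, min_eq_left hle]
  rw [hc]
  have h1 := Nat.floor_le h0
  have h2 := (Nat.lt_floor_add_one (x * (n + 1) / L)).le
  rw [le_div_iff₀ hL] at h1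
  rw [div_le_iff₀ hL] at h2
  refine ⟨by positivity, ?_, ?_⟩
  · rw [← mul_div_assoc, div_le_iff₀ hn]; exact h1
  · rw [sub_le_iff_le_add, ← mul_div_assoc, ← add_div, le_div_iff₀ hn]; linarith

theorem memLp_comp_cell (n : ℕ) (c : Fin (n + 2) → ℂ) :
    MemLp (fun x => c (cell L n x)) 2 (volume.restrict (Ioc 0 L)) :=
  MemLp.of_bound ((measurable_of_finite c).comp (measurable_cell n)).aestronglyMeasurable ‖c‖
    (Eventually.of_forall fun _ => norm_le_pi_norm c _)

/-- Functions that are constant on the cells of a mesh. -/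
noncomputable def stepMap (L : ℝ) (n : ℕ) : (Fin (n + 2) → ℂ) →ₗ[ℂ] L2I L where
  toFun c := (memLp_comp_cell n c).toLp _
  map_add' c d := by rw [← MemLp.toLp_add]; rfl
  map_smul' a c := by rw [RingHom.id_apply, ← MemLp.toLp_const_smul]; rfl

/-- The values of `∫₀ˣ f` at the points of a mesh. -/
noncomputable def sampleMap (L : ℝ) (n : ℕ) : L2I L →L[ℂ] (Fin (n + 2) → ℂ) :=
  ContinuousLinearMap.pi fun i => innerSL ℂ (window L 0 ((i : ℕ) * (L / (n + 1))))

/-- The Volterra operator is compact: it is the limit of the finite-rank operators which replace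
`∫₀ˣ f` by its values at the points of a mesh. -/
theorem isCompactOperator_volterra (hL : 0 < L) : IsCompactOperator (volterra L) := by
  set B : ∀ n, (Fin (n + 2) → ℂ) →L[ℂ] L2I L := fun n =>
    LinearMap.toContinuousLinearMap (stepMap L n)
  set C : ℝ := measureUnivNNReal (volume.restrict (Ioc 0 L)) ^ (2 : ENNReal).toReal⁻¹ with hC
  have hbound : ∀ n : ℕ, ‖(B n).comp (sampleMap L n) - volterra L‖ ≤ C * √(L / (n + 1)) := by
    intro n
    refine ContinuousLinearMap.opNorm_le_bound _ (by positivity) fun f => ?_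
    rw [mul_assoc]
    refine norm_le_of_forall_Ioc (by positivity) ?_
    have h0 : ∀ᵐ x ∂(volume.restrict (Ioc 0 L)), B n (sampleMap L n f) x =
        sampleMap L n f (cell L n x) := MemLp.coeFn_toLp (memLp_comp_cell n _)
    filter_upwards [h0, f.volterra_ae, Lp.coeFn_sub (B n (sampleMap L n f)) (volterra L f)]
      with x h1 h2 h3 hx
    obtain ⟨c0, c1, c2⟩ := cell_spec hL n hx
    have e1 : ((B n).comp (sampleMap L n) - volterra L) f =
        B n (sampleMap L n f) - volterra L f := rfl
    have e2 : sampleMap L n f (cell L n x) =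
        ∫ s in (0 : ℝ)..((cell L n x : ℕ) * (L / (n + 1))), f s :=
      f.inner_window le_rfl c0 (c1.trans hx.2)
    rw [e1, h3, Pi.sub_apply, h1, h2, e2, norm_sub_rev,
      intervalIntegral.integral_interval_sub_left (f.intervalIntegrable hx)
        (f.intervalIntegrable_of_subset le_rfl c0 (c1.trans hx.2))]
    exact (f.norm_integral_le c0 c1 hx.2).trans
      (mul_le_mul_of_nonneg_right (Real.sqrt_le_sqrt c2) (norm_nonneg _))
  have hlim : Tendsto (fun n : ℕ => C * √(L / ((n : ℝ) + 1))) atTop (𝓝 0) := by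
    have h1 := (tendsto_one_div_add_atTop_nhds_zero_nat (𝕜 := ℝ)).const_mul L
    have h2 := (h1.sqrt).const_mul C
    simpa only [mul_one_div, mul_zero, Real.sqrt_zero] using h2
  refine isCompactOperator_of_tendsto (tendsto_iff_norm_sub_tendsto_zero.2
    (squeeze_zero (fun n => norm_nonneg _) hbound hlim)) (Eventually.of_forall fun n => ?_)
  exact (isCompactOperator_of_locallyCompactSpace_dom (sampleMap L n)).clm_comp (B n)

theorem isCompactOperator_adjoint_volterra (hL : 0 < L) :
    IsCompactOperator (volterra L).adjoint := by
  have h1 : (volterra L).adjoint =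
      (innerSL ℂ (window L 0 L)).smulRight (window L 0 L) - volterra L := by
    ext1 f
    rw [adjoint_volterra_apply hL.le, ← f.inner_window le_rfl hL.le le_rfl]
    rfl
  have h2 : IsCompactOperator (innerSL ℂ (window L 0 L)) :=
    isCompactOperator_of_locallyCompactSpace_dom (innerSL ℂ (window L 0 L))
  rw [h1]
  exact (h2.clm_comp (ContinuousLinearMap.toSpanSingleton ℂ (window L 0 L))).sub
    (isCompactOperator_volterra hL)

end L2I

/-! ### The shear operators of the beam -/

theorem hasDerivWithinAt_integral_left {φ : ℝ → ℂ} {L x : ℝ} (hφ : ContinuousOn φ (Icc 0 L))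
    (hx : x ∈ Icc 0 L) :
    HasDerivWithinAt (fun x => ∫ s in (0 : ℝ)..x, φ s) (φ x) (Icc 0 L) x := by
  have : Fact (x ∈ Icc 0 L) := ⟨hx⟩
  refine intervalIntegral.integral_hasDerivWithinAt_right ?_ ?_ (hφ x hx)
  · refine (hφ.mono ?_).intervalIntegrable
    rw [uIcc_of_le hx.1]
    exact Icc_subset_Icc_right hx.2
  · exact hφ.stronglyMeasurableAtFilter_nhdsWithin measurableSet_Icc x

theorem hasDerivWithinAt_integral_right {φ : ℝ → ℂ} {L x : ℝ} (hφ : ContinuousOn φ (Icc 0 L))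
    (hx : x ∈ Icc 0 L) :
    HasDerivWithinAt (fun x => ∫ s in x..L, φ s) (-φ x) (Icc 0 L) x := by
  have : Fact (x ∈ Icc 0 L) := ⟨hx⟩
  refine intervalIntegral.integral_hasDerivWithinAt_left ?_ ?_ (hφ x hx)
  · refine (hφ.mono ?_).intervalIntegrable
    rw [uIcc_of_le hx.2]
    exact Icc_subset_Icc_left hx.1
  · exact hφ.stronglyMeasurableAtFilter_nhdsWithin measurableSet_Icc x

theorem continuousOn_of_hasDerivWithinAt {f f' : ℝ → ℂ} {s : Set ℝ}
    (h : ∀ x ∈ s, HasDerivWithinAt f (f' x) s x) : ContinuousOn f s :=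
  fun x hx => (h x hx).continuousWithinAt

theorem integral_eq_sub_of_hasDerivWithinAt_Icc {f f' : ℝ → ℂ} {L a c : ℝ} (ha : 0 ≤ a)
    (hac : a ≤ c) (hc : c ≤ L) (h : ∀ x ∈ Icc 0 L, HasDerivWithinAt f (f' x) (Icc 0 L) x)
    (h' : ContinuousOn f' (Icc 0 L)) : ∫ s in a..c, f' s = f c - f a := by
  have hsub : Icc a c ⊆ Icc 0 L := Icc_subset_Icc ha hc
  refine intervalIntegral.integral_eq_sub_of_hasDerivAt_of_le hac
    ((continuousOn_of_hasDerivWithinAt h).mono hsub) (fun x hx => ?_) ?_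
  · exact (h x (hsub (Ioo_subset_Icc_self hx))).hasDerivAt
      (Icc_mem_nhds (ha.trans_lt hx.1) (hx.2.trans_le hc))
  · refine (h'.mono ?_).intervalIntegrable
    rwa [uIcc_of_le hac]

theorem L2I.integral_congr_ae {L : ℝ} {f g : ℝ → ℂ}
    (h : f =ᵐ[volume.restrict (Ioc (0 : ℝ) L)] g) {a c : ℝ} (ha : 0 ≤ a) (hac : a ≤ c)
    (hc : c ≤ L) : ∫ s in a..c, f s = ∫ s in a..c, g s := by
  rw [intervalIntegral.integral_of_le hac, intervalIntegral.integral_of_le hac]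
  exact MeasureTheory.integral_congr_ae
    (ae_restrict_of_ae_restrict_of_subset (Ioc_subset_Ioc ha hc) h)

namespace SmartBeam

variable (b : SmartBeam)

theorem zero_lt_At : 0 < b.At := b.At_pos

theorem zero_lt_Bt : 0 < b.Bt := b.Bt_pos

theorem zero_lt_Ct : 0 < b.Ct := by
  have := b.C_pos; have := b.γ_pos; have := b.h₂_pos; have := b.h₃_pos; have := b.B₂_pos
  have := b.B₄_pos
  unfold Ct; positivity

/-- The square `ς C̃` of the decay rate of the kernel of `P`. -/
noncomputable def rsq : ℝ := b.ς * b.Ct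

theorem zero_lt_rsq : 0 < b.rsq := mul_pos b.ς_pos b.zero_lt_Ct

theorem zero_lt_coupling : 0 < b.coupling := by
  have := b.γ_pos; have := b.h₂_pos; have := b.h₃_pos; have := b.β_pos
  have := b.ς_pos; have := b.zero_lt_Bt
  unfold coupling; positivity

/-- The coefficient `ς h₂ h₃ B̃ B₂` of the shear term in the tip output. -/
noncomputable def shearGain : ℝ := b.ς * b.h₂ * b.h₃ * b.Bt * b.B₂

theorem zero_lt_shearGain : 0 < b.shearGain := by
  have := b.h₂_pos; have := b.h₃_pos; have := b.B₂_pos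
  have := b.ς_pos; have := b.zero_lt_Bt
  unfold shearGain; positivity

/-- Green's formula: if `u(0) = 0`, `u'(L) = 0` and `ς C̃ u - u'' = z`, then `P z = u`. -/
theorem P_eq_of_hasDerivWithinAt {z u v : ℝ → ℂ} (hz : ContinuousOn z (Icc 0 b.L))
    (hu : ∀ x ∈ Icc 0 b.L, HasDerivWithinAt u (v x) (Icc 0 b.L) x)
    (hv : ∀ x ∈ Icc 0 b.L, HasDerivWithinAt v (b.rsq * u x - z x) (Icc 0 b.L) x)
    (hu0 : u 0 = 0) (hvL : v b.L = 0) {x : ℝ} (hx : x ∈ Icc 0 b.L) : b.P z x = u x := by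
  set r : ℝ := √(b.Ct * b.ς) with hr
  have hr2 : b.rsq = r * r := by
    rw [hr, Real.mul_self_sqrt (mul_pos b.zero_lt_Ct b.ς_pos).le, rsq, mul_comm]
  have hrpos : 0 < r := Real.sqrt_pos.2 (mul_pos b.zero_lt_Ct b.ς_pos)
  have hucont := continuousOn_of_hasDerivWithinAt hu
  have hsinh : ∀ s, HasDerivWithinAt (fun s : ℝ => ((Real.sinh (r * s) : ℝ) : ℂ))
      ((Real.cosh (r * s) * r : ℝ) : ℂ) (Icc 0 b.L) s := fun s =>
    ((((hasDerivAt_id s).const_mul r).sinh.congr_deriv (by simp)).ofReal_comp).hasDerivWithinAt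
  have hcosh : ∀ s, HasDerivWithinAt (fun s : ℝ => ((Real.cosh (r * s) : ℝ) : ℂ))
      ((Real.sinh (r * s) * r : ℝ) : ℂ) (Icc 0 b.L) s := fun s =>
    ((((hasDerivAt_id s).const_mul r).cosh.congr_deriv (by simp)).ofReal_comp).hasDerivWithinAt
  have hsinh' : ∀ s, HasDerivWithinAt (fun s : ℝ => ((Real.sinh (r * (s - b.L)) : ℝ) : ℂ))
      ((Real.cosh (r * (s - b.L)) * r : ℝ) : ℂ) (Icc 0 b.L) s := fun s =>
    (((((hasDerivAt_id s).sub_const b.L).const_mul r).sinh.congr_deriv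
      (by simp)).ofReal_comp).hasDerivWithinAt
  have hcosh' : ∀ s, HasDerivWithinAt (fun s : ℝ => ((Real.cosh (r * (s - b.L)) : ℝ) : ℂ))
      ((Real.sinh (r * (s - b.L)) * r : ℝ) : ℂ) (Icc 0 b.L) s := fun s =>
    (((((hasDerivAt_id s).sub_const b.L).const_mul r).cosh.congr_deriv
      (by simp)).ofReal_comp).hasDerivWithinAt
  -- The products of `z = ς C̃ u - v'` with the two branches of the kernel have explicit primitives.
  have h1 : ∫ s in (0 : ℝ)..x, (Real.sinh (r * s) : ℂ) * z s =
      -(v x * Real.sinh (r * x)) + r * (u x * Real.cosh (r * x)) := by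
    rw [integral_eq_sub_of_hasDerivWithinAt_Icc le_rfl hx.1 hx.2
      (f := fun s => -(v s * (Real.sinh (r * s) : ℝ)) + r * (u s * (Real.cosh (r * s) : ℝ)))]
    · simp [hu0]
    · intro s hs
      refine ((((hv s hs).mul (hsinh s)).neg).add
        (((hu s hs).mul (hcosh s)).const_mul (r : ℂ))).congr_deriv ?_
      rw [hr2]; push_cast; ring
    · exact (by fun_prop : Continuous
        fun s : ℝ => ((Real.sinh (r * s) : ℝ) : ℂ)).continuousOn.mul hz
  have h2 : ∫ s in x..b.L, (Real.cosh (r * (s - b.L)) : ℂ) * z s =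
      v x * Real.cosh (r * (x - b.L)) - r * (u x * Real.sinh (r * (x - b.L))) := by
    rw [integral_eq_sub_of_hasDerivWithinAt_Icc hx.1 hx.2 le_rfl
      (f := fun s => -(v s * (Real.cosh (r * (s - b.L)) : ℝ)) +
        r * (u s * (Real.sinh (r * (s - b.L)) : ℝ)))]
    · simp [hvL]; ring
    · intro s hs
      refine ((((hv s hs).mul (hcosh' s)).neg).add
        (((hu s hs).mul (hsinh' s)).const_mul (r : ℂ))).congr_deriv ?_
      rw [hr2]; push_cast; ring
    · exact (by fun_prop : Continuous
        fun s : ℝ => ((Real.cosh (r * (s - b.L)) : ℝ) : ℂ)).continuousOn.mul hz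
  have hc : Real.cosh (r * b.L) ≠ 0 := (Real.cosh_pos _).ne'
  have g1 : ∫ s in (0 : ℝ)..x, (b.green x s : ℂ) * z s =
      (Real.cosh (r * (x - b.L)) / (r * Real.cosh (r * b.L)) : ℝ) *
        ∫ s in (0 : ℝ)..x, (Real.sinh (r * s) : ℂ) * z s := by
    rw [← intervalIntegral.integral_const_mul]
    refine intervalIntegral.integral_congr fun s hs => ?_
    rw [uIcc_of_le hx.1] at hs
    have : b.green x s = Real.cosh (r * (x - b.L)) * Real.sinh (r * s) /
        (r * Real.cosh (r * b.L)) := by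
      unfold green
      split_ifs with h
      · rw [le_antisymm h hs.2]
      · rfl
    simp only [this]
    push_cast; ring
  have g2 : ∫ s in x..b.L, (b.green x s : ℂ) * z s =
      (Real.sinh (r * x) / (r * Real.cosh (r * b.L)) : ℝ) *
        ∫ s in x..b.L, (Real.cosh (r * (s - b.L)) : ℂ) * z s := by
    rw [← intervalIntegral.integral_const_mul]
    refine intervalIntegral.integral_congr fun s hs => ?_
    rw [uIcc_of_le hx.2] at hs
    simp only [green, if_pos hs.1, ← hr]
    push_cast; ring
  have hgc : Continuous fun s => (b.green x s : ℂ) := by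
    refine Complex.continuous_ofReal.comp ?_
    unfold green
    refine Continuous.if_le (by fun_prop) (by fun_prop) continuous_const continuous_id ?_
    intro s hs; rw [hs]
  have hi : ∀ a c, 0 ≤ a → a ≤ c → c ≤ b.L →
      IntervalIntegrable (fun s => (b.green x s : ℂ) * z s) volume a c := by
    intro a c ha hac hc
    refine ((hgc.continuousOn.mul hz).mono ?_).intervalIntegrable
    rw [uIcc_of_le hac]; exact Icc_subset_Icc ha hc
  unfold P
  rw [← intervalIntegral.integral_add_adjacent_intervals (hi 0 x le_rfl hx.1 hx.2)
    (hi x b.L hx.1 hx.2 le_rfl), g1, g2, h1, h2]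
  have key : Real.cosh (r * b.L) = Real.cosh (r * x) * Real.cosh (r * (x - b.L)) -
      Real.sinh (r * x) * Real.sinh (r * (x - b.L)) := by
    rw [← Real.cosh_sub]; ring_nf
  have key' : (Real.cosh (r * b.L) : ℂ) = Real.cosh (r * x) * Real.cosh (r * (x - b.L)) -
      Real.sinh (r * x) * Real.sinh (r * (x - b.L)) := by exact_mod_cast key
  have hc' : (Real.cosh (r * b.L) : ℂ) ≠ 0 := by exact_mod_cast hc
  have hr' : (r : ℂ) ≠ 0 := by exact_mod_cast hrpos.ne'
  simp only [Complex.ofReal_div, Complex.ofReal_mul]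
  field_simp
  rw [key']; ring

end SmartBeam

/-! ### The stiffness form and the tip output -/

namespace SmartBeam

variable (b : SmartBeam)

open L2I

/-- The integrated shear operator `ς C̃ V V*`, where `V` is the Volterra operator. -/
noncomputable def shearCompliance : L2I b.L →L[ℂ] L2I b.L :=
  (b.rsq : ℂ) • ((volterra b.L).comp (volterra b.L).adjoint)

theorem inner_shearCompliance (f g : L2I b.L) : inner ℂ f (b.shearCompliance g) =
    (b.rsq : ℂ) * inner ℂ ((volterra b.L).adjoint f) ((volterra b.L).adjoint g) := by
  rw [shearCompliance, _root_.smul_apply, ContinuousLinearMap.comp_apply, inner_smul_right,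
    ContinuousLinearMap.adjoint_inner_left]

theorem inner_shearCompliance_self_re_nonneg (f : L2I b.L) :
    0 ≤ (inner ℂ f (b.shearCompliance f)).re := by
  rw [inner_shearCompliance, inner_self_eq_ofReal, ← Complex.ofReal_mul, Complex.ofReal_re]
  exact mul_nonneg b.zero_lt_rsq.le (sq_nonneg _)

/-- The operator `(1 + ς C̃ V V*)⁻¹`. On primitives `V g` it agrees with `-J`. -/
noncomputable def shearInverse : L2I b.L →L[ℂ] L2I b.L :=
  (exists_inverse_one_add b.inner_shearCompliance_self_re_nonneg).choose

theorem shearInverse_add (f : L2I b.L) :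
    b.shearInverse f + b.shearCompliance (b.shearInverse f) = f :=
  congrArg (fun A : L2I b.L →L[ℂ] L2I b.L => A f)
    (exists_inverse_one_add b.inner_shearCompliance_self_re_nonneg).choose_spec.1

theorem inner_shearInverse (f g : L2I b.L) :
    inner ℂ f (b.shearInverse g) = inner ℂ (b.shearInverse f) (b.shearInverse g) +
      inner ℂ (b.shearInverse f) (b.shearCompliance (b.shearInverse g)) := by
  conv_lhs => rw [← b.shearInverse_add f]
  rw [inner_add_left, ← inner_conj_symm (b.shearCompliance _), inner_shearCompliance,
    inner_shearCompliance, map_mul, inner_conj_symm, Complex.conj_ofReal]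

theorem inner_shearInverse_left (f g : L2I b.L) :
    inner ℂ (b.shearInverse f) g = inner ℂ f (b.shearInverse g) := by
  rw [← inner_conj_symm, b.inner_shearInverse g f, b.inner_shearInverse f g, inner_shearCompliance,
    inner_shearCompliance, map_add, map_mul, inner_conj_symm, inner_conj_symm, Complex.conj_ofReal]

theorem inner_shearInverse_self_re_nonneg (f : L2I b.L) :
    0 ≤ (inner ℂ f (b.shearInverse f)).re := by
  rw [inner_shearInverse, Complex.add_re, inner_self_eq_ofReal, Complex.ofReal_re]
  have := b.inner_shearCompliance_self_re_nonneg (b.shearInverse f)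
  positivity

/-- The operator `V* (1 + ς C̃ V V*)⁻¹ V`, which takes `w_xx` to `(P w_x)_x`. -/
noncomputable def shearStiffness : L2I b.L →L[ℂ] L2I b.L :=
  (volterra b.L).adjoint.comp (b.shearInverse.comp (volterra b.L))

theorem inner_shearStiffness (f g : L2I b.L) : inner ℂ f (b.shearStiffness g) =
    inner ℂ (volterra b.L f) (b.shearInverse (volterra b.L g)) := by
  rw [shearStiffness, ContinuousLinearMap.comp_apply, ContinuousLinearMap.comp_apply,
    ContinuousLinearMap.adjoint_inner_right]

theorem inner_shearStiffness_left (f g : L2I b.L) :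
    inner ℂ (b.shearStiffness f) g = inner ℂ f (b.shearStiffness g) := by
  rw [← inner_conj_symm, inner_shearStiffness, inner_shearStiffness, inner_conj_symm,
    inner_shearInverse_left]

/-- The continuous function `(P w_x)_x`, for `w_xx = g`. -/
noncomputable def shearRate (g : L2I b.L) (x : ℝ) : ℂ :=
  ∫ s in x..b.L, b.shearInverse (volterra b.L g) s

/-- The continuous function `P w_x`, for `w_xx = g`. -/
noncomputable def shear (g : L2I b.L) (x : ℝ) : ℂ := ∫ s in (0 : ℝ)..x, b.shearRate g s

theorem shearStiffness_ae (g : L2I b.L) :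
    ∀ᵐ x ∂(volume.restrict (Ioc 0 b.L)), b.shearStiffness g x = b.shearRate g x :=
  adjoint_volterra_ae b.L_pos.le _

theorem shear_eq_integral (g : L2I b.L) {x : ℝ} (hx : x ∈ Icc 0 b.L) :
    b.shear g x = ∫ s in (0 : ℝ)..x, b.shearStiffness g s :=
  (L2I.integral_congr_ae (b.shearStiffness_ae g) le_rfl hx.1 hx.2).symm

theorem continuousOn_shear (g : L2I b.L) : ContinuousOn (b.shear g) (Icc 0 b.L) :=
  (b.shearStiffness g).continuousOn_primitive.congr fun _ hx => b.shear_eq_integral g hx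

theorem shearInverse_volterra_ae (g : L2I b.L) : ∀ᵐ x ∂(volume.restrict (Ioc 0 b.L)),
    b.shearInverse (volterra b.L g) x = (∫ s in (0 : ℝ)..x, g s) - b.rsq * b.shear g x := by
  have h1 : b.shearInverse (volterra b.L g) = volterra b.L g -
      (b.rsq : ℂ) • volterra b.L (b.shearStiffness g) :=
    eq_sub_of_add_eq (b.shearInverse_add (volterra b.L g))
  filter_upwards [Lp.coeFn_sub (volterra b.L g) ((b.rsq : ℂ) • volterra b.L (b.shearStiffness g)),
    Lp.coeFn_smul (b.rsq : ℂ) (volterra b.L (b.shearStiffness g)), g.volterra_ae,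
    (b.shearStiffness g).volterra_ae, ae_restrict_mem measurableSet_Ioc] with x h2 h3 h4 h5 hx
  rw [h1, h2, Pi.sub_apply, h3, Pi.smul_apply, h4, h5, smul_eq_mul,
    b.shear_eq_integral g (Ioc_subset_Icc_self hx)]

theorem hasDerivWithinAt_shearRate (g : L2I b.L) {x : ℝ} (hx : x ∈ Icc 0 b.L) :
    HasDerivWithinAt (b.shearRate g) (b.rsq * b.shear g x - ∫ s in (0 : ℝ)..x, g s)
      (Icc 0 b.L) x := by
  have hc : ContinuousOn (fun x => (∫ s in (0 : ℝ)..x, g s) - b.rsq * b.shear g x) (Icc 0 b.L) :=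
    g.continuousOn_primitive.sub (continuousOn_const.mul (b.continuousOn_shear g))
  have heq : ∀ y ∈ Icc 0 b.L, b.shearRate g y =
      ∫ s in y..b.L, ((∫ t in (0 : ℝ)..s, g t) - b.rsq * b.shear g s) := fun y hy =>
    L2I.integral_congr_ae (b.shearInverse_volterra_ae g) hy.1 hy.2 le_rfl
  exact ((hasDerivWithinAt_integral_right hc hx).congr heq (heq x hx)).congr_deriv (by ring)

theorem hasDerivWithinAt_shear (g : L2I b.L) {x : ℝ} (hx : x ∈ Icc 0 b.L) :
    HasDerivWithinAt (b.shear g) (b.shearRate g x) (Icc 0 b.L) x :=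
  hasDerivWithinAt_integral_left
    (continuousOn_of_hasDerivWithinAt fun _ h => b.hasDerivWithinAt_shearRate g h) hx

theorem P_primitive (g : L2I b.L) {x : ℝ} (hx : x ∈ Icc 0 b.L) :
    b.P (fun x => ∫ s in (0 : ℝ)..x, g s) x = b.shear g x :=
  b.P_eq_of_hasDerivWithinAt g.continuousOn_primitive
    (fun _ h => b.hasDerivWithinAt_shear g h) (fun _ h => b.hasDerivWithinAt_shearRate g h)
    (by simp [shear]) (by simp [shearRate]) hx

theorem neg_J_ae (w : H2L b.L) : ∀ᵐ x ∂(volume.restrict (Ioc 0 b.L)),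
    b.shearInverse (volterra b.L (H2L.dxx w)) x = -b.J (H2L.dx w) x := by
  filter_upwards [b.shearInverse_volterra_ae (H2L.dxx w), ae_restrict_mem measurableSet_Ioc]
    with x h hx
  have h1 : b.P (H2L.dx w) x = b.shear (H2L.dxx w) x :=
    b.P_primitive (H2L.dxx w) (Ioc_subset_Icc_self hx)
  rw [h, J, h1, rsq, H2L.dx]; ring

/-- The operator `Ã + γβς h₂h₃ B̃² V* (1 + ς C̃ V V*)⁻¹ V` on `w_xx`, whose quadratic form is the
stiffness form. -/
noncomputable def bendingOp : L2I b.L →L[ℂ] L2I b.L :=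
  (b.At : ℂ) • 1 + (b.coupling : ℂ) • b.shearStiffness

theorem bendingOp_apply (g : L2I b.L) :
    b.bendingOp g = (b.At : ℂ) • g + (b.coupling : ℂ) • b.shearStiffness g := rfl

theorem inner_bendingOp_left (f g : L2I b.L) :
    inner ℂ (b.bendingOp f) g = inner ℂ f (b.bendingOp g) := by
  simp only [bendingOp_apply, inner_add_left, inner_add_right, inner_smul_left, inner_smul_right,
    inner_shearStiffness_left, Complex.conj_ofReal]

theorem re_inner_bendingOp_self (g : L2I b.L) :
    b.At * ‖g‖ ^ 2 ≤ (inner ℂ g (b.bendingOp g)).re := by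
  rw [bendingOp_apply, inner_add_right, inner_smul_right, inner_smul_right, inner_self_eq_ofReal,
    inner_shearStiffness, Complex.add_re, ← Complex.ofReal_mul, Complex.ofReal_re,
    Complex.re_ofReal_mul]
  have := mul_nonneg b.zero_lt_coupling.le
    (b.inner_shearInverse_self_re_nonneg (volterra b.L g))
  linarith

theorem stiffness_eq_inner (w ψ : H2L b.L) :
    b.stiffness w ψ = inner ℂ (H2L.dxx ψ) (b.bendingOp (H2L.dxx w)) := by
  rw [bendingOp_apply, inner_add_right, inner_smul_right, inner_smul_right, inner_shearStiffness,
    L2.inner_def, L2.inner_def, ← MeasureTheory.integral_const_mul,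
    ← MeasureTheory.integral_const_mul, ← MeasureTheory.integral_add
      ((L2.integrable_inner _ _).const_mul _) ((L2.integrable_inner _ _).const_mul _),
    stiffness, intervalIntegral.integral_of_le b.L_pos.le]
  refine MeasureTheory.integral_congr_ae ?_
  filter_upwards [b.neg_J_ae w, (H2L.dxx ψ).volterra_ae] with x h1 h2
  rw [h1, h2, RCLike.inner_apply, RCLike.inner_apply]
  change _ = _ + _ * (-_ * conj (H2L.dx ψ x))
  ring

/-- The vector representing the tip output as a functional of `w_xx`. -/
noncomputable def tipVector : L2I b.L :=
  (b.B₃ : ℂ) • window b.L 0 b.L + (b.shearGain : ℂ) • b.shearStiffness (window b.L 0 b.L)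

theorem inner_tipVector (g : L2I b.L) : inner ℂ b.tipVector g =
    (b.B₃ : ℂ) * (∫ s in (0 : ℝ)..b.L, g s) + b.shearGain * b.shear g b.L := by
  rw [tipVector, inner_add_left, inner_smul_left, inner_smul_left, inner_shearStiffness_left,
    inner_window g le_rfl b.L_pos.le le_rfl, inner_window _ le_rfl b.L_pos.le le_rfl,
    Complex.conj_ofReal, Complex.conj_ofReal, b.shear_eq_integral g ⟨b.L_pos.le, le_rfl⟩]

theorem tipOutput_eq_inner (ψ : H2L b.L) : b.tipOutput ψ = inner ℂ b.tipVector (H2L.dxx ψ) := by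
  rw [inner_tipVector, ← b.P_primitive _ ⟨b.L_pos.le, le_rfl⟩, tipOutput, add_comm]
  rfl

end SmartBeam

/-! ### Modes with vanishing tip output -/

namespace L2I

variable {L : ℝ}

theorem volterra_ae_of_ae {f : L2I L} {φ : ℝ → ℂ}
    (h : ∀ᵐ x ∂(volume.restrict (Ioc 0 L)), f x = φ x) :
    ∀ᵐ x ∂(volume.restrict (Ioc 0 L)), volterra L f x = ∫ s in (0 : ℝ)..x, φ s := by
  filter_upwards [f.volterra_ae, ae_restrict_mem measurableSet_Ioc] with x h1 hx
  rw [h1, L2I.integral_congr_ae h le_rfl hx.1.le hx.2]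

theorem adjoint_volterra_ae_of_ae (hL : 0 ≤ L) {f : L2I L} {φ : ℝ → ℂ}
    (h : ∀ᵐ x ∂(volume.restrict (Ioc 0 L)), f x = φ x) :
    ∀ᵐ x ∂(volume.restrict (Ioc 0 L)), (volterra L).adjoint f x = ∫ s in x..L, φ s := by
  filter_upwards [adjoint_volterra_ae hL f, ae_restrict_mem measurableSet_Ioc] with x h1 hx
  rw [h1, L2I.integral_congr_ae h hx.1.le hx.2 le_rfl]

end L2I

namespace SmartBeam

variable (b : SmartBeam)

open L2I

/-- A vibration mode of the undamped beam with vanishing tip output vanishes. The equation for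
`g = w_xx` shows that `g` has a continuous representative `p` and can be differentiated, so that its
real and imaginary parts solve the equations of `TipSilentMode`. -/
theorem eq_zero_of_mode {N : ℝ} (hN : 0 < N) {g : L2I b.L}
    (hmode : b.bendingOp g = (N : ℂ) • (volterra b.L).adjoint ((volterra b.L).adjoint
      (volterra b.L (volterra b.L g)))) (htip : inner ℂ b.tipVector g = 0) : g = 0 := by
  have hL := b.L_pos.le
  set z : ℝ → ℂ := fun x => ∫ s in (0 : ℝ)..x, g s with hz
  set w : ℝ → ℂ := fun x => ∫ s in (0 : ℝ)..x, z s with hw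
  set q : ℝ → ℂ := fun x => ∫ s in x..b.L, w s with hq
  set q' : ℝ → ℂ := fun x => ∫ s in x..b.L, q s with hq'
  set p : ℝ → ℂ := fun x => (N * q' x - b.coupling * b.shearRate g x) / b.At with hp
  have hAt : (b.At : ℂ) ≠ 0 := by exact_mod_cast b.zero_lt_At.ne'
  have hzc : ContinuousOn z (Icc 0 b.L) := g.continuousOn_primitive
  have dw : ∀ x ∈ Icc 0 b.L, HasDerivWithinAt w (z x) (Icc 0 b.L) x :=
    fun x hx => hasDerivWithinAt_integral_left hzc hx
  have dq : ∀ x ∈ Icc 0 b.L, HasDerivWithinAt q (-w x) (Icc 0 b.L) x :=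
    fun x hx => hasDerivWithinAt_integral_right (continuousOn_of_hasDerivWithinAt dw) hx
  have dq' : ∀ x ∈ Icc 0 b.L, HasDerivWithinAt q' (-q x) (Icc 0 b.L) x :=
    fun x hx => hasDerivWithinAt_integral_right (continuousOn_of_hasDerivWithinAt dq) hx
  have dp : ∀ x ∈ Icc 0 b.L, HasDerivWithinAt p
      ((-(N * q x) - b.coupling * (b.rsq * b.shear g x - z x)) / b.At) (Icc 0 b.L) x :=
    fun x hx => ((((dq' x hx).const_mul (N : ℂ)).sub
      ((b.hasDerivWithinAt_shearRate g hx).const_mul (b.coupling : ℂ))).div_const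
        (b.At : ℂ)).congr_deriv (by ring)
  have hq'ae := adjoint_volterra_ae_of_ae hL (adjoint_volterra_ae_of_ae hL
    (volterra_ae_of_ae g.volterra_ae))
  have hgp : ∀ᵐ x ∂(volume.restrict (Ioc 0 b.L)), g x = p x := by
    have h1 : (b.At : ℂ) • g + (b.coupling : ℂ) • b.shearStiffness g = _ := hmode
    rw [← eq_sub_iff_add_eq] at h1
    set M := (volterra b.L).adjoint ((volterra b.L).adjoint (volterra b.L (volterra b.L g)))
    filter_upwards [Lp.coeFn_smul (b.At : ℂ) g, Lp.coeFn_smul (N : ℂ) M,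
      Lp.coeFn_smul (b.coupling : ℂ) (b.shearStiffness g),
      Lp.coeFn_sub ((N : ℂ) • M) ((b.coupling : ℂ) • b.shearStiffness g),
      b.shearStiffness_ae g, hq'ae] with x h2 h3 h4 h5 h6 h7
    rw [h1, h5, Pi.sub_apply, h3, h4, Pi.smul_apply, Pi.smul_apply, Pi.smul_apply, h6, h7,
      smul_eq_mul, smul_eq_mul, smul_eq_mul] at h2
    rw [hp, eq_div_iff hAt, mul_comm, ← h2]
  have dz : ∀ x ∈ Icc 0 b.L, HasDerivWithinAt z (p x) (Icc 0 b.L) x := fun x hx =>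
    (hasDerivWithinAt_integral_left (continuousOn_of_hasDerivWithinAt dp) hx).congr
      (fun y hy => L2I.integral_congr_ae hgp le_rfl hy.1 hy.2)
      (L2I.integral_congr_ae hgp le_rfl hx.1 hx.2)
  have hB₃ : (b.B₃ : ℂ) ≠ 0 := by exact_mod_cast b.B₃_pos.ne'
  have htip' : z b.L = -((b.shearGain / b.B₃ : ℝ) : ℂ) * b.shear g b.L := by
    rw [inner_tipVector] at htip
    push_cast
    field_simp
    linear_combination htip
  have key : ∀ ℓ : ℂ →L[ℝ] ℝ, ∀ x ∈ Icc 0 b.L, ℓ (z x) = 0 := by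
    intro ℓ x hx
    have hd : ∀ {f : ℝ → ℂ} {f' : ℂ} {x : ℝ}, HasDerivWithinAt f f' (Icc 0 b.L) x →
        HasDerivWithinAt (fun x => ℓ (f x)) (ℓ f') (Icc 0 b.L) x :=
      fun {f f' x} h => ℓ.hasFDerivAt.comp_hasDerivWithinAt x h
    have hr : ∀ (r : ℝ) (c : ℂ), ℓ (r * c) = r * ℓ c := fun r c => by
      rw [← Complex.real_smul, map_smul, smul_eq_mul]
    have hdiv : ∀ (r : ℝ) (c : ℂ), ℓ (c / r) = ℓ c / r := fun r c => by
      rw [div_eq_inv_mul, div_eq_inv_mul, ← Complex.ofReal_inv, hr]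
    have hm : TipSilentMode b.L b.At b.coupling b.rsq N (b.shearGain / b.B₃)
        (fun x => ℓ (w x)) (fun x => ℓ (z x)) (fun x => ℓ (p x)) (fun x => -(N * ℓ (q x)))
        (fun x => ℓ (b.shear g x)) (fun x => ℓ (b.shearRate g x)) :=
      { deriv_w := fun x hx => hd (dw x hx)
        deriv_z := fun x hx => hd (dz x hx)
        deriv_p := fun x hx => (hd (dp x hx)).congr_deriv (by
          rw [hdiv, _root_.map_sub, _root_.map_neg, hr, hr, _root_.map_sub, hr])
        deriv_Q := fun x hx => ((hd (dq x hx)).const_mul N).neg.congr_deriv (by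
          rw [_root_.map_neg]; ring)
        deriv_u := fun x hx => hd (b.hasDerivWithinAt_shear g hx)
        deriv_v := fun x hx => (hd (b.hasDerivWithinAt_shearRate g hx)).congr_deriv (by
          rw [_root_.map_sub, hr])
        w_zero := by simp [hw]
        z_zero := by simp [hz]
        u_zero := by simp [shear]
        p_end := by simp [hp, hq', shearRate]
        Q_end := by simp [hq]
        v_end := by simp [shearRate]
        tip := by
          rw [htip', neg_mul, _root_.map_neg, hr, neg_mul] }
    exact (hm.eq_zero hL b.zero_lt_At b.zero_lt_coupling b.zero_lt_rsq hN
      (div_pos b.zero_lt_shearGain b.B₃_pos).le hx).2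
  exact eq_zero_of_primitive_eq_zero b.L_pos fun x hx =>
    Complex.ext (key Complex.reCLM x hx) (key Complex.imCLM x hx)

end SmartBeam

/-! ### Energy coordinates -/

/-- A strictly positive bounded operator has an invertible symmetric square root. -/
theorem exists_symmetric_sqrt {E : Type*} [NormedAddCommGroup E] [InnerProductSpace ℂ E]
    [CompleteSpace E] {A : E →L[ℂ] E} {c : ℝ} (hc : 0 < c)
    (hsym : ∀ x y, inner ℂ (A x) y = inner ℂ x (A y))
    (hpos : ∀ x, c * ‖x‖ ^ 2 ≤ (inner ℂ x (A x)).re) :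
    ∃ B : E ≃L[ℂ] E, (∀ x y, inner ℂ (B x) y = inner ℂ x (B y)) ∧ ∀ x, B (B x) = A x := by
  have hA : 0 ≤ A := (ContinuousLinearMap.nonneg_iff_isPositive A).2 <| by
    refine ContinuousLinearMap.isPositive_def.2 ⟨hsym, fun x => ?_⟩
    rw [ContinuousLinearMap.reApplyInnerSelf_apply, hsym]
    exact (by positivity : 0 ≤ c * ‖x‖ ^ 2).trans (hpos x)
  have hunit : IsUnit A := by
    refine ContinuousLinearMap.isUnit_of_forall_le_norm_inner_map A (c := ⟨c, hc.le⟩) hc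
      fun x => ?_
    rw [hsym, mul_comm]
    exact (hpos x).trans (Complex.re_le_norm _)
  obtain ⟨u, hu⟩ := (CFC.isUnit_sqrt_iff A hA).2 hunit
  have hB : ∀ x, ContinuousLinearEquiv.ofUnit u x = CFC.sqrt A x := fun x => by
    rw [← hu]; rfl
  refine ⟨ContinuousLinearEquiv.ofUnit u, fun x y => ?_, fun x => ?_⟩
  · rw [hB, hB]
    exact ((ContinuousLinearMap.nonneg_iff_isPositive _).1
      (CFC.sqrt_nonneg A)).isSymmetric x y
  · rw [hB, hB]
    exact congrArg (fun D : E →L[ℂ] E => D x) (CFC.sqrt_mul_sqrt_self A hA)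

/-- The semigroup obtained by a linear change of coordinates. -/
noncomputable def C0Semigroup.conj {X Y : Type*} [NormedAddCommGroup X] [NormedSpace ℂ X]
    [NormedAddCommGroup Y] [NormedSpace ℂ Y] (T : C0Semigroup X) (e : X ≃L[ℂ] Y) :
    C0Semigroup Y where
  S t := (e : X →L[ℂ] Y).comp ((T.S t).comp (e.symm : Y →L[ℂ] X))
  map_zero := by rw [T.map_zero]; ext y; simp
  map_add s t hs ht := by rw [T.map_add s t hs ht]; ext y; simp
  continuous_zero y := by
    have h := (e.continuous.tendsto _).comp (T.continuous_zero (e.symm y))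
    rw [e.apply_symm_apply] at h
    exact h

theorem C0Semigroup.IsGeneratedBy.conj {X Y : Type*} [NormedAddCommGroup X] [NormedSpace ℂ X]
    [NormedAddCommGroup Y] [NormedSpace ℂ Y] {T : C0Semigroup X} {G : X → X → Prop}
    {G' : Y → Y → Prop} (hT : T.IsGeneratedBy G) (e : X ≃L[ℂ] Y)
    (hG : ∀ x y, G x y ↔ G' (e x) (e y)) : (T.conj e).IsGeneratedBy G' := by
  intro x y
  have h1 := hG (e.symm x) (e.symm y)
  rw [e.apply_symm_apply, e.apply_symm_apply] at h1
  rw [← h1, hT]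
  have h2 : ∀ t : ℝ, (t : ℂ)⁻¹ • ((T.conj e).S t x - x) =
      e ((t : ℂ)⁻¹ • (T.S t (e.symm x) - e.symm x)) := fun t => by
    rw [map_smul, _root_.map_sub, e.apply_symm_apply]; rfl
  simp only [h2]
  refine e.toHomeomorph.isInducing.tendsto_nhds_iff.trans ?_
  change Tendsto (fun t : ℝ => e _) _ (𝓝 (e (e.symm y))) ↔ _
  rw [e.apply_symm_apply]

/-- The isomorphism of `H²_L(0, L)` onto `L²(0, L)` given by `w ↦ w_xx`. -/
noncomputable def H2L.dxxEquiv (L : ℝ) : H2L L ≃L[ℂ] L2I L :=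
  ContinuousLinearEquiv.equivOfInverse
    (((ContinuousLinearMap.snd ℂ _ _).comp (ContinuousLinearMap.snd ℂ _ _)).comp (H2L L).subtypeL)
    (((((L2I.volterra L).comp (L2I.volterra L)).prod
      ((L2I.volterra L).prod (ContinuousLinearMap.id ℂ _)))).codRestrict (H2L L)
        fun _ => ⟨isPrimitive_iff.2 rfl, isPrimitive_iff.2 rfl⟩)
    (fun w => Subtype.ext <| by
      obtain ⟨⟨w, w', w''⟩, h1, h2⟩ := w
      rw [isPrimitive_iff] at h1 h2
      simp only at h1 h2
      subst h2; subst h1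
      rfl)
    (fun _ => rfl)

theorem H2L.dxxEquiv_apply {L : ℝ} (w : H2L L) : H2L.dxxEquiv L w = H2L.dxx w := rfl

theorem H2L.val_eq {L : ℝ} (w : H2L L) :
    H2L.val w = L2I.volterra L (L2I.volterra L (H2L.dxx w)) := by
  obtain ⟨w, h1, h2⟩ := w
  rw [isPrimitive_iff] at h1 h2
  exact h1.trans (congrArg _ h2)

/-! ### The closed-loop beam as an abstract beam equation -/

namespace SmartBeam

variable (b : SmartBeam)

open L2I

theorem exists_bendingSqrt : ∃ B : L2I b.L ≃L[ℂ] L2I b.L,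
    (∀ x y, inner ℂ (B x) y = inner ℂ x (B y)) ∧ ∀ x, B (B x) = b.bendingOp x :=
  exists_symmetric_sqrt b.zero_lt_At b.inner_bendingOp_left b.re_inner_bendingOp_self

/-- The square root of the bending operator. -/
noncomputable def bendingSqrt : L2I b.L ≃L[ℂ] L2I b.L := b.exists_bendingSqrt.choose

theorem inner_bendingSqrt_left (f g : L2I b.L) :
    inner ℂ (b.bendingSqrt f) g = inner ℂ f (b.bendingSqrt g) :=
  b.exists_bendingSqrt.choose_spec.1 f g

theorem bendingSqrt_bendingSqrt (f : L2I b.L) : b.bendingSqrt (b.bendingSqrt f) = b.bendingOp f :=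
  b.exists_bendingSqrt.choose_spec.2 f

theorem sqrt_m_ne_zero : ((√b.m : ℝ) : ℂ) ≠ 0 := by
  exact_mod_cast (Real.sqrt_pos.2 b.m_pos).ne'

theorem sqrt_m_mul_self : ((√b.m : ℝ) : ℂ) * (√b.m : ℝ) = b.m := by
  exact_mod_cast Real.mul_self_sqrt b.m_pos.le

/-- Multiplication by `√m`. -/
noncomputable def massSqrt : L2I b.L ≃L[ℂ] L2I b.L :=
  ContinuousLinearEquiv.smulLeft (Units.mk0 ((√b.m : ℝ) : ℂ) b.sqrt_m_ne_zero)

/-- The coordinates `(w, v) ↦ (B w_xx, √m v)`, with `B` the square root of the bending operator,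
in which the energy is half the square of the Hilbert norm. -/
noncomputable def energyCoord : BeamState b.L ≃L[ℂ] WithLp 2 (L2I b.L × L2I b.L) :=
  (((H2L.dxxEquiv b.L).trans b.bendingSqrt).prodCongr b.massSqrt).trans
    (WithLp.prodContinuousLinearEquiv 2 ℂ (L2I b.L) (L2I b.L)).symm

theorem energyCoord_fst (Φ : BeamState b.L) :
    (b.energyCoord Φ).fst = b.bendingSqrt (H2L.dxx Φ.1) := rfl

theorem energyCoord_snd (Φ : BeamState b.L) :
    (b.energyCoord Φ).snd = ((√b.m : ℝ) : ℂ) • Φ.2 := rfl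

theorem energy_eq (Φ : BeamState b.L) : b.energy Φ = 1 / 2 * ‖b.energyCoord Φ‖ ^ 2 := by
  have h1 : ∫ x in (0 : ℝ)..b.L, ‖Φ.2 x‖ ^ 2 = ‖Φ.2‖ ^ 2 := by
    have h2 := L2.inner_def (𝕜 := ℂ) Φ.2 Φ.2
    simp only [inner_self_eq_ofReal] at h2
    rw [intervalIntegral.integral_of_le b.L_pos.le]
    exact_mod_cast h2.symm
  rw [energy, h1, stiffness_eq_inner, ← bendingSqrt_bendingSqrt, ← inner_bendingSqrt_left,
    inner_self_eq_ofReal, Complex.ofReal_re, WithLp.prod_norm_sq_eq_of_L2, energyCoord_fst,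
    energyCoord_snd, norm_smul, mul_pow, Complex.norm_real, Real.norm_eq_abs, sq_abs,
    Real.sq_sqrt b.m_pos.le]
  ring

/-- The operator taking the energy coordinate `B w_xx` to `√m w`. -/
noncomputable def displacementOp : L2I b.L →L[ℂ] L2I b.L :=
  ((√b.m : ℝ) : ℂ) • (((volterra b.L).comp (volterra b.L)).comp
    (b.bendingSqrt.symm : L2I b.L →L[ℂ] L2I b.L))

theorem displacementOp_apply (g : L2I b.L) : b.displacementOp g =
    ((√b.m : ℝ) : ℂ) • volterra b.L (volterra b.L (b.bendingSqrt.symm g)) := rfl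

theorem inner_bendingSqrt_symm_left (f g : L2I b.L) :
    inner ℂ (b.bendingSqrt.symm f) g = inner ℂ f (b.bendingSqrt.symm g) := by
  conv_rhs => rw [← b.bendingSqrt.apply_symm_apply f]
  rw [inner_bendingSqrt_left, ContinuousLinearEquiv.apply_symm_apply]

theorem adjoint_displacementOp : b.displacementOp.adjoint = ((√b.m : ℝ) : ℂ) •
    ((b.bendingSqrt.symm : L2I b.L →L[ℂ] L2I b.L).comp
      ((volterra b.L).adjoint.comp (volterra b.L).adjoint)) := by
  symm
  rw [ContinuousLinearMap.eq_adjoint_iff]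
  intro f g
  rw [displacementOp_apply, inner_smul_right, _root_.smul_apply, inner_smul_left,
    Complex.conj_ofReal]
  simp only [ContinuousLinearMap.comp_apply, ContinuousLinearEquiv.coe_coe]
  rw [inner_bendingSqrt_symm_left, ContinuousLinearMap.adjoint_inner_left,
    ContinuousLinearMap.adjoint_inner_left]

theorem adjoint_displacementOp_apply (f : L2I b.L) : b.displacementOp.adjoint f =
    ((√b.m : ℝ) : ℂ) • b.bendingSqrt.symm ((volterra b.L).adjoint ((volterra b.L).adjoint f)) := by
  rw [adjoint_displacementOp]; rfl

theorem isCompactOperator_displacementOp : IsCompactOperator b.displacementOp :=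
  (((isCompactOperator_volterra b.L_pos).clm_comp (volterra b.L)).comp_clm
    (b.bendingSqrt.symm : L2I b.L →L[ℂ] L2I b.L)).smul ((√b.m : ℝ) : ℂ)

theorem isCompactOperator_adjoint_displacementOp : IsCompactOperator b.displacementOp.adjoint := by
  rw [adjoint_displacementOp]
  exact (((isCompactOperator_adjoint_volterra b.L_pos).clm_comp (volterra b.L).adjoint).clm_comp
    (b.bendingSqrt.symm : L2I b.L →L[ℂ] L2I b.L)).smul ((√b.m : ℝ) : ℂ)

theorem displacementOp_injective {g : L2I b.L} (h : b.displacementOp g = 0) : g = 0 := by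
  rw [displacementOp_apply, smul_eq_zero_iff_right b.sqrt_m_ne_zero] at h
  exact (map_eq_zero_iff _ b.bendingSqrt.symm.injective).1
    (volterra_injective b.L_pos (volterra_injective b.L_pos h))

theorem adjoint_displacementOp_injective {g : L2I b.L} (h : b.displacementOp.adjoint g = 0) :
    g = 0 := by
  rw [adjoint_displacementOp_apply, smul_eq_zero_iff_right b.sqrt_m_ne_zero,
    map_eq_zero_iff _ b.bendingSqrt.symm.injective] at h
  exact adjoint_volterra_injective b.L_pos (adjoint_volterra_injective b.L_pos h)

/-- The tip vector in energy coordinates. -/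
noncomputable def energyTipVector : L2I b.L := b.bendingSqrt.symm b.tipVector

theorem inner_energyTipVector (g : L2I b.L) : inner ℂ b.energyTipVector g =
    inner ℂ b.tipVector (b.bendingSqrt.symm g) := b.inner_bendingSqrt_symm_left _ _

/-- The undamped beam has no nonzero mode with vanishing tip output. -/
theorem eq_zero_of_silent {ω : ℝ} (hω : ω ≠ 0) {a : L2I b.L}
    (ha : a = ((ω ^ 2 : ℝ) : ℂ) • b.displacementOp.adjoint (b.displacementOp a))
    (htip : inner ℂ b.energyTipVector a = 0) : a = 0 := by
  rw [inner_energyTipVector] at htip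
  obtain ⟨g, rfl⟩ := b.bendingSqrt.surjective a
  rw [ContinuousLinearEquiv.symm_apply_apply] at htip
  have hm := b.m_pos
  have h := congrArg b.bendingSqrt ha
  rw [adjoint_displacementOp_apply, displacementOp_apply, ContinuousLinearEquiv.symm_apply_apply,
    bendingSqrt_bendingSqrt, map_smul, map_smul, map_smul, map_smul, map_smul, map_smul,
    ContinuousLinearEquiv.apply_symm_apply, smul_smul, smul_smul, mul_assoc, b.sqrt_m_mul_self,
    ← Complex.ofReal_mul] at h
  rw [b.eq_zero_of_mode (by positivity) h htip, map_zero]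

/-- In energy coordinates the closed-loop operator is an abstract damped system. -/
theorem closedLoop_iff {k₁ : ℝ} (Φ Ψ : BeamState b.L) : b.closedLoop k₁ Φ Ψ ↔
    abstractBeamGraph b.displacementOp (b.γ * k₁ / b.B₄) b.energyTipVector
      (b.energyCoord Φ) (b.energyCoord Ψ) := by
  set g := H2L.dxx Φ.1 with hg
  set g' := H2L.dxx Ψ.1 with hg'
  unfold closedLoop abstractBeamGraph
  rw [energyCoord_snd, energyCoord_fst, energyCoord_snd, energyCoord_fst, displacementOp_apply,
    ContinuousLinearEquiv.symm_apply_apply, ← H2L.val_eq, inner_energyTipVector,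
    ContinuousLinearEquiv.symm_apply_apply, map_smul, adjoint_displacementOp_apply,
    (smul_right_injective _ b.sqrt_m_ne_zero).eq_iff]
  refine and_congr eq_comm ?_
  -- The weak form says that the residual `F` is orthogonal to `ψ_xx` for all `ψ`, that is, `F = 0`.
  set F : L2I b.L := (b.m : ℂ) • (volterra b.L).adjoint ((volterra b.L).adjoint Ψ.2) +
    b.bendingOp g + (((b.γ * k₁ / b.B₄ : ℝ) : ℂ) * inner ℂ b.tipVector g') • b.tipVector with hF
  have h1 : ∀ ψ : H2L b.L,
      (b.m : ℂ) * (∫ x in (0 : ℝ)..b.L, Ψ.2 x * conj (H2L.val ψ x)) + b.stiffness Φ.1 ψ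
      = ((b.γ / b.B₄ : ℝ) : ℂ) * b.voltage k₁ Ψ.1 * conj (b.tipOutput ψ) ↔
      inner ℂ (H2L.dxx ψ) F = 0 := by
    intro ψ
    have h2 : ∫ x in (0 : ℝ)..b.L, Ψ.2 x * conj (H2L.val ψ x) = inner ℂ (H2L.dxx ψ)
        ((volterra b.L).adjoint ((volterra b.L).adjoint Ψ.2)) := by
      rw [ContinuousLinearMap.adjoint_inner_right, ContinuousLinearMap.adjoint_inner_right,
        ← H2L.val_eq, L2.inner_def, intervalIntegral.integral_of_le b.L_pos.le]
      rfl
    rw [h2, stiffness_eq_inner, voltage, tipOutput_eq_inner, tipOutput_eq_inner, inner_conj_symm,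
      hF, inner_add_right, inner_add_right, inner_smul_right, inner_smul_right, ← hg, ← hg',
      ← sub_eq_zero]
    refine Eq.congr ?_ rfl
    push_cast; ring
  have h3 : (∀ ψ : H2L b.L, inner ℂ (H2L.dxx ψ) F = 0) ↔ F = 0 := by
    refine ⟨fun h => ?_, fun h ψ => by rw [h, inner_zero_right]⟩
    obtain ⟨ψ, hψ⟩ := (H2L.dxxEquiv b.L).surjective F
    have := h ψ
    rwa [← H2L.dxxEquiv_apply, hψ, inner_self_eq_zero] at this
  rw [forall_congr' h1, h3, ← map_eq_zero_iff _ b.bendingSqrt.symm.injective]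
  refine Eq.congr ?_ rfl
  rw [hF, _root_.map_add, _root_.map_add, map_smul, map_smul, ← bendingSqrt_bendingSqrt,
    ContinuousLinearEquiv.symm_apply_apply, smul_smul, b.sqrt_m_mul_self]
  rfl

end SmartBeam

theorem mainTheorem2 (b : SmartBeam) (k₁ : ℝ) (hk₁ : 0 < k₁) :
    (∃ T : C0Semigroup (BeamState b.L), T.IsGeneratedBy (b.closedLoop k₁)) ∧
    ∀ T : C0Semigroup (BeamState b.L), T.IsGeneratedBy (b.closedLoop k₁) →
      ∀ Φ₀ : BeamState b.L,
        Tendsto (fun t : ℝ => T.S t Φ₀) atTop (𝓝 0) ∧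
        Tendsto (fun t : ℝ => b.energy (T.S t Φ₀)) atTop (𝓝 0) := by
  obtain ⟨⟨T', hT'⟩, hstable⟩ := abstractBeam_stable b.isCompactOperator_displacementOp
    b.isCompactOperator_adjoint_displacementOp (fun _ => b.displacementOp_injective)
    (fun _ => b.adjoint_displacementOp_injective)
    (div_pos (mul_pos b.γ_pos hk₁) b.B₄_pos) (fun _ _ hω => b.eq_zero_of_silent hω)
  refine ⟨⟨T'.conj b.energyCoord.symm, hT'.conj _ fun x y => ?_⟩, fun T hT Φ₀ => ?_⟩
  · rw [SmartBeam.closedLoop_iff, ContinuousLinearEquiv.apply_symm_apply,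
      ContinuousLinearEquiv.apply_symm_apply]
  · have h1 := hstable _ (hT.conj b.energyCoord b.closedLoop_iff) (b.energyCoord Φ₀)
    have h2 : ∀ t, (T.conj b.energyCoord).S t (b.energyCoord Φ₀) = b.energyCoord (T.S t Φ₀) :=
      fun t => congrArg (fun Φ => b.energyCoord (T.S t Φ))
        (b.energyCoord.symm_apply_apply Φ₀)
    simp only [h2] at h1
    constructor
    · have h3 := (b.energyCoord.symm.continuous.tendsto 0).comp h1
      simpa [Function.comp_def] using h3
    · have h3 := (h1.norm.pow 2).const_mul (1 / 2)
      simpa [SmartBeam.energy_eq] using h3
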